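/- Let $F$ be a field and $A$ a central simple $F$-algebra of degree $n$, i.e. $\dim_F A=n^2$. Let $X=\mathrm{SB}(A)$ be its Severi--Brauer variety: the $F$-scheme representing the functor that sends a commutative $F$-algebra $R$ to the set of right ideals $N\subset R\otimes_F A$ such that $(R\otimes_F A)/N$ is a finitely generated projective $R$-module of constant rank $n^2-n$ (right ideals of reduced dimension $1$). Let $\mathcal I\subset \mathcal O_X\otimes_F A$ be the tautological sheaf of right ideals, i.e. the $\mathcal O_X$-submodule whose sections are those sections of $\mathcal O_X\otimes_F A$ whose germ at each point $x$ lies in the right ideal of $\mathcal O_{X,x}\otimes_F A$ corresponding to the canonical morphism $\operatorname{Spec}\mathcal O_{X,x}\to X$, and put \[\mathcal T=\mathcal O_X\oplus\mathcal I\oplus\mathcal I^{\otimes 2}\oplus\dots\oplus\mathcal I^{\otimes(n-1)}\] (tensor powers over $\mathcal O_X$). Then $\mathcal T$ is quasi-coherent and, regarded as a complex concentrated in degree $0$, it generates the unbounded derived category $D(\operatorname{Qcoh}(X))$ of the abelian category of quasi-coherent sheaves on $X$: if $\mathcal M\in D(\operatorname{Qcoh}(X))$ satisfies $\operatorname{Hom}_{D(\operatorname{Qcoh}(X))}(\mathcal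 T[i],\mathcal M)=0$ for all $i\in\mathbb Z$ (that is, $\operatorname{RHom}(\mathcal T,\mathcal M)=0$), then $\mathcal M=0$. -/

import Mathlib

open CategoryTheory Limits AlgebraicGeometry TopologicalSpace Opposite TensorProduct

universe u w

noncomputable section

namespace SB


/-- The property of being a quasi-coherent sheaf of modules on a scheme. -/
def isQcoh (X : Scheme.{u}) : ObjectProperty X.Modules :=
  fun M => SheafOfModules.IsQuasicoherent M

/-- Sections over an open subset, as a functor to abelian groups. -/
def evalAb {X : Scheme.{u}} (U : X.Opens) : X.Modules ⥤ Ab.{u} :=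
  Scheme.Modules.toPresheaf X ⋙ (evaluation (Opens X)ᵒᵖ Ab.{u}).obj (op U)

instance {X : Scheme.{u}} (U : X.Opens) : PreservesFiniteLimits (evalAb U) :=
  have : PreservesFiniteLimits (Scheme.Modules.toPresheaf X) :=
    PreservesLimitsOfSize.preservesFiniteLimits.{u,u} _
  have : PreservesFiniteLimits ((evaluation (Opens X)ᵒᵖ Ab.{u}).obj (op U)) := inferInstance
  comp_preservesFiniteLimits _ _

instance {X : Scheme.{u}} (U : X.Opens) : (evalAb U).PreservesZeroMorphisms where
  map_zero _ _ := rfl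

lemma exact_app {X : Scheme.{u}} {M N : X.Modules} (φ : M ⟶ N) (k : KernelFork φ)
    (hk : IsLimit k) (U : X.Opens) :
    Function.Injective (k.ι.app U) ∧ ∀ x : Γ(M, U), φ.app U x = 0 → ∃ y, k.ι.app U y = x := by
  have h := (KernelFork.isLimitMapConeEquiv k (evalAb U)) (isLimitOfPreserves (evalAb U) hk)
  have hm : Mono ((evalAb U).map k.ι) := Fork.IsLimit.mono h
  refine ⟨(AddCommGrpCat.mono_iff_injective _).1 hm, fun x hx => ?_⟩
  let S : ShortComplex Ab := ShortComplex.mk ((evalAb U).map k.ι) ((evalAb U).map φ)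
    (by rw [← Functor.map_comp, k.condition, Functor.map_zero])
  have hS : S.Exact := S.exact_of_f_is_kernel h
  exact (ShortComplex.ab_exact_iff S).1 hS x hx

lemma app_smul_Spec {R : CommRingCat.{u}} {M N : (Spec R).Modules} (φ : M ⟶ N)
    (U : (Spec R).Opens) (r : R) (x : Γ(M, U)) : φ.app U (r • x) = r • φ.app U x := by
  rw [Scheme.Modules.smul_Spec_def, Scheme.Modules.smul_Spec_def, Scheme.Modules.Hom.app_smul]

lemma app_res {X : Scheme.{u}} {M N : X.Modules} (φ : M ⟶ N) {U V : X.Opens} (i : U ⟶ V)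
    (x : Γ(M, V)) : φ.app U (M.presheaf.map i.op x) = N.presheaf.map i.op (φ.app V x) :=
  ConcreteCategory.congr_hom (φ.mapPresheaf.naturality i.op) x

/-- The basic open subset `D(f)` of `Spec R`. -/
def dOpen {R : CommRingCat.{u}} (f : R) : (Spec R).Opens := PrimeSpectrum.basicOpen f

/-- Restriction of global sections to `D(f)`. -/
def dRes {R : CommRingCat.{u}} (M : (Spec R).Modules) (f : R) (x : Γ(M, ⊤)) : Γ(M, dOpen f) :=
  M.presheaf.map (homOfLE (le_top : dOpen f ≤ ⊤)).op x

lemma isQcoh_spec_iff {R : CommRingCat.{u}} (M : (Spec R).Modules) : isQcoh _ M ↔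
    ∀ f : R, (∀ x : Γ(M, dOpen f), ∃ (n : ℕ) (t : Γ(M, ⊤)), f ^ n • x = dRes M f t) ∧
      ∀ t : Γ(M, ⊤), dRes M f t = 0 → ∃ n : ℕ, f ^ n • t = 0 := by
  refine (isQuasicoherent_iff_isIso_fromTildeΓ M).trans
    ((isIso_fromTildeΓ_iff_isLocalizing M).trans ?_)
  let φ (f : R) := ((modulesSpecToSheaf.obj M).obj.map (PrimeSpectrum.basicOpen f).leTop.op).hom
  refine ⟨fun h f => ?_, fun h f => IsLocalizedModule.Away.mk_of_addCommGroup ?_ ?_ ?_⟩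
  · have hf : IsLocalizedModule.Away f (φ f) := h f
    refine ⟨fun x => ?_, fun t ht => ?_⟩
    · obtain ⟨n, y, hy⟩ := hf.surj _ _ x
      exact ⟨n, y, hy⟩
    · obtain ⟨⟨_, n, rfl⟩, hn⟩ := (IsLocalizedModule.eq_zero_iff (.powers f) (φ f)).mp ht
      exact ⟨n, hn⟩
  · exact Scheme.Modules.isUnit_algebraMap_end_of_le_basicOpen f le_rfl
  · intro x
    obtain ⟨n, t, ht⟩ := (h f).1 x
    exact ⟨n, t, ht⟩
  · intro x hx
    obtain ⟨n, hn⟩ := (h f).2 x hx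
    exact ⟨n, hn⟩

lemma app_dRes {R : CommRingCat.{u}} {M N : (Spec R).Modules} (φ : M ⟶ N) (f : R)
    (x : Γ(M, ⊤)) : φ.app _ (dRes M f x) = dRes N f (φ.app _ x) :=
  app_res _ _ _

lemma dRes_smul {R : CommRingCat.{u}} (M : (Spec R).Modules) (f r : R)
    (x : Γ(M, ⊤)) : dRes M f (r • x) = r • dRes M f x :=
  Scheme.Modules.map_smul_Spec _ _ _

lemma isQcoh_kernel_spec {R : CommRingCat.{u}} {M N : (Spec R).Modules} {K : (Spec R).Modules}
    (ι : K ⟶ M) (φ : M ⟶ N) (w : ι ≫ φ = 0)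
    (hk : ∀ U, Function.Injective (ι.app U) ∧ ∀ x : Γ(M, U), φ.app U x = 0 → ∃ y, ι.app U y = x)
    (hM : isQcoh _ M) (hN : isQcoh _ N) : isQcoh _ K := by
  rw [isQcoh_spec_iff] at hM hN ⊢
  refine fun f => ⟨fun y => ?_, fun x hx => ?_⟩
  · obtain ⟨n, x, hx⟩ := (hM f).1 (ι.app _ y)
    have h0 : dRes N f (φ.app ⊤ x) = 0 := by
      rw [← app_dRes, ← hx, app_smul_Spec]
      have : φ.app _ (ι.app _ y) = 0 := by
        rw [← ConcreteCategory.comp_apply, ← Scheme.Modules.Hom.comp_app, w]; rfl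
      rw [this, smul_zero]
    obtain ⟨m, hm⟩ := (hN f).2 _ h0
    obtain ⟨z, hz⟩ := (hk ⊤).2 (f ^ m • x) (by rw [app_smul_Spec, hm])
    refine ⟨m + n, z, (hk _).1 ?_⟩
    rw [app_dRes, hz, app_smul_Spec, pow_add, mul_smul, hx, dRes_smul]
  · obtain ⟨n, hn⟩ := (hM f).2 (ι.app ⊤ x) (by
      have := app_dRes ι f x
      rw [hx, map_zero] at this
      exact this.symm)
    refine ⟨n, (hk _).1 ?_⟩
    rw [app_smul_Spec, hn, map_zero]

lemma isQcoh_iff_essImage {R : CommRingCat.{u}} (M : (Spec R).Modules) :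
    isQcoh _ M ↔ (tilde.functor R).essImage M := by
  rw [essImage_tilde]; rfl

lemma isQcoh_cokernel_spec {R : CommRingCat.{u}} {M N : (Spec R).Modules} (φ : M ⟶ N)
    (k : CokernelCofork φ) (hk : IsColimit k) (hM : isQcoh _ M) (hN : isQcoh _ N) :
    isQcoh _ k.pt := by
  rw [isQcoh_iff_essImage] at hM hN ⊢
  obtain ⟨M', ⟨eM⟩⟩ := hM
  obtain ⟨N', ⟨eN⟩⟩ := hN
  obtain ⟨g, hg⟩ := (tilde.functor R).map_surjective (eM.hom ≫ φ ≫ eN.inv)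
  let i : parallelPair ((tilde.functor R).map g) 0 ≅ parallelPair φ 0 :=
    parallelPair.ext eM eN (by rw [hg]; simp) (by simp)
  exact ⟨cokernel g, ⟨PreservesCokernel.iso (tilde.functor R) g ≪≫
    IsColimit.coconePointsIsoOfNatIso (colimit.isColimit _) hk i⟩⟩

lemma isQcoh_biprod_spec {R : CommRingCat.{u}} {M N : (Spec R).Modules}
    (hM : isQcoh _ M) (hN : isQcoh _ N) : isQcoh _ (M ⊞ N) := by
  rw [isQcoh_iff_essImage] at hM hN ⊢
  obtain ⟨M', ⟨eM⟩⟩ := hM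
  obtain ⟨N', ⟨eN⟩⟩ := hN
  have := preservesBinaryBiproducts_of_preservesBinaryCoproducts (tilde.functor R)
  exact ⟨M' ⊞ N', ⟨(tilde.functor R).mapBiprod M' N' ≪≫ biprod.mapIso eM eN⟩⟩

lemma isQcoh_of_iso {X : Scheme.{u}} {M N : X.Modules} (e : M ≅ N) (h : isQcoh _ M) :
    isQcoh _ N :=
  (SheafOfModules.isQuasicoherent X.ringCatSheaf).prop_of_iso e h

/-- Transport of a presentation along an isomorphism. -/
def presOfIso {X : Scheme.{u}} {M N : X.Modules} (e : M ≅ N)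
    (p : SheafOfModules.Presentation (R := X.ringCatSheaf) M) :
    SheafOfModules.Presentation (R := X.ringCatSheaf) N :=
  let f : @Quiver.Hom (SheafOfModules X.ringCatSheaf) _ M N := e.hom
  have : IsIso f := ⟨e.inv, e.hom_inv_id, e.inv_hom_id⟩
  SheafOfModules.Presentation.ofIsIso f p

lemma isQcoh_of_affine {X : Scheme.{u}} (M : X.Modules)
    (h : ∀ (U : X.Opens) (hU : IsAffineOpen U), isQcoh _ (M.restrict hU.fromSpec)) :
    isQcoh _ M := by
  have hp (U : X.Opens) (hU : IsAffineOpen U) : Nonempty (SheafOfModules.Presentation (M.over U)) := by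
    obtain ⟨N, ⟨e⟩⟩ := (isQcoh_iff_essImage _).1 (h U hU)
    have p : SheafOfModules.Presentation (tilde N) :=
      presentationTilde.{u} N .univ (by simp) _ (Submodule.span_eq _)
    have p1 := presOfIso e p
    have p2 := Scheme.Modules.presentationRestrict hU.isoSpec.hom p1
    let E : SheafOfModules (X.ringCatSheaf.over U) ≌ SheafOfModules U.toScheme.ringCatSheaf :=
      Scheme.Modules.overEquiv U
    let G := E.inverse
    let e1 : (M.restrict hU.fromSpec).restrict hU.isoSpec.hom ≅ M.restrict U.ι :=
      ((Scheme.Modules.restrictFunctorComp _ _).app M).symm ≪≫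
        (Scheme.Modules.restrictFunctorCongr (by simp)).app M
    let e2 : G.obj ((M.restrict hU.fromSpec).restrict hU.isoSpec.hom) ≅ M.over U :=
      G.mapIso (e1 ≪≫ ((Scheme.Modules.overFunctorEquiv U).app M).symm) ≪≫
        E.unitIso.symm.app _
    have p3 := p2.map G (E.unitIso.app (SheafOfModules.unit _))
    exact ⟨SheafOfModules.Presentation.ofIsIso e2.hom p3⟩
  refine (SheafOfModules.QuasicoherentData.mk (M := M) X.affineOpens (fun U => U.1) ?_
    fun U => (hp U.1 U.2).some).isQuasicoherent
  rw [Opens.coversTop_iff]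
  exact iSup_affineOpens_eq_top X


instance restrict_add {X Y : Scheme.{u}} (f : X ⟶ Y) [IsOpenImmersion f] :
    (Scheme.Modules.restrictFunctor f).Additive where

lemma isQcoh_restrict {X Y : Scheme.{u}} (f : X ⟶ Y) [IsOpenImmersion f] {M : Y.Modules}
    (hM : isQcoh _ M) : isQcoh _ (M.restrict f) :=
  have : SheafOfModules.IsQuasicoherent (R := Y.ringCatSheaf) M := hM
  Scheme.Modules.isQuasicoherent_restrictFunctor f M

instance (X : Scheme.{u}) : (isQcoh X).IsClosedUnderIsomorphisms where
  of_iso e h := isQcoh_of_iso e h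

instance (X : Scheme.{u}) : (isQcoh X).IsClosedUnderKernels where
  kernels_le := by
    rintro _ ⟨φ, k, hk, hM, hN⟩
    refine isQcoh_of_affine _ fun U hU => ?_
    let G := Scheme.Modules.restrictFunctor hU.fromSpec
    exact isQcoh_kernel_spec (G.map k.ι) (G.map φ)
      (by rw [← Functor.map_comp, k.condition, Functor.map_zero])
      (fun V => exact_app φ k hk (hU.fromSpec ''ᵁ V))
      (isQcoh_restrict _ hM) (isQcoh_restrict _ hN)

instance (X : Scheme.{u}) : (isQcoh X).IsClosedUnderCokernels where
  cokernels_le := by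
    rintro _ ⟨φ, k, hk, hM, hN⟩
    refine isQcoh_of_affine _ fun U hU => ?_
    let G := Scheme.Modules.restrictFunctor hU.fromSpec
    exact isQcoh_cokernel_spec (G.map φ) _
      ((CokernelCofork.isColimitMapCoconeEquiv k G) (isColimitOfPreserves G hk))
      (isQcoh_restrict _ hM) (isQcoh_restrict _ hN)

lemma isQcoh_biprod {X : Scheme.{u}} {M N : X.Modules}
    (hM : isQcoh _ M) (hN : isQcoh _ N) : isQcoh _ (M ⊞ N) := by
  refine isQcoh_of_affine _ fun U hU => ?_
  let G := Scheme.Modules.restrictFunctor hU.fromSpec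
  have := preservesBinaryBiproducts_of_preservesBinaryCoproducts G
  exact isQcoh_of_iso (G.mapBiprod M N).symm
    (isQcoh_biprod_spec (isQcoh_restrict _ hM) (isQcoh_restrict _ hN))

instance (X : Scheme.{u}) : (isQcoh X).ContainsZero where
  exists_zero := ⟨HasZeroObject.zero' X.Modules |>.zero, isZero_zero _, isQcoh_of_affine _ fun _ hU =>
    (isQcoh_iff_essImage _).2 ⟨ModuleCat.of _ PUnit, ⟨
      ((tilde.functor _).map_isZero (ModuleCat.isZero_of_subsingleton _)).iso
      ((Scheme.Modules.restrictFunctor hU.fromSpec).map_isZero (isZero_zero _))⟩⟩⟩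

instance (X : Scheme.{u}) : (isQcoh X).IsClosedUnderFiniteProducts := by
  have : (isQcoh X).IsClosedUnderBinaryProducts := ⟨by
    rintro Y ⟨p⟩
    let e : Y ≅ p.diag.obj ⟨.left⟩ ⊞ p.diag.obj ⟨.right⟩ :=
      IsLimit.conePointsIsoOfNatIso p.isLimit (BinaryBiproduct.isLimit _ _)
        (diagramIsoPair p.diag)
    exact isQcoh_of_iso e.symm (isQcoh_biprod (p.prop_diag_obj _) (p.prop_diag_obj _))⟩
  exact ObjectProperty.IsClosedUnderFiniteProducts.mk'

/-- The abelian category of quasi-coherent sheaves on a scheme. (It is a full subcategory of the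
category of all sheaves of modules, closed under kernels, cokernels and finite products; its abelian
structure is inferred from these closure properties.) -/
abbrev Qcoh (X : Scheme.{u}) := (isQcoh X).FullSubcategory

section
variable (F A : Type u) [Field F] [Ring A] [Algebra F A]

/-- For an `F`-algebra `A` of dimension `n ^ 2` and a commutative `F`-algebra `R`: the right ideals
`N` of `R ⊗ A` for which `(R ⊗ A) / N` is a finitely generated projective `R`-module of constant rank
`n ^ 2 - n`, that is, the right ideals which are `R`-direct summands of constant rank `n`. For a field
`R` and `A` central simple these are the right ideals of reduced dimension `1`. -/
structure RightIdealPoint (n : ℕ) (R : Type u) [CommRing R] [Algebra F R] extends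
    Module.Grassmannian R (R ⊗[F] A) (n ^ 2 - n) where
  mul_mem : ∀ x ∈ toSubmodule, ∀ y : R ⊗[F] A, x * y ∈ toSubmodule

/-- A Severi-Brauer variety of the `F`-algebra `A` of dimension `n ^ 2`: an `F`-scheme `X` which
represents the functor of right ideals of reduced dimension `1`, that is, with bijections, natural in
the commutative `F`-algebra `R`, between the `F`-morphisms `Spec R ⟶ X` and the right ideals of
`R ⊗ A` which are direct summands of rank `n`. It is unique up to a unique isomorphism. -/
structure SeveriBrauer (n : ℕ) where
  /-- the underlying scheme -/
  X : Scheme.{u}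
  /-- the structure morphism -/
  structMap : X ⟶ Spec (CommRingCat.of F)
  /-- the right ideal that corresponds to an `R`-valued point -/
  points (R : Type u) [CommRing R] [Algebra F R] :
    {f : Spec (CommRingCat.of R) ⟶ X //
      f ≫ structMap = Spec.map (CommRingCat.ofHom (algebraMap F R))} ≃ RightIdealPoint F A n R
  /-- naturality: composition with `Spec R' ⟶ Spec R` corresponds to base change of ideals -/
  points_map {R R' : Type u} [CommRing R] [Algebra F R] [CommRing R'] [Algebra F R']
    (φ : R →ₐ[F] R') (f : Spec (CommRingCat.of R) ⟶ X)
    (hf : f ≫ structMap = Spec.map (CommRingCat.ofHom (algebraMap F R)))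
    (hf' : (Spec.map (CommRingCat.ofHom φ.toRingHom) ≫ f) ≫ structMap =
      Spec.map (CommRingCat.ofHom (algebraMap F R'))) :
    (points R' ⟨Spec.map (CommRingCat.ofHom φ.toRingHom) ≫ f, hf'⟩).toGrassmannian =
      Module.Grassmannian.map φ (points R ⟨f, hf⟩).toGrassmannian
end

namespace SeveriBrauer
variable {F A : Type u} [Field F] [Ring A] [Algebra F A] {n : ℕ} (S : SeveriBrauer F A n)

instance (U : S.X.Opens) : Algebra F Γ(S.X, U) :=
  ((Scheme.ΓSpecIso (CommRingCat.of F)).inv ≫ S.structMap.appTop ≫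
    S.X.presheaf.map (homOfLE (le_top : U ≤ ⊤)).op).hom.toAlgebra

instance (x : S.X) : Algebra F (S.X.presheaf.stalk x) :=
  ((Scheme.ΓSpecIso (CommRingCat.of F)).inv ≫ S.structMap.appTop ≫
    S.X.presheaf.germ ⊤ x trivial).hom.toAlgebra

/-- Restriction of functions, as an `F`-algebra map. -/
def res {U V : S.X.Opens} (h : V ≤ U) : Γ(S.X, U) →ₐ[F] Γ(S.X, V) where
  __ := (S.X.presheaf.map (homOfLE h).op).hom
  commutes' a := by
    have : (S.X.presheaf.map (homOfLE (le_top : U ≤ ⊤)).op) ≫ S.X.presheaf.map (homOfLE h).op =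
      S.X.presheaf.map (homOfLE (le_top : V ≤ ⊤)).op := by rw [← Functor.map_comp]; rfl
    exact congr($this (S.structMap.appTop ((Scheme.ΓSpecIso (CommRingCat.of F)).inv a)))

/-- The germ of functions at a point, as an `F`-algebra map. -/
def germ {U : S.X.Opens} (x : S.X) (hx : x ∈ U) : Γ(S.X, U) →ₐ[F] S.X.presheaf.stalk x where
  __ := (S.X.presheaf.germ U x hx).hom
  commutes' a := by
    have := S.X.presheaf.germ_res (homOfLE (le_top : U ≤ ⊤)) x hx
    exact congr($this (S.structMap.appTop ((Scheme.ΓSpecIso (CommRingCat.of F)).inv a)))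

lemma germ_comp_res {U V : S.X.Opens} (h : V ≤ U) (x : S.X) (hx : x ∈ V) :
    (S.germ x hx).comp (S.res h) = S.germ x (h hx) := by
  ext a
  exact congr($(S.X.presheaf.germ_res (homOfLE h) x hx) a)

lemma fromSpecStalk_structMap (x : S.X) : S.X.fromSpecStalk x ≫ S.structMap =
    Spec.map (CommRingCat.ofHom (algebraMap F (S.X.presheaf.stalk x))) := by
  refine ext_of_isAffine ?_
  have h : Spec.map (CommRingCat.ofHom (algebraMap F (S.X.presheaf.stalk x))) =
      Spec.map ((Scheme.ΓSpecIso (CommRingCat.of F)).inv ≫ S.structMap.appTop ≫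
        S.X.presheaf.germ ⊤ x trivial) := rfl
  rw [h, Scheme.Hom.comp_appTop, Scheme.fromSpecStalk_appTop,
    ← cancel_epi (Scheme.ΓSpecIso (CommRingCat.of F)).inv, ← Scheme.ΓSpecIso_inv_naturality]
  have h' : (Spec (S.X.presheaf.stalk x)).presheaf.map
      (homOfLE (le_top : (⊤ : (Spec (S.X.presheaf.stalk x)).Opens) ≤ ⊤)).op = 𝟙 _ :=
    (Spec (S.X.presheaf.stalk x)).presheaf.map_id _
  simp only [Category.assoc]
  erw [h', Category.comp_id]

/-- The right ideal of `𝒪_{X,x} ⊗ A` that corresponds to the canonical morphism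
`Spec 𝒪_{X,x} ⟶ X`. -/
def idealAt (x : S.X) : Submodule (S.X.presheaf.stalk x) (S.X.presheaf.stalk x ⊗[F] A) :=
  (S.points (S.X.presheaf.stalk x)
    ⟨S.X.fromSpecStalk x, S.fromSpecStalk_structMap x⟩).toSubmodule

lemma rTensor_smul {R R' : Type u} [CommRing R] [CommRing R'] [Algebra F R] [Algebra F R']
    (φ : R →ₐ[F] R') (r : R) (s : R ⊗[F] A) :
    φ.toLinearMap.rTensor A (r • s) = φ r • φ.toLinearMap.rTensor A s := by
  induction s with
  | zero => simp
  | tmul a b => simp [smul_tmul']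
  | add a b ha hb => simp only [smul_add, map_add, ha, hb]

lemma rTensor_comp {R R' R'' : Type u} [CommRing R] [CommRing R'] [CommRing R''] [Algebra F R]
    [Algebra F R'] [Algebra F R''] (φ : R →ₐ[F] R') (ψ : R' →ₐ[F] R'') (s : R ⊗[F] A) :
    ψ.toLinearMap.rTensor A (φ.toLinearMap.rTensor A s) =
      (ψ.comp φ).toLinearMap.rTensor A s := by
  rw [← LinearMap.comp_apply, ← LinearMap.rTensor_comp]
  rfl

lemma repr_rTensor {ι R R' : Type u} [CommRing R] [CommRing R'] [Algebra F R] [Algebra F R']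
    (b : Module.Basis ι F A) (φ : R →ₐ[F] R') (s : R ⊗[F] A) (j : ι) :
    (b.baseChange R').repr (φ.toLinearMap.rTensor A s) j = φ ((b.baseChange R).repr s j) := by
  induction s with
  | zero => simp
  | tmul a b => simp [Algebra.smul_def]
  | add a b ha hb => simp only [map_add, Finsupp.add_apply, ha, hb]

/-- The sections over `U` of the tautological subsheaf of `𝒪_X ⊗ A`: those whose germ at each
point `x` of `U` lies in the right ideal given by `x`. -/
def tautSections (U : S.X.Opens) : Submodule Γ(S.X, U) (Γ(S.X, U) ⊗[F] A) where
  carrier := {s | ∀ (x : S.X) (hx : x ∈ U), (S.germ x hx).toLinearMap.rTensor A s ∈ S.idealAt x}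
  add_mem' hs ht x hx := by
    rw [map_add]
    exact add_mem (hs x hx) (ht x hx)
  zero_mem' x hx := by
    rw [map_zero]
    exact zero_mem _
  smul_mem' r s hs x hx := by
    rw [rTensor_smul]
    exact Submodule.smul_mem _ _ (hs x hx)

/-- Restriction of sections of the tautological sheaf. -/
def tautRes {U V : S.X.Opens} (h : V ≤ U) : S.tautSections U →+ S.tautSections V where
  toFun s := ⟨(S.res h).toLinearMap.rTensor A s.1, fun x hx => by
    rw [rTensor_comp, germ_comp_res]
    exact s.2 x (h hx)⟩
  map_zero' := by ext; simp
  map_add' s t := by ext; simp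

/-- The tautological sheaf as a presheaf of abelian groups. -/
def tautPresheafAb : TopCat.Presheaf Ab.{u} S.X where
  obj U := AddCommGrpCat.of (S.tautSections U.unop)
  map f := AddCommGrpCat.ofHom (S.tautRes (leOfHom f.unop))
  map_id U := by
    refine AddCommGrpCat.ext fun s => Subtype.ext ?_
    have : S.res (le_refl U.unop) = AlgHom.id _ _ := by
      ext a; exact congr($(S.X.presheaf.map_id U) a)
    change (S.res _).toLinearMap.rTensor A s.1 = s.1
    rw [this]
    simp
  map_comp {U V W} f g := by
    refine AddCommGrpCat.ext fun s => Subtype.ext ?_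
    change (S.res _).toLinearMap.rTensor A s.1 =
      (S.res _).toLinearMap.rTensor A ((S.res _).toLinearMap.rTensor A s.1)
    rw [rTensor_comp]
    congr
    ext a; exact congr($(S.X.presheaf.map_comp f g) a)

instance (U : (Opens S.X)ᵒᵖ) : Module (S.X.ringCatSheaf.obj.obj U) (S.tautPresheafAb.obj U) :=
  inferInstanceAs (Module Γ(S.X, U.unop) (S.tautSections U.unop))

/-- The tautological sheaf as a presheaf of modules. -/
def tautPresheaf : PresheafOfModules S.X.ringCatSheaf.obj :=
  .ofPresheaf S.tautPresheafAb fun U V f r m => by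
    refine Subtype.ext ?_
    exact rTensor_smul (S.res (leOfHom f.unop)) r m.1

lemma tautPresheafAb_isSheaf [FiniteDimensional F A] : S.tautPresheafAb.IsSheaf := by
  rw [TopCat.Presheaf.isSheaf_iff_isSheafUniqueGluing]
  intro ι U sf hsf
  let b := Module.Free.chooseBasis F A
  have hc (j) : TopCat.Presheaf.IsCompatible S.X.presheaf U
      (fun i => (b.baseChange Γ(S.X, U i)).repr (sf i).1 j) := by
    intro i k
    have h1 := repr_rTensor b (S.res (inf_le_left : U i ⊓ U k ≤ U i)) (sf i).1 j
    have h2 := repr_rTensor b (S.res (inf_le_right : U i ⊓ U k ≤ U k)) (sf k).1 j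
    have h3 : (S.res (inf_le_left : U i ⊓ U k ≤ U i)).toLinearMap.rTensor A (sf i).1 =
      (S.res (inf_le_right : U i ⊓ U k ≤ U k)).toLinearMap.rTensor A (sf k).1 :=
      congrArg Subtype.val (hsf i k)
    rw [h3] at h1
    exact h1.symm.trans h2
  have hg (j) := S.X.sheaf.existsUnique_gluing U _ (hc j)
  choose g hg1 hg2 using hg
  let s : Γ(S.X, iSup U) ⊗[F] A := (b.baseChange _).repr.symm (Finsupp.equivFunOnFinite.symm g)
  have hs (j) : (b.baseChange _).repr s j = g j := by
    rw [LinearEquiv.apply_symm_apply]; rfl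
  have hr (i) : (S.res (le_iSup U i)).toLinearMap.rTensor A s = (sf i).1 := by
    apply (b.baseChange _).repr.injective
    ext j
    rw [repr_rTensor, hs]
    exact hg1 j i
  refine ⟨⟨s, fun x hx => ?_⟩, fun i => Subtype.ext (hr i), fun t ht => Subtype.ext ?_⟩
  · obtain ⟨i, hi⟩ := Opens.mem_iSup.1 hx
    rw [← S.germ_comp_res (le_iSup U i) x hi, ← rTensor_comp, hr]
    exact (sf i).2 x hi
  · apply (b.baseChange _).repr.injective
    ext j
    rw [hs]
    refine hg2 j _ fun i => ?_
    have h1 := repr_rTensor b (S.res (le_iSup U i)) t.1 j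
    have h2 : (S.res (le_iSup U i)).toLinearMap.rTensor A t.1 = (sf i).1 :=
      congrArg Subtype.val (ht i)
    rw [h2] at h1
    exact h1.symm

/-- The tautological sheaf `ℐ`, a sheaf of `𝒪_X`-submodules of `𝒪_X ⊗ A`. -/
def taut [FiniteDimensional F A] : S.X.Modules where
  val := S.tautPresheaf
  isSheaf := S.tautPresheafAb_isSheaf

end SeveriBrauer

/-- The tensor product over `𝒪_X`: the sheaf associated with `U ↦ M(U) ⊗ N(U)`. -/
def tensorObj {X : Scheme.{u}} (M N : X.Modules) : X.Modules :=
  (PresheafOfModules.sheafification (𝟙 X.ringCatSheaf.obj)).obj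
    (PresheafOfModules.Monoidal.tensorObj (R := X.presheaf) M.val N.val)

/-- Tensor powers over `𝒪_X`. -/
def tensorPow {X : Scheme.{u}} (M : X.Modules) : ℕ → X.Modules
  | 0 => SheafOfModules.unit X.ringCatSheaf
  | i + 1 => tensorObj (tensorPow M i) M

/-- The sheaf `𝒯 = 𝒪_X ⊕ ℐ ⊕ ℐ^{⊗ 2} ⊕ ⋯ ⊕ ℐ^{⊗ (n - 1)}`. -/
def SeveriBrauer.T {F A : Type u} [Field F] [Ring A] [Algebra F A] [FiniteDimensional F A] {n : ℕ}
  (S : SeveriBrauer F A n) : S.X.Modules :=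
  have : HasFiniteBiproducts S.X.Modules := Abelian.hasFiniteBiproducts
  ⨁ fun i : Fin n => tensorPow S.taut i


/-- The object `E` generates the triangulated category `D`: an object `M` with
`Hom (E[i], M) = 0` for all integers `i` is zero. -/
def Generates {D : Type*} [Category D] [HasZeroMorphisms D] [HasShift D ℤ] (E : D) : Prop :=
  ∀ M : D, (∀ (i : ℤ) (f : E⟦i⟧ ⟶ M), f = 0) → IsZero M

end SB

end

/-! Let `K` be a finite extension of `F` that splits `A`. Over `K` the variety is a projective space
of dimension `n - 1`, and `ℐ` is a sum of `n` copies of a line bundle `L`, the `O(-1)`. All sheaves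
are kept on `X`: a sheaf on `X_K` is replaced by its push-forward, a submodule of a free module over
`𝒪_X ⊗ K`. A separability idempotent of `A` provides each right ideal in question with a left
identity `e` (`exists_left_identity`). Left multiplication by `e` is an idempotent matrix with image
`ℐ`, and `ρ(e)` is an idempotent `n × n` matrix of rank one with image `L` (`rankOne_leftIdentity`).
As `K` is finite over `F` and `M_n(K)` is the sum of its columns, `ℐ^m`, `ℐ^m ⊗ K` and `L^m` are
direct summands of finite sums of copies of one another (`addOf_tensorPow`, `addOf_lm_rho`,
`addOf_rho_lm`).

Fix `M` such that every morphism from a shift of `𝒯` to `M` is zero. The quasi-coherent sheaves with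
this property form a class closed under such summands, under kernels of epimorphisms and under
extensions (`isThickProp_qcohOrth`). It contains `L^m` for `m < n`. The Koszul complex on the `n`
coordinates `L → 𝒪`, twisted by `L^m`, is exact; its terms are sums of copies of `L^m, …, L^(m+n)`,
and the last power occurs only in the leftmost term. By induction the class contains all `L^m`
(`pow_of_isThickProp`), hence all `ℐ^m ⊗ K`.

These powers separate morphisms of quasi-coherent sheaves, because `det ℐ` is anti-ample. The
Plücker coordinates of `ℐ ⊆ 𝒪 ⊗ A`, that is the `n × n` minors, are functionals on `ℐ^n`. Their
nonvanishing loci cover `X` and are affine, which is read off from the functor represented by `X`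
(`isAffineOpen_chart`). A section of a quasi-coherent `Z` over a chart extends after multiplication
by the `k`-th power of a Plücker coordinate, so it lies in the image of a morphism `ℐ^(kn) ⊗ K → Z`
(`Twists.separating`). Applied to the projection from cycles to homology of a complex representing
`M`, this shows that all homology vanishes (`isZero_of_leftOrth_separating`). -/

noncomputable section
namespace SB

/-! ### Splitting a central simple algebra by a finite extension -/

section Splitting

variable {F A : Type u} [Field F] [Ring A] [Algebra F A]

/-- The two-sided ideal generated by a nonzero element of a simple ring is everything. -/
lemma exists_sum_mul_mul_eq_one [IsSimpleRing A] {a : A} (ha : a ≠ 0) :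
    ∃ l : List (A × A), (l.map fun p => p.1 * a * p.2).sum = 1 := by
  let I : TwoSidedIdeal A := .mk' {x | ∃ l : List (A × A), (l.map fun p => p.1 * a * p.2).sum = x}
    ⟨[], rfl⟩
    (by rintro _ _ ⟨l, rfl⟩ ⟨l', rfl⟩; exact ⟨l ++ l', by simp⟩)
    (by
      rintro _ ⟨l, rfl⟩
      refine ⟨l.map fun p => (-p.1, p.2), ?_⟩
      rw [← neg_one_mul, ← List.sum_map_mul_left, List.map_map]
      congr 2; ext p; simp)
    (by
      rintro x _ ⟨l, rfl⟩
      refine ⟨l.map fun p => (x * p.1, p.2), ?_⟩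
      rw [← List.sum_map_mul_left, List.map_map]
      congr 2; ext p; simp [mul_assoc])
    (by
      rintro _ x ⟨l, rfl⟩
      refine ⟨l.map fun p => (p.1, p.2 * x), ?_⟩
      rw [← List.sum_map_mul_right, List.map_map]
      congr 2; ext p; simp [mul_assoc])
  have hI : I = ⊤ := by
    refine (eq_bot_or_eq_top I).resolve_left fun h => ha ?_
    have : a ∈ I := (TwoSidedIdeal.mem_mk' ..).2 ⟨[(1, 1)], by simp⟩
    rwa [h, TwoSidedIdeal.mem_bot] at this
  have : (1 : A) ∈ I := hI ▸ trivial
  rwa [TwoSidedIdeal.mem_mk'] at this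

/-- A scalar extension of a central simple algebra is simple. -/
lemma isSimpleRing_tensorProduct (L : Type u) [Field L] [Algebra F L] [Algebra.IsCentral F A]
    [IsSimpleRing A] : IsSimpleRing (L ⊗[F] A) := by
  let b := Module.Free.chooseBasis F L
  let c : L ⊗[F] A ≃ₗ[F] (Module.Free.ChooseBasisIndex F L →₀ A) :=
    TensorProduct.comm F L A ≪≫ₗ TensorProduct.congr (.refl F A) b.repr ≪≫ₗ
      finsuppScalarRight F F A _
  have hc (l : L) (a : A) (k) : c (l ⊗ₜ a) k = b.repr l k • a := by
    simp [c]
  have hl (a : A) (z : L ⊗[F] A) (k) : c ((1 ⊗ₜ a) * z) k = a * c z k := by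
    induction z with
    | zero => simp
    | tmul l x => simp [hc]
    | add x y hx hy => rw [mul_add, map_add, map_add, Finsupp.add_apply, Finsupp.add_apply, hx, hy, mul_add]
  have hr (a : A) (z : L ⊗[F] A) (k) : c (z * (1 ⊗ₜ a)) k = c z k * a := by
    induction z with
    | zero => simp
    | tmul l x => simp [hc]
    | add x y hx hy => rw [add_mul, map_add, map_add, Finsupp.add_apply, Finsupp.add_apply, hx, hy, add_mul]
  have : Nontrivial (L ⊗[F] A) := inferInstance
  refine ⟨⟨fun I => ?_⟩⟩
  by_cases hI : I = ⊥
  · exact .inl hI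
  refine .inr ?_
  obtain ⟨z₀, hz₀, hz₀'⟩ : ∃ z ∈ I, z ≠ 0 := by
    by_contra! h
    exact hI (le_bot_iff.1 fun x hx => h x hx)
  -- Shortest length argument: `z` is chosen nonzero in `I` with coordinate vector over `A` of
  -- minimal support.
  have hex : ∃ m : ℕ, ∃ z ∈ I, z ≠ 0 ∧ (c z).support.card = m := ⟨_, z₀, hz₀, hz₀', rfl⟩
  classical
  obtain ⟨z, hz, hz', hcard⟩ := Nat.find_spec hex
  have hmin (y) (hy : y ∈ I) (h : (c y).support.card < (c z).support.card) : y = 0 := by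
    by_contra hne
    exact Nat.find_min hex (hcard ▸ h) ⟨y, hy, hne, rfl⟩
  obtain ⟨k, hk⟩ : ∃ k, c z k ≠ 0 := by
    by_contra! h
    exact hz' (c.injective (by ext k; simpa using h k))
  obtain ⟨l, hl1⟩ := exists_sum_mul_mul_eq_one hk
  -- By simplicity of `A`, two-sided combinations of `z` with coefficients in `A` make the `k`-th
  -- coordinate equal to `1` without enlarging the support.
  let y : L ⊗[F] A := (l.map fun p => (1 ⊗ₜ p.1) * z * (1 ⊗ₜ p.2)).sum
  have hy : y ∈ I := by
    refine list_sum_mem fun x hx => ?_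
    obtain ⟨p, -, rfl⟩ := List.mem_map.1 hx
    exact I.mul_mem_right _ _ (I.mul_mem_left _ _ hz)
  have hcy (j) : c y j = (l.map fun p => p.1 * c z j * p.2).sum := by
    have := map_list_sum ((Finsupp.applyAddHom j).comp c.toAddMonoidHom)
      (l.map fun p => (1 ⊗ₜ[F] p.1) * z * (1 ⊗ₜ[F] p.2))
    refine this.trans ?_
    rw [List.map_map]
    congr 2; ext p
    change c _ j = _
    rw [hr, hl]
  have hk1 : c y k = 1 := by rw [hcy, hl1]
  have hsupp : (c y).support ⊆ (c z).support := by
    intro j hj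
    rw [Finsupp.mem_support_iff] at hj ⊢
    intro h0
    refine hj ?_
    rw [hcy, h0]
    simp
  -- The `k`-th coordinate of the commutator is `a - a = 0`, so its support is strictly smaller and
  -- minimality kills it. The coordinates of `y` are then central, so `y` comes from a nonzero
  -- element of the field `L`.
  have hcomm (a : A) : (1 ⊗ₜ a) * y = y * (1 ⊗ₜ a) := by
    rw [← sub_eq_zero]
    refine hmin _ (sub_mem (I.mul_mem_left _ _ hy) (I.mul_mem_right _ _ hy)) ?_
    refine Finset.card_lt_card ⟨fun j hj => hsupp ?_, fun h => ?_⟩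
    · rw [Finsupp.mem_support_iff, map_sub, Finsupp.sub_apply, hl, hr] at hj
      rw [Finsupp.mem_support_iff]
      intro h0
      simp [h0] at hj
    · have := h (Finsupp.mem_support_iff.2 hk)
      rw [Finsupp.mem_support_iff, map_sub, Finsupp.sub_apply, hl, hr, hk1] at this
      simp at this
  have hcent (j) : ∃ r : F, c y j = algebraMap F A r := by
    have : c y j ∈ Subalgebra.center F A := by
      rw [Subalgebra.mem_center_iff]
      intro a
      rw [← hl, ← hr, hcomm]
    obtain ⟨r, hr⟩ := Algebra.mem_bot.1 (Algebra.IsCentral.out this)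
    exact ⟨r, hr.symm⟩
  choose r hr' using hcent
  let x : L := ∑ j ∈ (c y).support, r j • b j
  have hx : y = x ⊗ₜ 1 := by
    apply c.injective
    ext j
    rw [hc, map_sum, Finsupp.finsetSum_apply]
    simp only [map_smul, Module.Basis.repr_self, Finsupp.smul_apply, Finsupp.single_apply]
    by_cases hj : j ∈ (c y).support
    · rw [Finset.sum_eq_single_of_mem j hj (by intro i _ hi; simp [hi])]
      simp [hr', Algebra.algebraMap_eq_smul_one]
    · rw [Finset.sum_eq_zero]
      · simpa using hj
      · intro i hi
        rw [if_neg (by rintro rfl; exact hj hi)]; simp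
  have hx0 : x ≠ 0 := by
    rintro h
    rw [h, zero_tmul] at hx
    rw [hx] at hk1
    simp at hk1
  have : (1 : L ⊗[F] A) ∈ I := by
    have : (x⁻¹ ⊗ₜ 1) * y ∈ I := I.mul_mem_left _ _ hy
    rwa [hx, Algebra.TensorProduct.tmul_mul_tmul, inv_mul_cancel₀ hx0, mul_one] at this
  exact (TwoSidedIdeal.one_mem_iff _).1 this

variable (F A) in
/-- Every central simple algebra is split by a finite field extension. -/
theorem exists_splitting [FiniteDimensional F A] [Algebra.IsCentral F A] [IsSimpleRing A] (n : ℕ)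
    (hn : Module.finrank F A = n ^ 2) :
    ∃ (K : Type u) (_ : Field K) (_ : Algebra F K) (_ : FiniteDimensional F K)
      (ρ : A →ₐ[F] Matrix (Fin n) (Fin n) K), ∀ {ι : Type} (b : Module.Basis ι F A),
        LinearIndependent K fun i => ρ (b i) := by
  let L := AlgebraicClosure F
  have := isSimpleRing_tensorProduct (F := F) (A := A) L
  obtain ⟨m, _, ⟨e⟩⟩ := IsSimpleRing.exists_algEquiv_matrix_of_isAlgClosed L (L ⊗[F] A)
  obtain rfl : m = n := by
    have h := e.toLinearEquiv.finrank_eq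
    rw [Module.finrank_baseChange, hn, Module.finrank_matrix] at h
    simp only [Fintype.card_fin, Module.finrank_self, mul_one, ← pow_two] at h
    exact (Nat.pow_left_injective two_ne_zero h).symm
  let σ : A →ₐ[F] Matrix (Fin m) (Fin m) L :=
    (e.toAlgHom.restrictScalars F).comp Algebra.TensorProduct.includeRight
  have hσ {ι : Type} (b : Module.Basis ι F A) : LinearIndependent L fun i => σ (b i) := by
    have := (b.baseChange L).linearIndependent.map' e.toLinearMap
      (LinearMap.ker_eq_bot.2 e.injective)
    have h2 : (fun i => σ (b i)) = e.toLinearMap ∘ (b.baseChange L) := by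
      ext1 i; simp [σ]
    rw [h2]
    exact this
  let c := Module.finBasis F A
  -- The finitely many matrix entries of `σ` on a basis generate a finite extension of `F` over
  -- which the representation is already defined.
  let s : Set L := Set.range fun t : Fin (Module.finrank F A) × Fin m × Fin m => σ (c t.1) t.2.1 t.2.2
  have hs : s.Finite := Set.finite_range _
  let K := IntermediateField.adjoin F s
  have : FiniteDimensional F K :=
    have := hs.to_subtype
    IntermediateField.finiteDimensional_adjoin fun x _ => Algebra.IsIntegral.isIntegral x
  have hmem (a : A) (i j) : σ a i j ∈ K := by
    rw [← c.sum_repr a, map_sum, Matrix.sum_apply]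
    refine sum_mem fun k _ => ?_
    rw [map_smul, Matrix.smul_apply]
    exact K.smul_mem (IntermediateField.subset_adjoin F s ⟨(k, i, j), rfl⟩)
  let ι : Matrix (Fin m) (Fin m) K →ₐ[F] Matrix (Fin m) (Fin m) L := K.val.mapMatrix
  have hι : Function.Injective ι := by
    intro x y h
    ext i j
    exact congr_fun (congr_fun h i) j
  have hrange (a : A) : ∃ x, ι x = σ a := ⟨.of fun i j => ⟨σ a i j, hmem a i j⟩, by ext; rfl⟩
  choose g hg using hrange
  let ρ : A →ₐ[F] Matrix (Fin m) (Fin m) K := AlgHom.ofLinearMap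
    { toFun := g
      map_add' := fun x y => hι (by rw [map_add, hg, hg, hg, map_add])
      map_smul' := fun r x => hι (by rw [RingHom.id_apply, map_smul, hg, hg, map_smul]) }
    (hι ((hg 1).trans ((map_one σ).trans (map_one ι).symm)))
    (fun x y => hι ((hg _).trans ((map_mul σ x y).trans
      ((congr_arg₂ (· * ·) (hg x).symm (hg y).symm).trans (map_mul ι _ _).symm))))
  refine ⟨K, inferInstance, inferInstance, this, ρ, fun b => ?_⟩
  rw [linearIndependent_iff']
  intro t f hf i hi
  refine Subtype.ext ((linearIndependent_iff'.1 (hσ b)) t (fun i => (f i : L)) ?_ i hi)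
  ext r s
  have := congr_arg Subtype.val (congr_fun (congr_fun hf r) s)
  rw [Matrix.sum_apply, AddSubmonoidClass.coe_finsetSum] at this
  rw [Matrix.sum_apply]
  refine (Finset.sum_congr rfl fun k _ => ?_).trans this
  exact congr_arg ((f k : L) * ·) (congr_fun (congr_fun (hg (b k)).symm r) s)

end Splitting
end SB

end

noncomputable section
namespace SB

/-! ### Idempotent matrices and their fixed vectors -/

section FixedVectors

/-- The vectors fixed by a square matrix. -/
def fixVec {ι Q : Type*} [Fintype ι] [CommRing Q] (p : Matrix ι ι Q) : Submodule Q (ι → Q) where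
  carrier := {v | p.mulVec v = v}
  add_mem' {v w} hv hw := by
    change p.mulVec (v + w) = v + w
    rw [Matrix.mulVec_add, hv, hw]
  zero_mem' := Matrix.mulVec_zero _
  smul_mem' r v hv := by
    change p.mulVec (r • v) = r • v
    rw [Matrix.mulVec_smul, hv]

variable {ι κ Q : Type*} [Fintype ι] [Fintype κ] [CommRing Q]

lemma mem_fixVec {p : Matrix ι ι Q} {v : ι → Q} : v ∈ fixVec p ↔ p.mulVec v = v := Iff.rfl

/-- The projection onto the vectors fixed by an idempotent matrix. -/
def fixProj (p : Matrix ι ι Q) (hp : p * p = p) : (ι → Q) →ₗ[Q] fixVec p :=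
  p.mulVecLin.codRestrict _ fun v => by simp [mem_fixVec, hp]

lemma fixProj_comp_subtype (p : Matrix ι ι Q) (hp : p * p = p) :
    fixProj p hp ∘ₗ (fixVec p).subtype = .id := by
  ext v
  exact congr_fun v.2 _

lemma fixVec_projective (p : Matrix ι ι Q) (hp : p * p = p) : Module.Projective Q (fixVec p) :=
  .of_split _ _ (fixProj_comp_subtype p hp)

lemma fixVec_finite (p : Matrix ι ι Q) (hp : p * p = p) : Module.Finite Q (fixVec p) :=
  .of_surjective (fixProj p hp) fun v => ⟨v, LinearMap.congr_fun (fixProj_comp_subtype p hp) v⟩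

/-- An idempotent matrix over a local ring whose fixed vectors are free of rank one is a product
of a column and a row. -/
lemma exists_eq_vecMulVec_of_finrank [IsLocalRing Q] (f : Matrix κ κ Q) (hf : f * f = f)
    (h : Module.finrank Q (fixVec f) = 1) :
    ∃ l g : κ → Q, (∀ i j, f i j = l i * g j) ∧ ∑ i, l i * g i = 1 := by
  classical
  have := fixVec_projective f hf
  have := fixVec_finite f hf
  have : Module.Free Q (fixVec f) := Module.free_of_flat_of_isLocalRing
  -- The image of `f` is free on the vector `B 0`, so the `j`-th column of `f` is a multiple `g j`
  -- of it. This is the factorisation into a column and a row.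
  let B := Module.finBasisOfFinrankEq Q _ h
  have hB (v : fixVec f) : v = B.repr v 0 • B 0 := by
    conv_lhs => rw [← B.sum_repr v]
    simp
  let g (j : κ) : Q := B.repr (fixProj f hf (Pi.single j 1)) 0
  have hg (i j : κ) : f i j = (B 0).1 i * g j := by
    have := congr_fun (congr_arg Subtype.val (hB (fixProj f hf (Pi.single j 1)))) i
    have h' : (fixProj f hf (Pi.single j 1)).1 i = f i j := by
      change f.mulVec (Pi.single j 1) i = _
      rw [Matrix.mulVec_single_one]
      rfl
    rw [← h', this, mul_comm]
    rfl
  refine ⟨(B 0).1, g, hg, ?_⟩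
  -- `f` fixes `B 0`, which forces the scalar `∑ l i * g i` to act on it as `1`.
  have h1 : (∑ i, (B 0).1 i * g i) • B 0 = B 0 := by
    refine Subtype.ext (funext fun i => ?_)
    conv_rhs => rw [← mem_fixVec.1 (B 0).2]
    simp only [Matrix.mulVec, dotProduct, hg, Submodule.coe_smul, Pi.smul_apply, smul_eq_mul,
      Finset.sum_mul]
    exact Finset.sum_congr rfl fun _ _ => by ring
  have h2 := congr_arg (fun v => B.repr v 0) h1
  simpa using h2

/-- The constant matrices which identify `K ⊗ A` with a sum of copies of the split
representation; here in an abstract form. -/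
structure Intertwines {m : Type*} [Fintype m] [DecidableEq m] [DecidableEq ι] [DecidableEq κ]
    (p : Matrix ι ι Q) (f : Matrix κ κ Q)
    (C : m → Matrix ι κ Q) (D : m → Matrix κ ι Q) : Prop where
  comp_C : ∀ j, p * C j = C j * f
  D_comp : ∀ j, D j * p = f * D j
  sum_C_D : ∑ j, C j * D j = 1
  D_C : ∀ i j, D i * C j = if i = j then 1 else 0

variable {m : Type*} [Fintype m] [DecidableEq m] [DecidableEq ι] [DecidableEq κ]
    {p : Matrix ι ι Q} {f : Matrix κ κ Q}
    {C : m → Matrix ι κ Q} {D : m → Matrix κ ι Q}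

/-- `D j * C j = 1` gives `f = D j * p * C j`, and the intertwining relations carry idempotency from
`p` to `f`. -/
lemma Intertwines.idem [Nonempty m] (h : Intertwines p f C D) (hp : p * p = p) : f * f = f := by
  have j := Classical.arbitrary m
  have h1 : f = D j * (p * C j) := by
    rw [h.comp_C, ← Matrix.mul_assoc, h.D_C, if_pos rfl, Matrix.one_mul]
  calc f * f = D j * (p * C j) * f := by rw [← h1]
    _ = D j * (p * (p * C j)) := by rw [Matrix.mul_assoc, Matrix.mul_assoc, ← h.comp_C]
    _ = D j * (p * p * C j) := by simp only [Matrix.mul_assoc]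
    _ = f := by rw [hp, ← h1]

lemma Intertwines.map {Q' : Type*} [CommRing Q'] (h : Intertwines p f C D) (φ : Q →+* Q') :
    Intertwines (p.map φ) (f.map φ) (fun j => (C j).map φ) (fun j => (D j).map φ) where
  comp_C j := by rw [← Matrix.map_mul, h.comp_C, Matrix.map_mul]
  D_comp j := by rw [← Matrix.map_mul, h.D_comp, Matrix.map_mul]
  sum_C_D := by
    simp_rw [← Matrix.map_mul]
    have := congr_arg φ.mapMatrix h.sum_C_D
    rw [map_sum, map_one] at this
    exact this
  D_C i j := by
    rw [← Matrix.map_mul, h.D_C]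
    split_ifs <;> simp

/-- The fixed vectors of intertwined matrices. -/
def Intertwines.fixEquiv (h : Intertwines p f C D) : fixVec p ≃ₗ[Q] (m → fixVec f) where
  toFun v j := ⟨(D j).mulVec v.1, by
    rw [mem_fixVec, Matrix.mulVec_mulVec, ← h.D_comp, ← Matrix.mulVec_mulVec, mem_fixVec.1 v.2]⟩
  map_add' v w := by ext; simp [Matrix.mulVec_add]
  map_smul' r v := by ext; simp [Matrix.mulVec_smul]
  invFun w := ⟨∑ j, (C j).mulVec (w j).1, by
    refine sum_mem fun j _ => ?_
    rw [mem_fixVec, Matrix.mulVec_mulVec, h.comp_C, ← Matrix.mulVec_mulVec, mem_fixVec.1 (w j).2]⟩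
  left_inv v := by
    refine Subtype.ext ?_
    simp only [Matrix.mulVec_mulVec]
    rw [← Matrix.sum_mulVec, h.sum_C_D, Matrix.one_mulVec]
  right_inv w := by
    funext j
    refine Subtype.ext ?_
    simp only
    rw [Matrix.mulVec_sum]
    simp only [Matrix.mulVec_mulVec, h.D_C]
    rw [Finset.sum_eq_single j (by intro i _ hi; simp [hi.symm]) (by simp)]
    simp

/-- If the fixed vectors of `p` have rank `#m` then `f` has rank one. -/
lemma Intertwines.rankOne [Nonempty m] [IsLocalRing Q] (h : Intertwines p f C D) (hp : p * p = p)
    (hr : Module.finrank Q (fixVec p) = Fintype.card m) :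
    (∀ i j a b, f i a * f j b = f j a * f i b) ∧ f.trace = 1 := by
  have hf := h.idem hp
  have := fixVec_projective f hf
  have := fixVec_finite f hf
  have : Module.Free Q (fixVec f) := Module.free_of_flat_of_isLocalRing
  have h1 : Module.finrank Q (fixVec f) = 1 := by
    rw [h.fixEquiv.finrank_eq, Module.finrank_pi_fintype] at hr
    simp only [Finset.sum_const, Finset.card_univ, smul_eq_mul] at hr
    exact Nat.eq_of_mul_eq_mul_left Fintype.card_pos (hr.trans (mul_one _).symm)
  obtain ⟨l, g, hlg, hs⟩ := exists_eq_vecMulVec_of_finrank f hf h1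
  refine ⟨fun i j a b => by simp only [hlg]; ring, ?_⟩
  rw [← hs]
  exact Finset.sum_congr rfl fun i _ => hlg i i

end FixedVectors

/-! ### The columns of a split algebra -/

section Constants

variable {F A : Type u} [Field F] [Ring A] [Algebra F A] {n : ℕ} [NeZero n]
  {K : Type u} [Field K] [Algebra F K] (ρ : A →ₐ[F] Matrix (Fin n) (Fin n) K)
  (b : Module.Basis (Fin (n ^ 2)) F A) (hρ : LinearIndependent K fun i => ρ (b i))

/-- The basis of the matrix algebra given by a splitting and a basis of the algebra. -/
def matBasis : Module.Basis (Fin (n ^ 2)) K (Matrix (Fin n) (Fin n) K) :=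
  haveI : Nonempty (Fin (n ^ 2)) := ⟨⟨0, Nat.pow_pos (NeZero.pos n)⟩⟩
  basisOfLinearIndependentOfCardEqFinrank hρ (by
    rw [Module.finrank_matrix]; simp [pow_two])

lemma matBasis_apply (i) : matBasis ρ b hρ i = ρ (b i) := by
  simp [matBasis]

/-- The constant matrix of the inclusion of the `j`-th column. -/
def colC (j : Fin n) : Matrix (Fin (n ^ 2)) (Fin n) K :=
  .of fun i r => (matBasis ρ b hρ).repr (Matrix.single r j 1) i

/-- The constant matrix of the projection to the `j`-th column. -/
def colD (j : Fin n) : Matrix (Fin n) (Fin (n ^ 2)) K := .of fun r i => ρ (b i) r j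

/-- The left module `M_n(K)` is the direct sum of its `n` columns, each of them the standard
representation; `C j` and `D j` are the inclusion and projection of the `j`-th column in the basis
`ρ (b i)`. Only the relation for `D` is computed. The one for `C` follows from it by inserting `∑ C
i * D i = 1` and using orthogonality. -/
lemma intertwines_const (a : A) : Intertwines ((Algebra.leftMulMatrix b a).map (algebraMap F K))
    (ρ a) (colC ρ b hρ) (colD ρ b) := by
  have hCD : ∑ j, colC ρ b hρ j * colD ρ b j = 1 := by
    ext i i'
    have h : (matBasis ρ b hρ).repr (ρ (b i')) i = ∑ j, ∑ r,
        (matBasis ρ b hρ).repr (Matrix.single r j 1) i * ρ (b i') r j := by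
      conv_lhs => rw [Matrix.matrix_eq_sum_single (ρ (b i'))]
      rw [Finset.sum_comm, map_sum, Finsupp.finsetSum_apply]
      refine Finset.sum_congr rfl fun j _ => ?_
      rw [map_sum, Finsupp.finsetSum_apply]
      refine Finset.sum_congr rfl fun r _ => ?_
      have : Matrix.single r j (ρ (b i') r j) = ρ (b i') r j • Matrix.single r j (1 : K) := by simp
      rw [this, map_smul, Finsupp.smul_apply, smul_eq_mul, mul_comm]
    rw [← matBasis_apply ρ b hρ, Module.Basis.repr_self, Finsupp.single_apply] at h
    simp only [Matrix.sum_apply, Matrix.one_apply, eq_comm (a := i)]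
    rw [h, matBasis_apply]
    rfl
  have hDC (i j) : colD ρ b i * colC ρ b hρ j = if i = j then 1 else 0 := by
    ext r r'
    have h := congr_fun (congr_fun ((matBasis ρ b hρ).sum_repr (Matrix.single r' j 1)) r) i
    rw [Matrix.sum_apply] at h
    simp only [matBasis_apply, Matrix.smul_apply, smul_eq_mul] at h
    rw [Matrix.mul_apply]
    refine (Finset.sum_congr rfl fun k _ => mul_comm _ _).trans (h.trans ?_)
    by_cases hij : i = j
    · subst hij; simp [Matrix.single_apply, Matrix.one_apply, eq_comm]
    · simp [hij, Ne.symm hij]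
  have hD (j) : colD ρ b j * (Algebra.leftMulMatrix b a).map (algebraMap F K) = ρ a * colD ρ b j := by
    ext r i
    have h : ρ a * ρ (b i) = ∑ k, Algebra.leftMulMatrix b a k i • ρ (b k) := by
      simp_rw [← map_smul, ← map_sum, ← map_mul, Algebra.leftMulMatrix_eq_repr_mul]
      rw [b.sum_repr]
    have h2 := congr_fun (congr_fun h r) j
    rw [Matrix.sum_apply, Matrix.mul_apply] at h2
    rw [Matrix.mul_apply, Matrix.mul_apply]
    refine Eq.trans ?_ h2.symm
    refine Finset.sum_congr rfl fun k _ => ?_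
    simp [colD, Algebra.smul_def, mul_comm]
  refine ⟨fun j => ?_, hD, hCD, hDC⟩
  calc _ = (∑ i, colC ρ b hρ i * colD ρ b i) *
        ((Algebra.leftMulMatrix b a).map (algebraMap F K) * colC ρ b hρ j) := by
        rw [hCD, Matrix.one_mul]
    _ = ∑ i, colC ρ b hρ i * (ρ a * (colD ρ b i * colC ρ b hρ j)) := by
        rw [Matrix.sum_mul]
        refine Finset.sum_congr rfl fun i _ => ?_
        rw [Matrix.mul_assoc, ← Matrix.mul_assoc (colD ρ b i), hD, Matrix.mul_assoc]
    _ = _ := by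
        rw [Finset.sum_eq_single j (by intro i _ hi; simp [hDC, hi]) (by simp)]
        simp [hDC]

end Constants
end SB

end

noncomputable section
namespace SB

/-! ### A separability idempotent -/

section Separability

variable {F A : Type u} [Field F] [Ring A] [Algebra F A] {n : ℕ} [NeZero n]
  {K : Type u} [Field K] [Algebra F K] (ρ : A →ₐ[F] Matrix (Fin n) (Fin n) K)
  (b : Module.Basis (Fin (n ^ 2)) F A) (hρ : LinearIndependent K fun i => ρ (b i))

include ρ b hρ in
/-- A split algebra has a separability idempotent over the base field. -/
lemma exists_separability : ∃ θ : A ⊗[F] A, (∀ c : A, (c ⊗ₜ 1) * θ = θ * (1 ⊗ₜ c)) ∧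
    LinearMap.mul' F A θ = 1 := by
  obtain ⟨lam, hlam⟩ : ∃ f : K →ₗ[F] F, f 1 = 1 := by
    obtain ⟨g, hg⟩ := (Algebra.linearMap F K).exists_leftInverse_of_injective
      (LinearMap.ker_eq_bot.2 (algebraMap F K).injective)
    exact ⟨g, by simpa using LinearMap.congr_fun hg 1⟩
  have hlam' (r : F) (k : K) : lam (algebraMap F K r * k) = r * lam k := by
    rw [← Algebra.smul_def, map_smul, smul_eq_mul]
  let B := matBasis ρ b hρ
  have hB (i) : B i = ρ (b i) := matBasis_apply ρ b hρ i
  have hrepr (x : A) (i) : B.repr (ρ x) i = algebraMap F K (b.repr x i) := by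
    conv_lhs => rw [← b.sum_repr x]
    rw [map_sum, map_sum, Finsupp.finsetSum_apply, Finset.sum_eq_single i]
    · rw [map_smul, ← hB, ← algebraMap_smul K, map_smul]
      simp [Algebra.algebraMap_eq_smul_one]
    · intro j _ hj
      rw [map_smul, ← hB, ← algebraMap_smul K, map_smul]
      simp [hj]
    · simp
  -- In `M_n(K)` the element `∑ E_{i0} ⊗ E_{0i}` is a separability idempotent over `K`. It is
  -- brought down to `A ⊗[F] A` by applying the retraction `lam` to coefficients: `G` sends `k • ρ
  -- x` and `k' • ρ y` to `lam (k * k') • (x ⊗ y)`.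
  let G : Matrix (Fin n) (Fin n) K →+ Matrix (Fin n) (Fin n) K →+ A ⊗[F] A :=
    AddMonoidHom.mk' (fun P => AddMonoidHom.mk'
      (fun Q => ∑ i, ∑ j, lam (B.repr P i * B.repr Q j) • (b i ⊗ₜ[F] b j))
      (fun Q Q' => by simp [mul_add, add_smul, Finset.sum_add_distrib]))
      (fun P P' => by ext Q; simp [add_mul, add_smul, Finset.sum_add_distrib])
  have hG (P Q) : G P Q = ∑ i, ∑ j, lam (B.repr P i * B.repr Q j) • (b i ⊗ₜ[F] b j) := rfl
  let H : Matrix (Fin n) (Fin n) K →+ A :=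
    AddMonoidHom.mk' (fun P => ∑ i, lam (B.repr P i) • b i)
      (fun P P' => by simp [add_smul, Finset.sum_add_distrib])
  have hHr (k : K) (x : A) : H (k • ρ x) = lam k • x := by
    conv_rhs => rw [← b.sum_repr x, Finset.smul_sum]
    change ∑ i, lam (B.repr (k • ρ x) i) • b i = _
    refine Finset.sum_congr rfl fun i _ => ?_
    simp [hrepr, smul_smul, mul_comm k, hlam', mul_comm (lam k)]
  have hGr (k k' : K) (x y : A) : G (k • ρ x) (k' • ρ y) = lam (k * k') • (x ⊗ₜ y) := by
    conv_rhs => rw [← b.sum_repr x, ← b.sum_repr y, sum_tmul, Finset.smul_sum]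
    rw [hG]
    refine Finset.sum_congr rfl fun i _ => ?_
    rw [tmul_sum, Finset.smul_sum]
    refine Finset.sum_congr rfl fun j _ => ?_
    have : k * algebraMap F K (b.repr x i) * (k' * algebraMap F K (b.repr y j)) =
      algebraMap F K (b.repr x i * b.repr y j) * (k * k') := by rw [map_mul]; ring
    simp only [map_smul, Finsupp.smul_apply, hrepr, smul_eq_mul, this, hlam']
    rw [smul_tmul_smul, smul_smul, mul_comm]
  have hspan (P) : P = ∑ i, B.repr P i • ρ (b i) := by
    simp_rw [← hB]; exact (B.sum_repr P).symm
  have hGl (c : A) (P Q) : (c ⊗ₜ 1) * G P Q = G (ρ c * P) Q := by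
    rw [hspan P, hspan Q]
    simp only [Finset.mul_sum, map_sum, AddMonoidHom.finsetSum_apply, mul_smul_comm, ← map_mul, hGr,
      Algebra.TensorProduct.tmul_mul_tmul, one_mul]
  have hGr' (c : A) (P Q) : G P Q * (1 ⊗ₜ c) = G P (Q * ρ c) := by
    rw [hspan P, hspan Q]
    simp only [Finset.sum_mul, map_sum, AddMonoidHom.finsetSum_apply, smul_mul_assoc, ← map_mul, hGr,
      Algebra.TensorProduct.tmul_mul_tmul, mul_one]
  have hG1 (P Q) : LinearMap.mul' F A (G P Q) = H (P * Q) := by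
    have hHr2 (k k' : K) (x y : A) : H ((k • ρ x) * (k' • ρ y)) = lam (k * k') • (x * y) := by
      rw [smul_mul_smul_comm, ← map_mul, hHr]
    rw [hspan P, hspan Q]
    simp only [Finset.sum_mul, Finset.mul_sum, map_sum, AddMonoidHom.finsetSum_apply, hGr, hHr2,
      map_smul, LinearMap.mul'_apply]
  -- `G` is balanced over `K`; this is what moves the entries of `ρ c` from one factor to the other.
  have hGs (k : K) (P Q) : G (k • P) Q = G P (k • Q) := by
    simp only [hG, map_smul, Finsupp.smul_apply, smul_eq_mul]
    simp only [mul_assoc, mul_left_comm]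
  have h0 (c : A) (i : Fin n) : ρ c * Matrix.single i (0 : Fin n) (1 : K) =
      ∑ k, ρ c k i • Matrix.single k (0 : Fin n) (1 : K) := by
    ext r s
    simp [Matrix.sum_apply, Matrix.mul_apply, Matrix.single_apply, ite_and]
  have h1 (c : A) (k : Fin n) : Matrix.single (0 : Fin n) k (1 : K) * ρ c =
      ∑ i, ρ c k i • Matrix.single (0 : Fin n) i (1 : K) := by
    ext r s
    simp [Matrix.sum_apply, Matrix.mul_apply, Matrix.single_apply, ite_and]
  refine ⟨∑ i : Fin n, G (Matrix.single i 0 1) (Matrix.single 0 i 1), fun c => ?_, ?_⟩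
  · simp only [Finset.mul_sum, Finset.sum_mul, hGl, hGr', h0, h1, map_sum,
      AddMonoidHom.finsetSum_apply, hGs]
    exact Finset.sum_comm
  · rw [map_sum]
    simp only [hG1, Matrix.single_mul_single_same, mul_one]
    rw [← map_sum]
    have : ∑ i : Fin n, Matrix.single i i (1 : K) = 1 := by
      ext r s
      simp [Matrix.sum_apply, Matrix.single_apply, Matrix.one_apply, ite_and]
    rw [this]
    simpa [hlam] using hHr 1 1

end Separability

/-! ### Left identities of right ideals -/

section LeftIdentity

variable {F A R : Type u} [Field F] [Ring A] [Algebra F A] [CommRing R] [Algebra F R]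

/-- A right ideal with projective quotient has a left identity if the algebra is separable. -/
lemma exists_left_identity {θ : A ⊗[F] A} (h1 : ∀ c : A, (c ⊗ₜ 1) * θ = θ * (1 ⊗ₜ c))
    (h2 : LinearMap.mul' F A θ = 1) (N : Submodule R (R ⊗[F] A))
    (hN : ∀ x ∈ N, ∀ y : R ⊗[F] A, x * y ∈ N) [Module.Projective R ((R ⊗[F] A) ⧸ N)] :
    ∃ e ∈ N, ∀ x ∈ N, e * x = x := by
  obtain ⟨π, hπ⟩ : ∃ π : R ⊗[F] A →ₗ[R] N, ∀ x : N, π x = x := by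
    obtain ⟨s, hs⟩ := Module.projective_lifting_property N.mkQ .id N.mkQ_surjective
    have hmem (x : R ⊗[F] A) : (LinearMap.id - s ∘ₗ N.mkQ : _ →ₗ[R] _) x ∈ N := by
      have := LinearMap.congr_fun hs (N.mkQ x)
      simp only [LinearMap.comp_apply, LinearMap.id_apply] at this
      rw [← Submodule.Quotient.mk_eq_zero, ← Submodule.mkQ_apply, LinearMap.sub_apply,
        LinearMap.id_apply, LinearMap.comp_apply, map_sub, this, sub_self]
    refine ⟨(LinearMap.id - s ∘ₗ N.mkQ).codRestrict N hmem, fun x => Subtype.ext ?_⟩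
    have : N.mkQ x = 0 := by simp
    change x.1 - s (N.mkQ x.1) = x.1
    rw [this, map_zero, sub_zero]
  -- The linear retraction `π` onto `N` is averaged with `θ = ∑ u ⊗ v`: the left identity is `∑ π(u)
  -- v`.
  let β : A ⊗[F] A →ₗ[F] R ⊗[F] A := TensorProduct.lift
    (LinearMap.mk₂ F (fun u v => (π (1 ⊗ₜ u) : R ⊗[F] A) * (1 ⊗ₜ v))
      (fun u u' v => by simp [tmul_add, add_mul])
      (fun c u v => by
        have : (1 : R) ⊗ₜ[F] (c • u) = algebraMap F R c • (1 ⊗ₜ u) := by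
          rw [algebraMap_smul, tmul_smul]
        rw [this, map_smul, Submodule.coe_smul, smul_mul_assoc, algebraMap_smul])
      (fun u v v' => by simp [tmul_add, mul_add])
      (fun c u v => by simp))
  have hβ (u v) : β (u ⊗ₜ v) = (π (1 ⊗ₜ u) : R ⊗[F] A) * (1 ⊗ₜ v) := by simp [β]
  have hβr (c : A) (t : A ⊗[F] A) : β (t * (1 ⊗ₜ c)) = β t * (1 ⊗ₜ c) := by
    induction t with
    | zero => simp
    | tmul u v => simp [hβ, mul_assoc]
    | add x y hx hy => rw [add_mul, map_add, hx, hy, map_add, add_mul]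
  have hmem : β θ ∈ N := by
    generalize θ = t
    induction t with
    | zero => simp
    | tmul u v => rw [hβ]; exact hN _ (π _).2 _
    | add x y hx hy => rw [map_add]; exact add_mem hx hy
  refine ⟨β θ, hmem, fun x hx => ?_⟩
  let γ (x : R ⊗[F] A) : A ⊗[F] A →ₗ[F] R ⊗[F] A := TensorProduct.lift
    (LinearMap.mk₂ F (fun u v => (π (x * (1 ⊗ₜ u)) : R ⊗[F] A) * (1 ⊗ₜ v))
      (fun u u' v => by simp [tmul_add, add_mul, mul_add])
      (fun c u v => by
        have : x * (1 : R) ⊗ₜ[F] (c • u) = algebraMap F R c • (x * (1 ⊗ₜ u)) := by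
          rw [algebraMap_smul, tmul_smul, mul_smul_comm]
        rw [this, map_smul, Submodule.coe_smul, smul_mul_assoc, algebraMap_smul])
      (fun u v v' => by simp [tmul_add, mul_add])
      (fun c u v => by simp))
  have hγ (x u v) : γ x (u ⊗ₜ v) = (π (x * (1 ⊗ₜ u)) : R ⊗[F] A) * (1 ⊗ₜ v) := by simp [γ]
  -- The relation `c θ = θ c` carries a right factor inside `π`: `(∑ π(u) v) x = ∑ π(x u) v`. For `x
  -- ∈ N` every `x u` lies in `N`, so the sum is `∑ x u v = x`.
  have key (x : R ⊗[F] A) : β θ * x = γ x θ := by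
    induction x with
    | zero =>
      have hh (t : A ⊗[F] A) : γ 0 t = 0 := by
        induction t with
        | zero => simp
        | tmul u v => simp [hγ]
        | add x y hx hy => rw [map_add, hx, hy, add_zero]
      rw [hh, mul_zero]
    | tmul r c =>
      have e1 : r ⊗ₜ[F] c = r • (1 ⊗ₜ[F] c) := by simp [smul_tmul']
      have e2 (t) : γ (r ⊗ₜ c) t = r • β ((c ⊗ₜ 1) * t) := by
        induction t with
        | zero => simp
        | tmul u v =>
          rw [hγ, e1, smul_mul_assoc, map_smul, Submodule.coe_smul, smul_mul_assoc,
            Algebra.TensorProduct.tmul_mul_tmul, Algebra.TensorProduct.tmul_mul_tmul, hβ, one_mul,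
            one_mul]
        | add x y hx hy => rw [map_add, hx, hy, mul_add, map_add, smul_add]
      rw [e2, h1, hβr, e1, mul_smul_comm]
    | add x y hx hy =>
      have hh (t : A ⊗[F] A) : γ (x + y) t = γ x t + γ y t := by
        induction t with
        | zero => simp
        | tmul u v => simp [hγ, add_mul]
        | add x y hx hy => rw [map_add, map_add, map_add, hx, hy]; abel
      rw [mul_add, hx, hy, hh]
  rw [key]
  have hh (t : A ⊗[F] A) : γ x t = x * (1 ⊗ₜ LinearMap.mul' F A t) := by
    induction t with
    | zero => simp
    | tmul u v =>
      rw [hγ, hπ ⟨_, hN x hx _⟩]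
      simp [mul_assoc]
    | add y z hy hz => rw [map_add, hy, hz, map_add, tmul_add, mul_add]
  rw [hh, h2, ← Algebra.TensorProduct.one_def, mul_one]

end LeftIdentity

/-! ### Base change of right ideals -/

section BaseChange

variable {F A R R' : Type u} [Field F] [Ring A] [Algebra F A] [CommRing R] [Algebra F R]
  [CommRing R'] [Algebra F R'] (φ : R →ₐ[F] R')

/-- Scalar extension as a ring homomorphism. -/
def bcHom (A : Type u) [Ring A] [Algebra F A] : R ⊗[F] A →ₐ[F] R' ⊗[F] A :=
  Algebra.TensorProduct.map φ (AlgHom.id F A)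

lemma bcHom_eq_rTensor (s : R ⊗[F] A) : bcHom φ A s = φ.toLinearMap.rTensor A s := rfl

@[simp] lemma bcHom_tmul (r : R) (a : A) : bcHom φ A (r ⊗ₜ a) = φ r ⊗ₜ a := rfl

lemma bcHom_smul (r : R) (s : R ⊗[F] A) : bcHom φ A (r • s) = φ r • bcHom φ A s :=
  SeveriBrauer.rTensor_smul φ r s

/-- Base change of right ideals in terms of a left identity. -/
lemma mem_map_iff {k : ℕ} (N : Module.Grassmannian R (R ⊗[F] A) k)
    {e : R ⊗[F] A} (he : e ∈ N.toSubmodule) (h : ∀ x ∈ N.toSubmodule, e * x = x)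
    (hN : ∀ x ∈ N.toSubmodule, ∀ y : R ⊗[F] A, x * y ∈ N.toSubmodule) (s : R' ⊗[F] A) :
    s ∈ (Module.Grassmannian.map φ N).toSubmodule ↔ bcHom φ A e * s = s := by
  let _ : Algebra R R' := φ.toAlgebra
  let _ : IsScalarTower F R R' := IsScalarTower.of_algebraMap_eq' φ.comp_algebraMap.symm
  rw [Module.Grassmannian.map_toSubmodule, LinearMap.mem_ker]
  have hmk (r : R') (x : R ⊗[F] A) :
      Module.Grassmannian.baseChangeMkQ R' N.toSubmodule (r • bcHom φ A x) = r ⊗ₜ N.mkQ x := by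
    induction x with
    | zero => simp
    | tmul q a =>
      have : r • bcHom φ A (q ⊗ₜ a) = (r * φ q) ⊗ₜ a := by simp [smul_tmul']
      rw [this]
      change (r * φ q) ⊗ₜ N.mkQ (1 ⊗ₜ a) = _
      have h2 : q ⊗ₜ[F] a = q • (1 ⊗ₜ[F] a) := by simp [smul_tmul']
      rw [h2, map_smul, ← smul_tmul, Algebra.smul_def, mul_comm]
      rfl
    | add x y hx hy => rw [map_add, smul_add, map_add, hx, hy, map_add, tmul_add]
  constructor
  · intro hs
    -- The map `x ↦ x - e * x` vanishes on `N`. Its base change, evaluated on the class of `s`, is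
    -- `s - φ(e) s`, which must vanish when `s` lies in the extended ideal.
    let g : ((R ⊗[F] A) ⧸ N.toSubmodule) →ₗ[R] R ⊗[F] A :=
      N.toSubmodule.liftQ (LinearMap.id - LinearMap.mulLeft R e) fun x hx => by
        simp [h x hx]
    let c : R' ⊗[R] (R ⊗[F] A) →ₗ[R'] R' ⊗[F] A :=
      (TensorProduct.AlgebraTensorModule.cancelBaseChange F R R' R' A).toLinearMap
    have key (s : R' ⊗[F] A) :
        c (g.baseChange R' (Module.Grassmannian.baseChangeMkQ R' N.toSubmodule s)) =
          s - bcHom φ A e * s := by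
      induction s with
      | zero => simp
      | tmul r a =>
        have h1 : r ⊗ₜ[F] a = r • bcHom φ A (1 ⊗ₜ a) := by simp [smul_tmul']
        have h2 (r : R') (x : R ⊗[F] A) : c (r ⊗ₜ x) = r • bcHom φ A x := by
          induction x with
          | zero => simp
          | tmul q a =>
            simp only [c, LinearEquiv.coe_coe, AlgebraTensorModule.cancelBaseChange_tmul, bcHom_tmul,
              smul_tmul', smul_eq_mul]
            rw [Algebra.smul_def, mul_comm]
            rfl
          | add x y hx hy => rw [tmul_add, map_add, hx, hy, map_add, smul_add]
        rw [h1, hmk, LinearMap.baseChange_tmul, h2]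
        simp [g, smul_sub]
      | add x y hx hy => rw [map_add, map_add, map_add, hx, hy, mul_add]; abel
    have := key s
    rw [hs, map_zero, map_zero] at this
    exact (sub_eq_zero.1 this.symm).symm
  · intro hs
    rw [← hs]
    clear hs
    induction s with
    | zero => rw [mul_zero, map_zero]
    | tmul r a =>
      have h1 : bcHom φ A e * r ⊗ₜ[F] a = r • bcHom φ A (e * (1 ⊗ₜ a)) := by
        rw [map_mul, ← mul_smul_comm, bcHom_tmul, map_one, smul_tmul', smul_eq_mul, mul_one]
      rw [h1, hmk]
      have : N.mkQ (e * (1 ⊗ₜ a)) = 0 := by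
        simpa using hN e he (1 ⊗ₜ a)
      rw [this, tmul_zero]
    | add x y hx hy => rw [mul_add, map_add, hx, hy, add_zero]

end BaseChange
end SB

end

noncomputable section
namespace SB

/-! ### Ranks of right ideals -/

section Rank

variable {R M : Type*} [CommRing R] [AddCommGroup M] [Module R M] {k : ℕ}

lemma exists_proj_grassmannian (N : Module.Grassmannian R M k) :
    ∃ π : M →ₗ[R] N.toSubmodule, ∀ x : N.toSubmodule, π x = x := by
  obtain ⟨s, hs⟩ := Module.projective_lifting_property N.toSubmodule.mkQ .id
    N.toSubmodule.mkQ_surjective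
  have hmem (x : M) : (LinearMap.id - s ∘ₗ N.toSubmodule.mkQ : _ →ₗ[R] _) x ∈ N.toSubmodule := by
    have := LinearMap.congr_fun hs (N.toSubmodule.mkQ x)
    simp only [LinearMap.comp_apply, LinearMap.id_apply] at this
    rw [← Submodule.Quotient.mk_eq_zero, ← Submodule.mkQ_apply, LinearMap.sub_apply,
      LinearMap.id_apply, LinearMap.comp_apply, map_sub, this, sub_self]
  refine ⟨(LinearMap.id - s ∘ₗ N.toSubmodule.mkQ).codRestrict _ hmem, fun x => Subtype.ext ?_⟩
  have : N.toSubmodule.mkQ x = 0 := by simp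
  change x.1 - s (N.toSubmodule.mkQ x.1) = x.1
  rw [this, map_zero, sub_zero]

instance (N : Module.Grassmannian R M k) [Module.Projective R M] :
    Module.Projective R N.toSubmodule := by
  obtain ⟨π, hπ⟩ := exists_proj_grassmannian N
  exact .of_split N.toSubmodule.subtype π (LinearMap.ext hπ)

instance (N : Module.Grassmannian R M k) [Module.Finite R M] :
    Module.Finite R N.toSubmodule := by
  obtain ⟨π, hπ⟩ := exists_proj_grassmannian N
  exact .of_surjective π fun x => ⟨x, hπ x⟩

/-- A retraction onto `N` splits `M` as `N × M / N`, and ranks add. -/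
lemma rankAtStalk_grassmannian (N : Module.Grassmannian R M k) [Module.Free R M] [Module.Finite R M]
    (p : PrimeSpectrum R) :
    Module.rankAtStalk (R := R) N.toSubmodule p + k = Module.finrank R M := by
  obtain ⟨π, hπ⟩ := exists_proj_grassmannian N
  have : Nontrivial R := p.nontrivial
  let e : M ≃ₗ[R] N.toSubmodule × (M ⧸ N.toSubmodule) :=
    LinearEquiv.ofBijective (π.prod N.toSubmodule.mkQ) <| by
      constructor
      · rw [injective_iff_map_eq_zero]
        intro x hx
        simp only [LinearMap.prod_apply, Function.prod_apply, Prod.mk_eq_zero, Submodule.mkQ_apply,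
          Submodule.Quotient.mk_eq_zero] at hx
        have h := congr_arg Subtype.val (hπ ⟨x, hx.2⟩)
        change (π x).1 = x at h
        rw [← h, hx.1]
        rfl
      · rintro ⟨y, q⟩
        obtain ⟨z, rfl⟩ := N.toSubmodule.mkQ_surjective q
        refine ⟨y + (z - π z), ?_⟩
        have h1 : N.toSubmodule.mkQ y = 0 := by simp
        have h2 : N.toSubmodule.mkQ (π z) = 0 := by simp
        simp only [LinearMap.prod_apply, Function.prod_apply, map_add, map_sub, hπ, h1, h2]
        simp
  have h := congr_fun (Module.rankAtStalk_eq_of_equiv e) p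
  rw [Module.rankAtStalk_prod, Module.rankAtStalk_eq_finrank_of_free, Pi.add_apply,
    N.rankAtStalk_eq] at h
  exact h.symm

end Rank

/-! ### Left identities have rank one in the split representation -/

section RankOne

variable {F A : Type u} [Field F] [Ring A] [Algebra F A] {n : ℕ}
  {K : Type u} [Field K] [Algebra F K] (ρ : A →ₐ[F] Matrix (Fin n) (Fin n) K)
  (b : Module.Basis (Fin (n ^ 2)) F A) (hρ : LinearIndependent K fun i => ρ (b i))
  {R R' : Type u} [CommRing R] [Algebra F R] [CommRing R'] [Algebra F R']

variable (R) in
/-- The split representation over an extension of the base field. -/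
def rhoR : R ⊗[F] A →ₐ[R] Matrix (Fin n) (Fin n) (R ⊗[F] K) :=
  Algebra.TensorProduct.lift (Algebra.ofId R _)
    ((Algebra.TensorProduct.includeRight (R := F) (A := R) (B := K)).mapMatrix.comp ρ)
    fun r _ => (Algebra.commutes r _ : Commute _ _)

lemma rhoR_tmul (r : R) (a : A) :
    rhoR ρ R (r ⊗ₜ a) = r • (ρ a).map (Algebra.TensorProduct.includeRight (R := F) (A := R)) := by
  rw [Algebra.smul_def]
  exact Algebra.TensorProduct.lift_tmul ..

/-- The matrix of left multiplication with respect to a basis over the base field. -/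
def lmR (e : R ⊗[F] A) : Matrix (Fin (n ^ 2)) (Fin (n ^ 2)) R :=
  Algebra.leftMulMatrix (b.baseChange R) e

lemma lmR_add (x y : R ⊗[F] A) : lmR b (x + y) = lmR b x + lmR b y := map_add _ _ _

lemma lmR_mul (x y : R ⊗[F] A) : lmR b (x * y) = lmR b x * lmR b y := map_mul _ _ _

lemma lmR_tmul (r : R) (a : A) : lmR b (r ⊗ₜ a) =
    r • (Algebra.leftMulMatrix b a).map (algebraMap F R) := by
  ext i j
  simp only [lmR, Algebra.leftMulMatrix_eq_repr_mul, Module.Basis.baseChange_apply,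
    Algebra.TensorProduct.tmul_mul_tmul, mul_one, Matrix.smul_apply, Matrix.map_apply,
    Module.Basis.baseChange_repr_tmul, smul_eq_mul]
  rw [Algebra.smul_def, mul_comm]

lemma lmR_mulVec_repr (e s : R ⊗[F] A) :
    (lmR b e).mulVec ((b.baseChange R).repr s) = (b.baseChange R).repr (e * s) := by
  rw [lmR, Algebra.leftMulMatrix_mulVec_repr]

lemma lmR_bcHom (φ : R →ₐ[F] R') (e : R ⊗[F] A) :
    lmR b (bcHom φ A e) = (lmR b e).map φ := by
  induction e with
  | zero =>
    have h0 (Q : Type u) [CommRing Q] [Algebra F Q] : lmR b (0 : Q ⊗[F] A) = 0 := map_zero _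
    rw [map_zero, h0, h0]
    ext; simp
  | tmul r a =>
    rw [bcHom_tmul, lmR_tmul, lmR_tmul]
    ext i j
    simp
  | add x y hx hy =>
    rw [map_add, lmR_add, hx, hy, lmR_add]
    ext; simp

lemma rhoR_bcHom (φ : R →ₐ[F] R') (e : R ⊗[F] A) :
    rhoR ρ R' (bcHom φ A e) = (rhoR ρ R e).map (bcHom φ K) := by
  induction e with
  | zero =>
    rw [map_zero, map_zero, map_zero]
    ext; simp
  | tmul r a =>
    rw [bcHom_tmul, rhoR_tmul, rhoR_tmul]
    ext i j
    simp [smul_tmul']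
  | add x y hx hy =>
    rw [map_add, map_add, hx, hy, map_add]
    ext; simp

/-- A constant matrix as a matrix of functions. -/
def cst (R : Type u) [CommRing R] [Algebra F R] {ι κ : Type*} (M : Matrix ι κ K) :
    Matrix ι κ (R ⊗[F] K) :=
  M.map (Algebra.TensorProduct.includeRight (R := F) (A := R) (B := K))

variable [NeZero n]

/-- The matrices `C` and `D` are constant, so the relations extend by additivity from pure tensors
`r ⊗ a`, where they come from `intertwines_const`. -/
lemma intertwines_base (e : R ⊗[F] A) :
    Intertwines ((lmR b e).map (algebraMap R (R ⊗[F] K))) (rhoR ρ R e)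
      (fun j => cst (F := F) R (colC ρ b hρ j)) (fun j => cst (F := F) R (colD ρ b j)) := by
  have h0 (a : A) := (intertwines_const ρ b hρ a).map
    (Algebra.TensorProduct.includeRight (R := F) (A := R) (B := K)).toRingHom
  have h1 (a : A) : ((Algebra.leftMulMatrix b a).map (algebraMap F K)).map
      (Algebra.TensorProduct.includeRight (R := F) (A := R) (B := K)) =
      ((Algebra.leftMulMatrix b a).map (algebraMap F R)).map (algebraMap R (R ⊗[F] K)) := by
    ext i j
    simp only [Matrix.map_apply, AlgHom.commutes]
    rw [← IsScalarTower.algebraMap_apply]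
  have h2 (r : R) (M : Matrix (Fin (n ^ 2)) (Fin (n ^ 2)) R) : (r • M).map (algebraMap R (R ⊗[F] K)) =
      r • M.map (algebraMap R (R ⊗[F] K)) := by
    ext i j
    simp only [Matrix.map_apply, Matrix.smul_apply, smul_eq_mul, map_mul]
    rw [← Algebra.smul_def]
  have h3 : (0 : Matrix (Fin (n ^ 2)) (Fin (n ^ 2)) R).map (algebraMap R (R ⊗[F] K)) = 0 := by
    ext; simp
  have h4 (x y : Matrix (Fin (n ^ 2)) (Fin (n ^ 2)) R) : (x + y).map (algebraMap R (R ⊗[F] K)) =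
      x.map (algebraMap R (R ⊗[F] K)) + y.map (algebraMap R (R ⊗[F] K)) := by
    ext i j
    exact map_add (algebraMap R (R ⊗[F] K)) _ _
  have h5 : lmR b (0 : R ⊗[F] A) = 0 := map_zero _
  refine ⟨fun j => ?_, fun j => ?_, (h0 1).sum_C_D, (h0 1).D_C⟩
  · induction e with
    | zero => rw [h5, h3, map_zero, Matrix.zero_mul, Matrix.mul_zero]
    | tmul r a =>
      rw [lmR_tmul, h2, ← h1, rhoR_tmul, Matrix.smul_mul, Matrix.mul_smul]
      exact congr_arg (r • ·) ((h0 a).comp_C j)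
    | add x y hx hy => rw [lmR_add, h4, map_add, Matrix.add_mul, hx, hy, Matrix.mul_add]
  · induction e with
    | zero => rw [h5, h3, map_zero, Matrix.zero_mul, Matrix.mul_zero]
    | tmul r a =>
      rw [lmR_tmul, h2, ← h1, rhoR_tmul, Matrix.smul_mul, Matrix.mul_smul]
      exact congr_arg (r • ·) ((h0 a).D_comp j)
    | add x y hx hy => rw [lmR_add, h4, map_add, Matrix.mul_add, hx, hy, Matrix.add_mul]

include b hρ in
/-- A left identity of a right ideal of reduced dimension one becomes a matrix of rank one. -/
theorem rankOne_leftIdentity (N : RightIdealPoint F A n R) {e : R ⊗[F] A} (he : e ∈ N.toSubmodule)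
    (h : ∀ x ∈ N.toSubmodule, e * x = x) :
    (∀ i j a c, rhoR ρ R e i a * rhoR ρ R e j c = rhoR ρ R e j a * rhoR ρ R e i c) ∧
      (rhoR ρ R e).trace = 1 := by
  -- Both identities are checked in the local rings `Q` of `R ⊗ K`. The extension of `N` to `Q` is
  -- the module of fixed vectors of left multiplication by `e` and is free of rank `n`. It consists
  -- of `n` copies of the fixed vectors of `ρ(e)`, which therefore have rank `1`.
  have key (m : Ideal (R ⊗[F] K)) [m.IsMaximal] :
      (∀ i j a c, algebraMap _ (Localization.AtPrime m)
        (rhoR ρ R e i a * rhoR ρ R e j c - rhoR ρ R e j a * rhoR ρ R e i c) = 0) ∧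
      algebraMap _ (Localization.AtPrime m) ((rhoR ρ R e).trace - 1) = 0 := by
    let Q := Localization.AtPrime m
    let φ : R →ₐ[F] Q := (IsScalarTower.toAlgHom F (R ⊗[F] K) Q).comp
      Algebra.TensorProduct.includeLeft
    have hI := (intertwines_base ρ b hρ e).map (algebraMap (R ⊗[F] K) Q)
    have hp : ((lmR b e).map (algebraMap R (R ⊗[F] K))).map (algebraMap (R ⊗[F] K) Q) =
        lmR b (bcHom φ A e) := by
      rw [lmR_bcHom]
      rfl
    rw [hp] at hI
    let N' := Module.Grassmannian.map φ N.toGrassmannian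
    have hN' (s) : s ∈ N'.toSubmodule ↔ bcHom φ A e * s = s := mem_map_iff φ _ he h N.mul_mem s
    have hee : bcHom φ A e * bcHom φ A e = bcHom φ A e := by rw [← map_mul, h e he]
    let E : N'.toSubmodule ≃ₗ[Q] fixVec (lmR b (bcHom φ A e)) :=
      LinearEquiv.ofSubmodules (b.baseChange Q).equivFun _ _ (by
        ext v
        rw [Submodule.mem_map, mem_fixVec]
        constructor
        · rintro ⟨s, hs, rfl⟩
          change (lmR b _).mulVec ((b.baseChange Q).repr s) = (b.baseChange Q).repr s
          rw [lmR_mulVec_repr, (hN' s).1 hs]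
        · intro hv
          obtain ⟨s, rfl⟩ := (b.baseChange Q).equivFun.surjective v
          refine ⟨s, (hN' s).2 ((b.baseChange Q).repr.injective (DFunLike.coe_injective ?_)), rfl⟩
          rw [← lmR_mulVec_repr]
          exact hv)
    have hfr : Module.finrank Q (fixVec (lmR b (bcHom φ A e))) = Fintype.card (Fin n) := by
      rw [← E.finrank_eq]
      have : FiniteDimensional F A := Module.Finite.of_basis b
      have h1 := rankAtStalk_grassmannian N' (IsLocalRing.closedPoint Q)
      have hfree : Module.Free Q N'.toSubmodule := by
        have hp : Module.Projective Q N'.toSubmodule := inferInstance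
        have hf : Module.Flat Q N'.toSubmodule := @Module.Flat.of_projective _ _ _ _ _ hp
        exact @Module.free_of_flat_of_isLocalRing _ _ _ _ _ _ _ hf
      rw [Module.rankAtStalk_eq_finrank_of_free, Module.finrank_baseChange,
        Module.finrank_eq_card_basis b, Fintype.card_fin] at h1
      rw [Fintype.card_fin]
      -- The quotient has rank `n ^ 2 - n`, a truncated subtraction; this inequality is needed to
      -- conclude that the ideal has rank `n`.
      have h2 : n ≤ n ^ 2 := Nat.le_self_pow two_ne_zero n
      simp only [Pi.natCast_apply, Nat.cast_id] at h1
      omega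
    have hidem : lmR b (bcHom φ A e) * lmR b (bcHom φ A e) = lmR b (bcHom φ A e) := by
      rw [← lmR_mul, hee]
    obtain ⟨r1, r2⟩ := hI.rankOne hidem hfr
    refine ⟨fun i j a c => ?_, ?_⟩
    · rw [map_sub, map_mul, map_mul, sub_eq_zero]
      exact r1 i j a c
    · rw [map_sub, map_one, sub_eq_zero, ← r2]
      simp only [Matrix.trace, map_sum]
      rfl
  refine ⟨fun i j a c => sub_eq_zero.1 (eq_zero_of_localization _ fun m _ => (key m).1 i j a c),
    sub_eq_zero.1 (eq_zero_of_localization _ fun m _ => (key m).2)⟩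

end RankOne
end SB

end

/-! ### The tautological sheaf in terms of left identities -/

noncomputable section
namespace SB

lemma repr_bcHom {F A : Type u} [Field F] [Ring A] [Algebra F A] {R R' : Type u} [CommRing R]
    [CommRing R'] [Algebra F R] [Algebra F R'] {ι : Type*} (b : Module.Basis ι F A)
    (φ : R →ₐ[F] R') (s : R ⊗[F] A) (j : ι) :
    (b.baseChange R').repr (bcHom φ A s) j = φ ((b.baseChange R).repr s j) := by
  induction s with
  | zero => simp
  | tmul a b => simp [Algebra.smul_def]
  | add a b ha hb => simp only [map_add, Finsupp.add_apply, ha, hb]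

lemma bcHom_comp {F A : Type u} [Field F] [Ring A] [Algebra F A] {R R' R'' : Type u} [CommRing R]
    [CommRing R'] [CommRing R''] [Algebra F R] [Algebra F R'] [Algebra F R'']
    (φ : R →ₐ[F] R') (ψ : R' →ₐ[F] R'') (s : R ⊗[F] A) :
    bcHom ψ A (bcHom φ A s) = bcHom (ψ.comp φ) A s :=
  SeveriBrauer.rTensor_comp φ ψ s

namespace SeveriBrauer

variable {F A : Type u} [Field F] [Ring A] [Algebra F A] {n : ℕ} (S : SeveriBrauer F A n)

lemma res_comp_res {U V W : S.X.Opens} (h : V ≤ U) (h' : W ≤ V) :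
    (S.res h').comp (S.res h) = S.res (h'.trans h) := by
  ext a
  exact congr($(S.X.presheaf.map_comp (homOfLE h).op (homOfLE h').op) a).symm

lemma res_refl (U : S.X.Opens) : S.res (le_refl U) = AlgHom.id F _ := by
  ext a; exact congr($(S.X.presheaf.map_id (op U)) a)

lemma section_ext {U : S.X.Opens} {s t : Γ(S.X, U)}
    (h : ∀ x (hx : x ∈ U), S.germ x hx s = S.germ x hx t) : s = t :=
  TopCat.Presheaf.section_ext S.X.sheaf U s t h

lemma tensor_section_ext {B : Type u} [Ring B] [Algebra F B] {U : S.X.Opens}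
    {s t : Γ(S.X, U) ⊗[F] B}
    (h : ∀ x (hx : x ∈ U), bcHom (S.germ x hx) B s = bcHom (S.germ x hx) B t) : s = t := by
  let b := Module.Free.chooseBasis F B
  refine (b.baseChange _).repr.injective (Finsupp.ext fun j => S.section_ext fun x hx => ?_)
  rw [← repr_bcHom, ← repr_bcHom, h]

lemma fromSpec_structMap {U : S.X.Opens} (hU : IsAffineOpen U) : hU.fromSpec ≫ S.structMap =
    Spec.map (CommRingCat.ofHom (algebraMap F Γ(S.X, U))) := by
  refine ext_of_isAffine ?_
  have h : Spec.map (CommRingCat.ofHom (algebraMap F Γ(S.X, U))) =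
      Spec.map ((Scheme.ΓSpecIso (CommRingCat.of F)).inv ≫ S.structMap.appTop ≫
        S.X.presheaf.map (homOfLE (le_top : U ≤ ⊤)).op) := rfl
  have h1 : hU.fromSpec.appTop = _ := hU.fromSpec_app_of_le ⊤ le_top
  rw [h, Scheme.Hom.comp_appTop, h1, ← cancel_epi (Scheme.ΓSpecIso (CommRingCat.of F)).inv,
    ← Scheme.ΓSpecIso_inv_naturality]
  have h' : (Spec Γ(S.X, U)).presheaf.map
      (homOfLE (le_top : (⊤ : (Spec Γ(S.X, U)).Opens) ≤ ⊤)).op = 𝟙 _ :=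
    (Spec Γ(S.X, U)).presheaf.map_id _
  simp only [Category.assoc]
  erw [h', Category.comp_id]
  rfl

/-- The right ideal given by an affine open subset. -/
def idealOn {U : S.X.Opens} (hU : IsAffineOpen U) : RightIdealPoint F A n Γ(S.X, U) :=
  S.points Γ(S.X, U) ⟨hU.fromSpec, S.fromSpec_structMap hU⟩

/-- The canonical morphism from the spectrum of the local ring factors through `hU.fromSpec`, so
naturality of `points` applies to the germ map. -/
lemma idealAt_eq {U : S.X.Opens} (hU : IsAffineOpen U) (x : S.X) (hx : x ∈ U) :
    S.idealAt x =
      (Module.Grassmannian.map (S.germ x hx) (S.idealOn hU).toGrassmannian).toSubmodule := by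
  have h : Spec.map (CommRingCat.ofHom (S.germ x hx).toRingHom) ≫ hU.fromSpec =
      S.X.fromSpecStalk x := hU.fromSpecStalk_eq_fromSpecStalk hx
  have h1 := S.points_map (S.germ x hx) hU.fromSpec (S.fromSpec_structMap hU)
    (by rw [h]; exact S.fromSpecStalk_structMap x)
  rw [idealOn, ← h1, idealAt]
  exact congr_arg (fun f => (S.points (S.X.presheaf.stalk x) f).toSubmodule) (Subtype.ext h.symm)

/-- A choice of left identities of the right ideals given by affine open subsets. -/
structure LeftId where
  /-- the left identity over an affine open subset -/
  e {U : S.X.Opens} (hU : IsAffineOpen U) : Γ(S.X, U) ⊗[F] A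
  mem {U : S.X.Opens} (hU : IsAffineOpen U) : e hU ∈ (S.idealOn hU).toSubmodule
  mul_eq {U : S.X.Opens} (hU : IsAffineOpen U) : ∀ x ∈ (S.idealOn hU).toSubmodule, e hU * x = x

theorem nonempty_leftId {K : Type u} [Field K] [Algebra F K] [NeZero n]
    (ρ : A →ₐ[F] Matrix (Fin n) (Fin n) K)
    (b : Module.Basis (Fin (n ^ 2)) F A) (hρ : LinearIndependent K fun i => ρ (b i)) :
    Nonempty S.LeftId := by
  obtain ⟨θ, h1, h2⟩ := exists_separability ρ b hρ
  have h {U : S.X.Opens} (hU : IsAffineOpen U) := exists_left_identity h1 h2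
    (S.idealOn hU).toSubmodule (S.idealOn hU).mul_mem
  exact ⟨⟨fun hU => (h hU).choose, fun hU => (h hU).choose_spec.1,
    fun hU => (h hU).choose_spec.2⟩⟩

variable {S} (E : S.LeftId)

namespace LeftId

/-- Sections of the tautological sheaf in terms of a left identity. -/
theorem mem_tautSections {U V : S.X.Opens} (hU : IsAffineOpen U) (h : V ≤ U)
    (s : Γ(S.X, V) ⊗[F] A) : s ∈ S.tautSections V ↔ bcHom (S.res h) A (E.e hU) * s = s := by
  -- The ideal at a stalk is the base change of the ideal over `U`, hence the set of elements fixed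
  -- by left multiplication by the germ of `e`. Equality of sections is then tested on germs.
  have key (x : S.X) (hx : x ∈ V) : (S.germ x hx).toLinearMap.rTensor A s ∈ S.idealAt x ↔
      bcHom (S.germ x hx) A (bcHom (S.res h) A (E.e hU) * s) = bcHom (S.germ x hx) A s := by
    rw [S.idealAt_eq hU x (h hx), mem_map_iff _ _ (E.mem hU) (E.mul_eq hU) (S.idealOn hU).mul_mem,
      map_mul, bcHom_comp, germ_comp_res]
    rfl
  exact ⟨fun hs => S.tensor_section_ext fun x hx => (key x hx).1 (hs x hx),
    fun hs x hx => (key x hx).2 (by rw [hs])⟩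

lemma e_mul_e {U : S.X.Opens} (hU : IsAffineOpen U) : E.e hU * E.e hU = E.e hU :=
  E.mul_eq hU _ (E.mem hU)

lemma res_e_mem {U V : S.X.Opens} (hU : IsAffineOpen U) (h : V ≤ U) :
    bcHom (S.res h) A (E.e hU) ∈ S.tautSections V := by
  rw [E.mem_tautSections hU h, ← map_mul, E.e_mul_e]

lemma e_mem {U : S.X.Opens} (hU : IsAffineOpen U) : E.e hU ∈ S.tautSections U := by
  have := E.res_e_mem hU le_rfl
  rw [S.res_refl] at this
  simpa [bcHom] using this

/-- The left identities over two affine open subsets absorb each other. -/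
lemma res_e_mul_res_e {U U' V : S.X.Opens} (hU : IsAffineOpen U) (hU' : IsAffineOpen U')
    (h : V ≤ U) (h' : V ≤ U') : bcHom (S.res h) A (E.e hU) * bcHom (S.res h') A (E.e hU') =
      bcHom (S.res h') A (E.e hU') :=
  (E.mem_tautSections hU h _).1 (E.res_e_mem hU' h')

end LeftId

lemma tautSections_mul_mem {V : S.X.Opens} {s : Γ(S.X, V) ⊗[F] A} (hs : s ∈ S.tautSections V)
    (y : Γ(S.X, V) ⊗[F] A) : s * y ∈ S.tautSections V := fun x hx => by
  have h := (S.points (S.X.presheaf.stalk x)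
    ⟨S.X.fromSpecStalk x, S.fromSpecStalk_structMap x⟩).mul_mem _ (hs x hx)
    (bcHom (S.germ x hx) A y)
  have h' := map_mul (bcHom (S.germ x hx) A) s y
  rw [bcHom_eq_rTensor] at h'
  rw [h']
  exact h

lemma tautSections_res {U V : S.X.Opens} (h : V ≤ U) {s : Γ(S.X, U) ⊗[F] A}
    (hs : s ∈ S.tautSections U) : bcHom (S.res h) A s ∈ S.tautSections V :=
  (S.tautRes h ⟨s, hs⟩).2

end SeveriBrauer
end SB

end

noncomputable section
namespace SB

/-! ### Sections of sheaves of modules and quasi-coherence -/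

section Sections

variable {X : Scheme.{u}}

/-- Restriction of sections of a sheaf of modules. -/
def mres (M : X.Modules) {U V : X.Opens} (h : V ≤ U) : Γ(M, U) →+ Γ(M, V) :=
  (M.presheaf.map (homOfLE h).op).hom

/-- Restriction of functions. -/
def fres {U V : X.Opens} (h : V ≤ U) : Γ(X, U) →+* Γ(X, V) :=
  (X.presheaf.map (homOfLE h).op).hom

lemma mres_mres (M : X.Modules) {U V W : X.Opens} (h : V ≤ U) (h' : W ≤ V) (x : Γ(M, U)) :
    mres M h' (mres M h x) = mres M (h'.trans h) x :=
  congr($(M.presheaf.map_comp (homOfLE h).op (homOfLE h').op) x).symm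

lemma fres_fres {U V W : X.Opens} (h : V ≤ U) (h' : W ≤ V) (x : Γ(X, U)) :
    fres h' (fres h x) = fres (h'.trans h) x :=
  congr($(X.presheaf.map_comp (homOfLE h).op (homOfLE h').op) x).symm

lemma fres_refl {U : X.Opens} (x : Γ(X, U)) : fres le_rfl x = x :=
  congr($(X.presheaf.map_id (op U)) x)

lemma mres_smul (M : X.Modules) {U V : X.Opens} (h : V ≤ U) (r : Γ(X, U)) (x : Γ(M, U)) :
    mres M h (r • x) = fres h r • mres M h x :=
  M.map_smul (homOfLE h) r x

lemma app_mres {M N : X.Modules} (φ : M ⟶ N) {U V : X.Opens} (h : V ≤ U) (x : Γ(M, U)) :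
    φ.app V (mres M h x) = mres N h (φ.app U x) :=
  app_res φ (homOfLE h) x

lemma eq_of_mres_eq (M : X.Modules) {U : X.Opens} {x y : Γ(M, U)}
    (h : ∀ p ∈ U, ∃ (V : X.Opens) (h : V ≤ U), p ∈ V ∧ mres M h x = mres M h y) : x = y := by
  choose! V hV hp hx using h
  refine TopCat.Sheaf.eq_of_locally_eq' ⟨M.presheaf, M.isSheaf⟩ (fun p : U => V p.1) U
    (fun p => homOfLE (hV p.1 p.2)) (fun p hp' => ?_) x y fun p => hx p.1 p.2
  exact Opens.mem_iSup.2 ⟨⟨p, hp'⟩, hp p hp'⟩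

/-- A morphism of sheaves of modules given by its effect on sections. -/
def mkHom {M N : X.Modules} (f : ∀ U, Γ(M, U) →+ Γ(N, U))
    (hsmul : ∀ U (r : Γ(X, U)) x, f U (r • x) = r • f U x)
    (hres : ∀ {U V : X.Opens} (h : V ≤ U) x, f V (mres M h x) = mres N h (f U x)) : M ⟶ N where
  val := PresheafOfModules.homMk
    { app := fun U => AddCommGrpCat.ofHom (f U.unop)
      naturality := fun U V i => by
        ext x
        exact hres (leOfHom i.unop) x }
    fun U r x => hsmul U.unop r x

lemma mod_hom_ext {M N : X.Modules} {f g : M ⟶ N} (h : ∀ U x, f.app U x = g.app U x) : f = g := by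
  refine Scheme.Modules.hom_ext _ _ fun U => ?_
  ext x
  exact h U x

lemma comp_app_apply {M N K : X.Modules} (f : M ⟶ N) (g : N ⟶ K) (U : X.Opens) (x : Γ(M, U)) :
    (f ≫ g).app U x = g.app U (f.app U x) := rfl

lemma sum_app_apply {M N : X.Modules} {ι : Type*} (s : Finset ι) (f : ι → (M ⟶ N)) (U : X.Opens)
    (x : Γ(M, U)) : (∑ i ∈ s, f i).app U x = ∑ i ∈ s, (f i).app U x := by
  classical
  induction s using Finset.induction_on with
  | empty => rfl
  | insert a s ha ih =>
    rw [Finset.sum_insert ha, Finset.sum_insert ha, ← ih]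
    rfl

/-- A morphism is determined by a family of open subsets which contains arbitrarily small
neighbourhoods of every point. -/
lemma hom_ext_of_small {M N : X.Modules} {f g : M ⟶ N} (P : X.Opens → Prop)
    (hP : ∀ (U : X.Opens), ∀ p ∈ U, ∃ V ≤ U, p ∈ V ∧ P V)
    (h : ∀ U, P U → ∀ x, f.app U x = g.app U x) : f = g := by
  refine mod_hom_ext fun U x => eq_of_mres_eq N fun p hp => ?_
  obtain ⟨V, hV, hpV, hPV⟩ := hP U p hp
  exact ⟨V, hV, hpV, by rw [← app_mres, ← app_mres, h V hPV]⟩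

lemma exists_affine_le (U : X.Opens) (p : X) (hp : p ∈ U) :
    ∃ V ≤ U, p ∈ V ∧ IsAffineOpen V := by
  obtain ⟨_, ⟨V, hV, rfl⟩, hpV, h⟩ := X.isBasis_affineOpens.exists_subset_of_mem_open hp U.isOpen
  exact ⟨V, h, hpV, hV⟩

lemma epi_of_locally_surjective {M N : X.Modules} (f : M ⟶ N)
    (h : ∀ U : X.Opens, IsAffineOpen U → ∀ y : Γ(N, U), ∃ x, f.app U x = y) : Epi f := by
  refine ⟨fun {K} a b hab => hom_ext_of_small IsAffineOpen exists_affine_le fun U hU y => ?_⟩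
  obtain ⟨x, rfl⟩ := h U hU y
  exact congr(($hab).app U x)

end Sections

section Quasicoherent

variable {X : Scheme.{u}}

/-- The scalar action in `isQcoh_spec_iff` passes through `ΓSpecIso`; here it is identified with the
action by restriction of functions on `X`. -/
lemma smul_restrict_fromSpec (M : X.Modules) {W : X.Opens} (hW : IsAffineOpen W)
    (V : (Spec Γ(X, W)).Opens) (hV : hW.fromSpec ''ᵁ V ≤ W) (r : Γ(X, W))
    (x : Γ(M.restrict hW.fromSpec, V)) :
    r • x = (fres hV r • (show Γ(M, hW.fromSpec ''ᵁ V) from x) : Γ(M, hW.fromSpec ''ᵁ V)) := by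
  rw [Scheme.Modules.smul_Spec_def]
  have h : (Scheme.ΓSpecIso Γ(X, W)).inv ≫ (Spec Γ(X, W)).presheaf.map V.leTop.op ≫
      (hW.fromSpec.appIso V).inv = X.presheaf.map (homOfLE hV).op := by
    rw [← Category.assoc, Iso.comp_inv_eq]
    rw [Scheme.Hom.appIso_hom', Scheme.Hom.map_appLE, Scheme.Hom.appLE, hW.fromSpec_app_self,
      Category.assoc, ← Functor.map_comp]
    rfl
  exact congr($h r • (show Γ(M, hW.fromSpec ''ᵁ V) from x))

/-- Quasi-coherence in terms of sections over affine open subsets. -/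
theorem isQcoh_iff (M : X.Modules) : isQcoh X M ↔ ∀ (W : X.Opens) (_ : IsAffineOpen W) (f : Γ(X, W)),
    (∀ x : Γ(M, X.basicOpen f), ∃ (k : ℕ) (t : Γ(M, W)),
      fres (X.basicOpen_le f) (f ^ k) • x = mres M (X.basicOpen_le f) t) ∧
    ∀ t : Γ(M, W), mres M (X.basicOpen_le f) t = 0 → ∃ k : ℕ, f ^ k • t = 0 := by
  have key (W : X.Opens) (hW : IsAffineOpen W) : isQcoh _ (M.restrict hW.fromSpec) ↔
      ∀ f : Γ(X, W), (∀ x : Γ(M, X.basicOpen f), ∃ (k : ℕ) (t : Γ(M, W)),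
      fres (X.basicOpen_le f) (f ^ k) • x = mres M (X.basicOpen_le f) t) ∧
    ∀ t : Γ(M, W), mres M (X.basicOpen_le f) t = 0 → ∃ k : ℕ, f ^ k • t = 0 := by
    rw [isQcoh_spec_iff]
    refine forall_congr' fun f => ?_
    have h1 : hW.fromSpec ''ᵁ dOpen f = X.basicOpen f := hW.fromSpec_image_basicOpen f
    have h0 : hW.fromSpec ''ᵁ ⊤ = W := by
      rw [Scheme.Hom.image_top_eq_opensRange, hW.opensRange_fromSpec]
    -- The images of `⊤` and `dOpen f` equal `W` and `X.basicOpen f` only propositionally; stating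
    -- the equivalence for arbitrary `U` and `V` makes substitution possible.
    have e (U V : X.Opens) (hU : U = W) (hV : V = X.basicOpen f) (hVU : V ≤ U) :
      ((∀ x : Γ(M, V), ∃ (k : ℕ) (t : Γ(M, U)), fres (hV.trans_le (X.basicOpen_le f)) (f ^ k) • x =
        mres M hVU t) ∧ ∀ t : Γ(M, U), mres M hVU t = 0 → ∃ k : ℕ, fres hU.le (f ^ k) • t = 0) ↔
      ((∀ x : Γ(M, X.basicOpen f), ∃ (k : ℕ) (t : Γ(M, W)),
      fres (X.basicOpen_le f) (f ^ k) • x = mres M (X.basicOpen_le f) t) ∧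
        ∀ t : Γ(M, W), mres M (X.basicOpen_le f) t = 0 → ∃ k : ℕ, f ^ k • t = 0) := by
      subst hU hV
      simp only [fres_refl]
    rw [← e _ _ h0 h1 (Scheme.Hom.image_mono _ le_top)]
    refine and_congr (forall_congr' fun x => exists_congr fun k => exists_congr fun t => ?_)
      (forall_congr' fun t => imp_congr Iff.rfl (exists_congr fun k => ?_))
    · rw [smul_restrict_fromSpec M hW _ (h1.trans_le (X.basicOpen_le f))]
      exact Iff.rfl
    · rw [smul_restrict_fromSpec M hW _ h0.le]
      exact Iff.rfl
  refine ⟨fun h W hW => (key W hW).1 (isQcoh_restrict _ h), fun h => isQcoh_of_affine M fun W hW =>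
    (key W hW).2 (h W hW)⟩

end Quasicoherent
end SB

end

/-! ### Functions with coefficients in `K` and subsheaves of free modules -/

noncomputable section
set_option linter.unusedVariables false
namespace SB

lemma exists_nat_forall {J : Type*} [Finite J] {P : J → ℕ → Prop}
    (hP : ∀ j k l, k ≤ l → P j k → P j l) (h : ∀ j, ∃ k, P j k) : ∃ k, ∀ j, P j k := by
  choose k hk using h
  obtain ⟨l, hl⟩ := Set.finite_range k |>.bddAbove
  exact ⟨l, fun j => hP j _ _ (hl ⟨j, rfl⟩) (hk j)⟩

lemma exists_pow_smul_function {X : Scheme.{u}} {W : X.Opens} (hW : IsAffineOpen W) (f : Γ(X, W))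
    (x : Γ(X, X.basicOpen f)) : ∃ (k : ℕ) (t : Γ(X, W)),
      fres (X.basicOpen_le f) (f ^ k) * x = fres (X.basicOpen_le f) t := by
  have := hW.isLocalization_basicOpen f
  obtain ⟨k, t, h⟩ := IsLocalization.Away.surj f x
  refine ⟨k, t, ?_⟩
  rw [map_pow, mul_comm]
  exact h

lemma exists_pow_mul_function_eq_zero {X : Scheme.{u}} {W : X.Opens} (hW : IsAffineOpen W)
    (f : Γ(X, W)) (t : Γ(X, W)) (ht : fres (X.basicOpen_le f) t = 0) : ∃ k : ℕ, f ^ k * t = 0 := by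
  have := hW.isLocalization_basicOpen f
  obtain ⟨⟨_, k, rfl⟩, h⟩ := (IsLocalization.map_eq_zero_iff (.powers f)
    Γ(X, X.basicOpen f) t).1 ht
  exact ⟨k, h⟩

namespace SeveriBrauer

section

variable {F A : Type u} [Field F] [Ring A] [Algebra F A] {n : ℕ} (S : SeveriBrauer F A n)
  (K : Type u) [Field K] [Algebra F K]

/-- Functions with coefficients in an extension of the base field. -/
abbrev GK (U : S.X.Opens) : Type u := Γ(S.X, U) ⊗[F] K

/-- Restriction of functions with coefficients in an extension of the base field. -/
def resK {U V : S.X.Opens} (h : V ≤ U) : S.GK K U →ₐ[F] S.GK K V := bcHom (S.res h) K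

variable {S K}

lemma resK_resK {U V W : S.X.Opens} (h : V ≤ U) (h' : W ≤ V) (x : S.GK K U) :
    S.resK K h' (S.resK K h x) = S.resK K (h'.trans h) x := by
  rw [resK, resK, bcHom_comp, res_comp_res]; rfl

lemma resK_refl {U : S.X.Opens} (h : U ≤ U) (x : S.GK K U) : S.resK K h x = x := by
  rw [resK, res_refl]
  exact congr($(Algebra.TensorProduct.map_id (R := F) (S := F)) x)

lemma resK_smul {U V : S.X.Opens} (h : V ≤ U) (r : Γ(S.X, U)) (x : S.GK K U) :
    S.resK K h (r • x) = fres h r • S.resK K h x :=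
  bcHom_smul (S.res h) r x

lemma GK_ext {U : S.X.Opens} {x y : S.GK K U}
    (h : ∀ p ∈ U, ∃ (V : S.X.Opens) (h : V ≤ U), p ∈ V ∧ S.resK K h x = S.resK K h y) : x = y := by
  refine S.tensor_section_ext fun p hp => ?_
  obtain ⟨V, hV, hpV, h⟩ := h p hp
  rw [← S.germ_comp_res hV p hpV, ← bcHom_comp, ← bcHom_comp]
  exact congr_arg _ h

/-- Gluing is done coordinate by coordinate in a basis of `K` over `F`. Finiteness of the basis
ensures that the glued coordinates define an element of the tensor product. -/
lemma GK_glue [FiniteDimensional F K] {ι : Type*} (U : ι → S.X.Opens) (s : ∀ i, S.GK K (U i))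
    (hs : ∀ i j, S.resK K (inf_le_left : U i ⊓ U j ≤ U i) (s i) = S.resK K inf_le_right (s j)) :
    ∃ t : S.GK K (iSup U), ∀ i, S.resK K (le_iSup U i) t = s i := by
  let b := Module.Free.chooseBasis F K
  have hc (j) : TopCat.Presheaf.IsCompatible S.X.presheaf U
      (fun i => (b.baseChange Γ(S.X, U i)).repr (s i) j) := by
    intro i k
    have h1 := repr_bcHom b (S.res (inf_le_left : U i ⊓ U k ≤ U i)) (s i) j
    have h2 := repr_bcHom b (S.res (inf_le_right : U i ⊓ U k ≤ U k)) (s k) j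
    have h3 : bcHom (S.res (inf_le_left : U i ⊓ U k ≤ U i)) K (s i) =
      bcHom (S.res (inf_le_right : U i ⊓ U k ≤ U k)) K (s k) := hs i k
    rw [h3] at h1
    exact h1.symm.trans h2
  have hg (j) := S.X.sheaf.existsUnique_gluing U _ (hc j)
  choose g hg1 hg2 using hg
  refine ⟨(b.baseChange _).repr.symm (Finsupp.equivFunOnFinite.symm g), fun i => ?_⟩
  apply (b.baseChange _).repr.injective
  ext j
  rw [resK, repr_bcHom, LinearEquiv.apply_symm_apply]
  exact hg1 j i

variable {ι κ : Type}

/-- Restriction of vectors of functions. -/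
def vres {U V : S.X.Opens} (h : V ≤ U) : (ι → S.GK K U) →+ (ι → S.GK K V) where
  toFun v i := S.resK K h (v i)
  map_zero' := by ext; simp
  map_add' _ _ := by ext; simp

@[simp] lemma vres_apply {U V : S.X.Opens} (h : V ≤ U) (v : ι → S.GK K U) (i : ι) :
    vres h v i = S.resK K h (v i) := rfl

lemma vres_vres {U V W : S.X.Opens} (h : V ≤ U) (h' : W ≤ V) (v : ι → S.GK K U) :
    vres h' (vres h v) = vres (h'.trans h) v := funext fun _ => resK_resK _ _ _

lemma vres_refl {U : S.X.Opens} (h : U ≤ U) (v : ι → S.GK K U) : vres h v = v :=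
  funext fun _ => resK_refl _ _

lemma vres_smul {U V : S.X.Opens} (h : V ≤ U) (r : Γ(S.X, U)) (v : ι → S.GK K U) :
    vres h (r • v) = fres h r • vres h v := funext fun _ => resK_smul _ _ _

lemma vec_ext {U : S.X.Opens} {x y : ι → S.GK K U}
    (h : ∀ p ∈ U, ∃ (V : S.X.Opens) (h : V ≤ U), p ∈ V ∧ vres h x = vres h y) : x = y := by
  refine funext fun i => GK_ext fun p hp => ?_
  obtain ⟨V, hV, hpV, h⟩ := h p hp
  exact ⟨V, hV, hpV, congr_fun h i⟩

end

section

variable {F A : Type u} [Field F] [Ring A] [Algebra F A] {n : ℕ} (S : SeveriBrauer F A n)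
  (K : Type u) [Field K] [Algebra F K] (ι : Type)

/-- A subsheaf of modules of a free sheaf of modules over the functions with coefficients
in an extension of the base field. -/
structure LocSub where
  /-- the sections over an open subset -/
  carrier (U : S.X.Opens) : Submodule Γ(S.X, U) (ι → S.GK K U)
  res_mem {U V : S.X.Opens} (h : V ≤ U) {v : ι → S.GK K U} : v ∈ carrier U → vres h v ∈ carrier V
  loc {U : S.X.Opens} {v : ι → S.GK K U} : (∀ p ∈ U, ∃ (V : S.X.Opens) (h : V ≤ U), p ∈ V ∧
    vres h v ∈ carrier V) → v ∈ carrier U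

end

namespace LocSub

variable {F A : Type u} [Field F] [Ring A] [Algebra F A] {n : ℕ} {S : SeveriBrauer F A n}
  {K : Type u} [Field K] [Algebra F K] {ι κ τ : Type} (L : S.LocSub K ι) (L' : S.LocSub K κ)
  (L'' : S.LocSub K τ)

/-- The underlying presheaf of abelian groups. -/
def presheafAb : TopCat.Presheaf Ab.{u} S.X where
  obj U := AddCommGrpCat.of (L.carrier U.unop)
  map f := AddCommGrpCat.ofHom
    (((vres (leOfHom f.unop)).comp (L.carrier _).subtype.toAddMonoidHom).codRestrict
      (L.carrier _) fun v => L.res_mem _ v.2)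
  map_id U := AddCommGrpCat.ext fun s => Subtype.ext (vres_refl _ _)
  map_comp f g := AddCommGrpCat.ext fun s => Subtype.ext (vres_vres _ _ _).symm

instance (U : (Opens S.X)ᵒᵖ) : Module (S.X.ringCatSheaf.obj.obj U) (L.presheafAb.obj U) :=
  inferInstanceAs (Module Γ(S.X, U.unop) (L.carrier U.unop))

lemma presheafAb_isSheaf [FiniteDimensional F K] : L.presheafAb.IsSheaf := by
  rw [TopCat.Presheaf.isSheaf_iff_isSheafUniqueGluing]
  intro I U sf hsf
  have h (i : ι) := GK_glue (K := K) U (fun k => (sf k).1 i)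
    fun k l => congr_fun (congr_arg Subtype.val (hsf k l)) i
  choose t ht using h
  refine ⟨⟨t, L.loc fun p hp => ?_⟩, fun i => Subtype.ext (funext fun j => ht j i),
    fun t' ht' => Subtype.ext (vec_ext fun p hp => ?_)⟩
  · obtain ⟨i, hi⟩ := Opens.mem_iSup.1 hp
    refine ⟨U i, le_iSup U i, hi, ?_⟩
    have : vres (le_iSup U i) t = (sf i).1 := funext fun j => ht j i
    rw [this]
    exact (sf i).2
  · obtain ⟨i, hi⟩ := Opens.mem_iSup.1 hp
    refine ⟨U i, le_iSup U i, hi, ?_⟩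
    exact (congr_arg Subtype.val (ht' i)).trans (funext fun j => ht j i).symm

variable [FiniteDimensional F K]

/-- The associated sheaf of modules. -/
def sheaf : S.X.Modules where
  val := .ofPresheaf L.presheafAb fun U V f r m => Subtype.ext (vres_smul _ _ _)
  isSheaf := L.presheafAb_isSheaf

/-- The vector underlying a section. -/
def vec {U : S.X.Opens} : Γ(L.sheaf, U) →+ (ι → S.GK K U) :=
  (L.carrier U).subtype.toAddMonoidHom

/-- The section given by a vector. -/
def sec {U : S.X.Opens} (v : ι → S.GK K U) (hv : v ∈ L.carrier U) : Γ(L.sheaf, U) :=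
  (⟨v, hv⟩ : L.carrier U)

@[simp] lemma vec_sec {U : S.X.Opens} (v : ι → S.GK K U) (hv : v ∈ L.carrier U) :
    L.vec (L.sec v hv) = v := rfl

lemma vec_mem {U : S.X.Opens} (x : Γ(L.sheaf, U)) : L.vec x ∈ L.carrier U := Subtype.prop _

lemma vec_injective {U : S.X.Opens} : Function.Injective (L.vec (U := U)) :=
  Subtype.val_injective

@[simp] lemma vec_smul {U : S.X.Opens} (r : Γ(S.X, U)) (x : Γ(L.sheaf, U)) :
    L.vec (r • x) = r • L.vec x := rfl

@[simp] lemma vec_mres {U V : S.X.Opens} (h : V ≤ U) (x : Γ(L.sheaf, U)) :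
    L.vec (mres L.sheaf h x) = vres h (L.vec x) := rfl

/-- A morphism into a subsheaf. -/
def lift {M : S.X.Modules} (f : ∀ U, Γ(M, U) →ₗ[Γ(S.X, U)] (ι → S.GK K U))
    (hf : ∀ U x, f U x ∈ L.carrier U)
    (hres : ∀ {U V : S.X.Opens} (h : V ≤ U) x, f V (mres M h x) = vres h (f U x)) :
    M ⟶ L.sheaf :=
  mkHom (fun U => ((f U).codRestrict (L.carrier U) (hf U)).toAddMonoidHom)
    (fun U r x => Subtype.ext ((f U).map_smul r x))
    (fun h x => Subtype.ext (hres h x))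

end LocSub

section NatMap

variable {F A : Type u} [Field F] [Ring A] [Algebra F A] {n : ℕ} (S : SeveriBrauer F A n)
  (K : Type u) [Field K] [Algebra F K]

/-- A family of linear maps between vectors of functions, compatible with restriction. -/
structure NatMap (W : S.X.Opens) (ι κ : Type) where
  /-- the linear maps -/
  f (U : S.X.Opens) (h : U ≤ W) : (ι → S.GK K U) →ₗ[Γ(S.X, U)] (κ → S.GK K U)
  nat {U V : S.X.Opens} (h : V ≤ U) (hU : U ≤ W) (v : ι → S.GK K U) :
    vres h (f U hU v) = f V (h.trans hU) (vres h v)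

end NatMap

namespace LocSub

variable {F A : Type u} [Field F] [Ring A] [Algebra F A] {n : ℕ} {S : SeveriBrauer F A n}
  {K : Type u} [Field K] [Algebra F K] {ι κ τ : Type} (L : S.LocSub K ι) (L' : S.LocSub K κ)
  (L'' : S.LocSub K τ) [FiniteDimensional F K]

/-- The inclusion into the free sheaf on sections, as a linear map. -/
def vecₗ (U : S.X.Opens) : Γ(L.sheaf, U) →ₗ[Γ(S.X, U)] (ι → S.GK K U) where
  toFun := L.vec
  map_add' := map_add _
  map_smul' := L.vec_smul

/-- The morphism of subsheaves given by a family of linear maps. -/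
def map (f : S.NatMap K ⊤ ι κ) (hf : ∀ U, ∀ v ∈ L.carrier U, f.f U le_top v ∈ L'.carrier U) :
    L.sheaf ⟶ L'.sheaf :=
  L'.lift (fun U => f.f U le_top ∘ₗ L.vecₗ U) (fun U x => hf U _ (L.vec_mem x))
    fun h x => (f.nat h le_top _).symm

/-- A local linear retraction of the ambient free sheaf onto a subsheaf. -/
structure Retraction (W : S.X.Opens) extends S.NatMap K W ι ι where
  mem (U : S.X.Opens) (h : U ≤ W) (v : ι → S.GK K U) : f U h v ∈ L.carrier U
  eq_self (U : S.X.Opens) (h : U ≤ W) : ∀ v ∈ L.carrier U, f U h v = v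

/-- Extension and annihilation up to a power of `f` hold for functions; for vectors they hold
coordinatewise, with one exponent serving the finitely many coordinates. -/
lemma exists_pow_smul_GK [Finite ι] {W : S.X.Opens} (hW : IsAffineOpen W) (f : Γ(S.X, W))
    (v : ι → S.GK K (S.X.basicOpen f)) : ∃ (k : ℕ) (t : ι → S.GK K W),
      fres (S.X.basicOpen_le f) (f ^ k) • v = vres (S.X.basicOpen_le f) t := by
  let b := Module.Free.chooseBasis F K
  let r (i) (j) := (b.baseChange Γ(S.X, S.X.basicOpen f)).repr (v i) j
  obtain ⟨k, hk⟩ := exists_nat_forall (J := ι × _)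
    (P := fun j k => ∃ t, fres (S.X.basicOpen_le f) (f ^ k) * r j.1 j.2 =
      fres (S.X.basicOpen_le f) t)
    (fun j k l hkl ⟨t, ht⟩ => ⟨f ^ (l - k) * t, by
      rw [map_mul, ← ht, ← mul_assoc, ← map_mul, ← pow_add, Nat.sub_add_cancel hkl]⟩)
    fun j => exists_pow_smul_function hW f (r j.1 j.2)
  choose t ht using hk
  refine ⟨k, fun i => (b.baseChange _).repr.symm (Finsupp.equivFunOnFinite.symm fun j => t (i, j)),
    funext fun i => (b.baseChange _).repr.injective (Finsupp.ext fun j => ?_)⟩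
  rw [vres_apply, resK, repr_bcHom, LinearEquiv.apply_symm_apply, Pi.smul_apply, map_smul]
  exact ht (i, j)

lemma exists_pow_smul_GK_eq_zero [Finite ι] {W : S.X.Opens} (hW : IsAffineOpen W) (f : Γ(S.X, W))
    (t : ι → S.GK K W) (ht : vres (S.X.basicOpen_le f) t = 0) : ∃ k : ℕ, f ^ k • t = 0 := by
  let b := Module.Free.chooseBasis F K
  let r (i) (j) := (b.baseChange Γ(S.X, W)).repr (t i) j
  obtain ⟨k, hk⟩ := exists_nat_forall (J := ι × _) (P := fun j k => f ^ k * r j.1 j.2 = 0)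
    (fun j k l hkl ht => by
      rw [← Nat.sub_add_cancel hkl, pow_add, mul_assoc, ht, mul_zero])
    fun j => exists_pow_mul_function_eq_zero hW f (r j.1 j.2) (by
      have := repr_bcHom b (S.res (S.X.basicOpen_le f)) (t j.1) j.2
      refine this.symm.trans ?_
      have h1 : bcHom (S.res (S.X.basicOpen_le f)) K (t j.1) = 0 := congr_fun ht j.1
      rw [h1, map_zero, Finsupp.zero_apply])
  refine ⟨k, funext fun i => (b.baseChange _).repr.injective (Finsupp.ext fun j => ?_)⟩
  rw [Pi.smul_apply, map_smul, Pi.zero_apply, map_zero]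
  exact hk (i, j)

/-- A subsheaf which is locally a retract of the ambient free sheaf is quasi-coherent. -/
theorem isQcoh_sheaf [Finite ι]
    (h : ∀ W : S.X.Opens, IsAffineOpen W → Nonempty (L.Retraction W)) : isQcoh S.X L.sheaf := by
  rw [isQcoh_iff]
  refine fun W hW f => ⟨fun x => ?_, fun t ht => ?_⟩
  · obtain ⟨k, t, ht⟩ := exists_pow_smul_GK hW f (L.vec x)
    obtain ⟨q⟩ := h W hW
    -- The extension `t` need not lie in the subsheaf. Applying the retraction corrects it without
    -- changing its restriction, which already lies there.
    refine ⟨k, L.sec (q.f W le_rfl t) (q.mem _ _ _), L.vec_injective ?_⟩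
    rw [vec_smul, vec_mres, vec_sec, q.nat _ le_rfl, ← ht, map_smul,
      q.eq_self _ _ _ (L.vec_mem x)]
  · obtain ⟨k, hk⟩ := exists_pow_smul_GK_eq_zero hW f (L.vec t)
      (by rw [← vec_mres, ht, map_zero])
    exact ⟨k, L.vec_injective (by rw [vec_smul, hk, map_zero])⟩

end LocSub
end SeveriBrauer
end SB

end

noncomputable section
set_option linter.unusedVariables false
namespace SB

/-! ### Direct summands of finite sums, and tensor products of matrices -/

section AddOf

variable {C D : Type*} [Category* C] [Preadditive C] [Category* D] [Preadditive D]

/-- `Q` is a direct summand of a finite direct sum of copies of `P`. -/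
def AddOf (Q P : C) : Prop :=
  ∃ (I : Type) (_ : Fintype I) (α : I → (Q ⟶ P)) (β : I → (P ⟶ Q)), ∑ i, α i ≫ β i = 𝟙 Q

lemma AddOf.trans {Q P R : C} (h : AddOf Q P) (h' : AddOf P R) : AddOf Q R := by
  obtain ⟨I, _, α, β, h⟩ := h
  obtain ⟨J, _, γ, δ, h'⟩ := h'
  refine ⟨I × J, inferInstance, fun i => α i.1 ≫ γ i.2, fun i => δ i.2 ≫ β i.1, ?_⟩
  rw [Fintype.sum_prod_type, ← h]
  refine Finset.sum_congr rfl fun i _ => ?_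
  simp only [Category.assoc]
  rw [← Preadditive.comp_sum]
  simp only [← Category.assoc (γ _)]
  rw [← Preadditive.sum_comp, h', Category.id_comp]

lemma AddOf.of_retract {Q P : C} (s : Q ⟶ P) (r : P ⟶ Q) (h : s ≫ r = 𝟙 Q) : AddOf Q P :=
  ⟨Unit, inferInstance, fun _ => s, fun _ => r, by simpa using h⟩

lemma AddOf.of_iso {Q P : C} (e : Q ≅ P) : AddOf Q P := .of_retract e.hom e.inv e.hom_inv_id

lemma AddOf.map {Q P : C} (h : AddOf Q P) (G : C ⥤ D) [G.Additive] :
    AddOf (G.obj Q) (G.obj P) := by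
  obtain ⟨I, _, α, β, h⟩ := h
  refine ⟨I, inferInstance, fun i => G.map (α i), fun i => G.map (β i), ?_⟩
  simp only [← G.map_comp]
  rw [← G.map_sum, h, G.map_id]

/-- `Q` is a retract of a finite power `B` of `P`, hence the kernel of the endomorphism `𝟙 B - r ≫
s`, and quasi-coherence passes to kernels. -/
lemma AddOf.isQcoh {X : Scheme.{u}} {Q P : X.Modules} (h : AddOf Q P) (hP : isQcoh X P) :
    isQcoh X Q := by
  obtain ⟨I, _, α, β, h⟩ := h
  have : HasFiniteBiproducts X.Modules := Abelian.hasFiniteBiproducts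
  let B := ⨁ fun _ : I => P
  have hB : SB.isQcoh X B := (SB.isQcoh X).prop_of_isLimit
    (biproduct.isLimit fun _ : I => P) fun _ => hP
  let s : Q ⟶ B := biproduct.lift α
  let r : B ⟶ Q := biproduct.desc β
  have hsr : s ≫ r = 𝟙 Q := by rw [biproduct.lift_desc, h]
  have w : s ≫ (𝟙 B - r ≫ s) = 0 := by
    rw [Preadditive.comp_sub, Category.comp_id, reassoc_of% hsr, sub_self]
  have hk : IsLimit (KernelFork.ofι s w) := KernelFork.IsLimit.ofι _ _
    (fun g _ => g ≫ r)
    (fun g hg => by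
      rw [Preadditive.comp_sub, Category.comp_id, sub_eq_zero] at hg
      rw [Category.assoc, ← hg])
    (fun g hg m hm => by rw [← hm, Category.assoc, hsr, Category.comp_id])
  exact ObjectProperty.IsClosedUnderKernels.kernels_le _ ⟨_, _, hk, hB, hB⟩

end AddOf

section PiMat

variable {R : Type*} [CommRing R] {ι κ τ T : Type*} [Fintype T]

/-- The tensor product of a family of matrices. -/
def piMat (M : T → Matrix κ ι R) : Matrix (T → κ) (T → ι) R := .of fun a b => ∏ t, M t (a t) (b t)

lemma piMat_apply (M : T → Matrix κ ι R) (a b) : piMat M a b = ∏ t, M t (a t) (b t) := rfl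

lemma piMat_mul [Fintype ι] [DecidableEq T] (M : T → Matrix κ ι R) (N : T → Matrix ι τ R) :
    piMat M * piMat N = piMat fun t => M t * N t := by
  ext a b
  simp only [Matrix.mul_apply, piMat_apply, Fintype.prod_sum, Finset.prod_mul_distrib]

lemma piMat_sum [DecidableEq T] {J : Type*} [Fintype J] (M : T → J → Matrix κ ι R) :
    ∑ j : T → J, piMat (fun t => M t (j t)) = piMat fun t => ∑ j, M t j := by
  ext a b
  simp only [Matrix.sum_apply, piMat_apply, Fintype.prod_sum]

lemma piMat_one [DecidableEq ι] [DecidableEq T] : piMat (fun _ : T => (1 : Matrix ι ι R)) = 1 := by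
  ext a b
  rw [piMat_apply, Matrix.one_apply]
  split_ifs with h
  · exact Finset.prod_eq_one fun t _ => by rw [h, Matrix.one_apply_eq]
  · obtain ⟨t, ht⟩ := Function.ne_iff.1 h
    exact Finset.prod_eq_zero (Finset.mem_univ t) (Matrix.one_apply_ne ht)

lemma piMat_map {R' : Type*} [CommRing R'] (φ : R →+* R') (M : T → Matrix κ ι R) :
    (piMat M).map φ = piMat fun t => (M t).map φ := by
  ext a b
  simp [piMat_apply]

end PiMat

/-! ### Sheaves cut out by idempotent matrices -/

namespace SeveriBrauer

section

variable {F A : Type u} [Field F] [Ring A] [Algebra F A] {n : ℕ} (S : SeveriBrauer F A n)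
  (K : Type u) [Field K] [Algebra F K] (ι : Type) [Fintype ι]

/-- A system of idempotent matrices of functions over the affine open subsets which absorb each
other, hence with the same image on overlaps. -/
structure ProjSys where
  /-- the matrix over an affine open subset -/
  p {W : S.X.Opens} (hW : IsAffineOpen W) : Matrix ι ι (S.GK K W)
  absorb {W W' V : S.X.Opens} (hW : IsAffineOpen W) (hW' : IsAffineOpen W') (h : V ≤ W)
    (h' : V ≤ W') :
    (p hW).map (S.resK K h) * (p hW').map (S.resK K h') = (p hW').map (S.resK K h')

end

variable {F A : Type u} [Field F] [Ring A] [Algebra F A] {n : ℕ} {S : SeveriBrauer F A n}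
  {K : Type u} [Field K] [Algebra F K] {ι κ : Type}

lemma vres_mulVec [Fintype ι] {U V : S.X.Opens} (h : V ≤ U) (M : Matrix κ ι (S.GK K U)) (v : ι → S.GK K U) :
    vres h (M.mulVec v) = (M.map (S.resK K h)).mulVec (vres h v) :=
  funext fun i => RingHom.map_mulVec (S.resK K h).toRingHom M v i

lemma map_resK_map_resK {U V W : S.X.Opens} (h : V ≤ U) (h' : W ≤ V) (M : Matrix κ ι (S.GK K U)) :
    (M.map (S.resK K h)).map (S.resK K h') = M.map (S.resK K (h'.trans h)) := by
  ext i j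
  exact resK_resK _ _ _

variable [Fintype ι]

namespace ProjSys

variable (P : S.ProjSys K ι)

/-- The image of a system of idempotent matrices. -/
def sub : S.LocSub K ι where
  carrier U :=
    { carrier := {v | ∀ (W : S.X.Opens) (hW : IsAffineOpen W) (h : W ≤ U),
        (P.p hW).mulVec (vres h v) = vres h v}
      add_mem' := fun hv hw W hW h => by rw [map_add, Matrix.mulVec_add, hv W hW h, hw W hW h]
      zero_mem' := fun W hW h => by rw [map_zero, Matrix.mulVec_zero]
      smul_mem' := fun r v hv W hW h => by rw [vres_smul, Matrix.mulVec_smul, hv W hW h] }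
  res_mem {U V} h v hv W hW hWV := by
    rw [vres_vres]
    exact hv W hW _
  loc {U v} H W hW hWU := by
    refine vec_ext fun x hx => ?_
    obtain ⟨V, hV, hxV, hv⟩ := H x (hWU hx)
    obtain ⟨W', hW'W, hxW', hW'⟩ := exists_affine_le (W ⊓ V) x ⟨hx, hxV⟩
    refine ⟨W', hW'W.trans inf_le_left, hxW', ?_⟩
    have h1 := hv W' hW' (hW'W.trans inf_le_right)
    rw [vres_vres] at h1
    have h2 := P.absorb hW hW' (hW'W.trans inf_le_left) le_rfl
    have h3 : (P.p hW').map (S.resK K le_rfl) = P.p hW' := by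
      ext i j; exact resK_refl _ _
    rw [h3] at h2
    rw [vres_mulVec, vres_vres, ← h1, Matrix.mulVec_mulVec, h2]

/-- The relation `p p' = p'` says that the image of `p'` lies in that of `p`; by symmetry the images
agree on overlaps. One affine open subset containing `U` therefore decides membership. -/
lemma mem_iff {U W : S.X.Opens} (hW : IsAffineOpen W) (h : U ≤ W) (v : ι → S.GK K U) :
    v ∈ P.sub.carrier U ↔ ((P.p hW).map (S.resK K h)).mulVec v = v := by
  constructor
  · intro hv
    refine vec_ext fun x hx => ?_
    obtain ⟨W', hW'U, hxW', hW'⟩ := exists_affine_le U x hx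
    refine ⟨W', hW'U, hxW', ?_⟩
    have h1 := hv W' hW' hW'U
    have h2 := P.absorb hW hW' (hW'U.trans h) le_rfl
    have h3 : (P.p hW').map (S.resK K le_rfl) = P.p hW' := by
      ext i j; exact resK_refl _ _
    rw [h3] at h2
    rw [vres_mulVec, map_resK_map_resK, ← h1, Matrix.mulVec_mulVec, h2]
  · intro hv W' hW' hW'U
    have h2 := P.absorb hW' hW le_rfl (hW'U.trans h)
    have h3 : (P.p hW').map (S.resK K le_rfl) = P.p hW' := by
      ext i j; exact resK_refl _ _
    rw [h3] at h2
    rw [← hv, vres_mulVec, map_resK_map_resK, Matrix.mulVec_mulVec, h2]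

/-- Membership in the image, for morphisms between images. -/
lemma mem_of_small {U : S.X.Opens} {v : ι → S.GK K U}
    (h : ∀ (W : S.X.Opens) (hW : IsAffineOpen W) (h : W ≤ U), vres h v ∈ P.sub.carrier W) :
    v ∈ P.sub.carrier U :=
  P.sub.loc fun x hx => by
    obtain ⟨W, hWU, hxW, hW⟩ := exists_affine_le U x hx
    exact ⟨W, hWU, hxW, h W hW hWU⟩

lemma map_mulVec_mem {U W : S.X.Opens} (hW : IsAffineOpen W) (h : U ≤ W) (v : ι → S.GK K U) :
    ((P.p hW).map (S.resK K h)).mulVec v ∈ P.sub.carrier U := by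
  rw [P.mem_iff hW h, Matrix.mulVec_mulVec, P.absorb]

/-- The idempotent matrix as a local retraction. -/
def retraction {W : S.X.Opens} (hW : IsAffineOpen W) : P.sub.Retraction W where
  f U h := ((P.p hW).map (S.resK K h)).mulVecLin.restrictScalars Γ(S.X, U)
  nat {U V} h hU v := by
    change vres h (((P.p hW).map (S.resK K hU)).mulVec v) = Matrix.mulVec _ (vres h v)
    rw [vres_mulVec, map_resK_map_resK]
  mem U h v := P.map_mulVec_mem hW h v
  eq_self U h v hv := (P.mem_iff hW h v).1 hv

lemma isQcoh_sheaf [FiniteDimensional F K] : isQcoh S.X P.sub.sheaf :=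
  P.sub.isQcoh_sheaf fun _ hW => ⟨P.retraction hW⟩

/-- Tensor powers of a system of idempotent matrices. -/
def pow (T : Type) [Fintype T] [DecidableEq T] : S.ProjSys K (T → ι) where
  p hW := piMat fun _ => P.p hW
  absorb hW hW' h h' := by
    have h1 {W V : S.X.Opens} (hW : IsAffineOpen W) (h : V ≤ W) :
        (piMat fun _ : T => P.p hW).map (S.resK K h) = piMat fun _ => (P.p hW).map (S.resK K h) :=
      piMat_map (S.resK K h).toRingHom _
    rw [h1, h1, piMat_mul, P.absorb]

end ProjSys

/-- A matrix of constants, acting on vectors of functions. -/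
def constMap (M : Matrix κ ι K) : S.NatMap K ⊤ ι κ where
  f U _ := (cst (F := F) Γ(S.X, U) M).mulVecLin.restrictScalars Γ(S.X, U)
  nat {U V} h hU v := by
    have h1 : (cst (F := F) Γ(S.X, U) M).map (S.resK K h) = cst Γ(S.X, V) M := by
      ext i j
      simp [cst, resK]
    change vres h (Matrix.mulVec _ v) = Matrix.mulVec _ (vres h v)
    rw [vres_mulVec, h1]

lemma constMap_apply (M : Matrix κ ι K) (U : S.X.Opens) (h : U ≤ ⊤) (v : ι → S.GK K U) :
    (constMap M).f U h v = (cst (F := F) Γ(S.X, U) M).mulVec v := rfl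

/-- Intertwining constants give morphisms between the images. -/
lemma constMap_mem [Fintype κ] (P : S.ProjSys K ι) (Q : S.ProjSys K κ) (M : Matrix κ ι K)
    (hM : ∀ (W : S.X.Opens) (hW : IsAffineOpen W),
      Q.p hW * cst (F := F) Γ(S.X, W) M = cst (F := F) Γ(S.X, W) M * P.p hW) (U : S.X.Opens) :
    ∀ v ∈ P.sub.carrier U, (constMap M).f U le_top v ∈ Q.sub.carrier U := by
  intro v hv W hW h
  rw [(constMap M).nat h, constMap_apply, Matrix.mulVec_mulVec, hM, ← Matrix.mulVec_mulVec,
    hv W hW h]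

end SeveriBrauer
end SB

end

/-! ### The sheaves `ℐ^m ⊗ K` and `L^m` -/

noncomputable section
set_option linter.unusedVariables false
namespace SB

namespace SeveriBrauer

variable {F A : Type u} [Field F] [Ring A] [Algebra F A] {n : ℕ} {S : SeveriBrauer F A n}
  {K : Type u} [Field K] [Algebra F K]

lemma cst_piMat {T : Type} [Fintype T] {R : Type u} [CommRing R] [Algebra F R] {ι κ : Type} (M : T → Matrix κ ι K) :
    cst (F := F) R (piMat M) = piMat fun t => cst (F := F) R (M t) :=
  piMat_map (Algebra.TensorProduct.includeRight (R := F) (A := R) (B := K)).toRingHom M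

lemma cst_one {R : Type u} [CommRing R] [Algebra F R] {ι : Type} [DecidableEq ι] :
    cst (F := F) R (1 : Matrix ι ι K) = 1 :=
  Matrix.map_one _ (map_zero _) (map_one _)

lemma cst_mul {R : Type u} [CommRing R] [Algebra F R] {ι κ τ : Type} [Fintype κ]
    (M : Matrix ι κ K) (N : Matrix κ τ K) :
    cst (F := F) R (M * N) = cst (F := F) R M * cst (F := F) R N :=
  Matrix.map_mul (f := (Algebra.TensorProduct.includeRight (R := F) (A := R) (B := K)).toRingHom)

lemma cst_sum {R : Type u} [CommRing R] [Algebra F R] {ι κ τ : Type} [Fintype τ]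
    (M : τ → Matrix ι κ K) : cst (F := F) R (∑ t, M t) = ∑ t, cst (F := F) R (M t) := by
  ext i j
  simp [cst, Matrix.sum_apply]

lemma algebraMap_map_resK {ι κ : Type} {U V : S.X.Opens} (h : V ≤ U) (M : Matrix κ ι Γ(S.X, U)) :
    (M.map (algebraMap Γ(S.X, U) (S.GK K U))).map (S.resK K h) =
      (M.map (S.res h)).map (algebraMap Γ(S.X, V) (S.GK K V)) := by
  ext i j
  simp [resK, Algebra.TensorProduct.algebraMap_apply]

namespace LeftId

variable (E : S.LeftId)

/-- The split representations of the left identities. -/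
def rhoSys (ρ : A →ₐ[F] Matrix (Fin n) (Fin n) K) : S.ProjSys K (Fin n) where
  p {W} hW := rhoR ρ Γ(S.X, W) (E.e hW)
  absorb hW hW' h h' := by
    have h1 := congr_arg (rhoR ρ _) (E.res_e_mul_res_e hW hW' h h')
    rw [map_mul, rhoR_bcHom, rhoR_bcHom] at h1
    exact h1

variable (K) in
/-- The left multiplications by the left identities. -/
def lmSys (b : Module.Basis (Fin (n ^ 2)) F A) : S.ProjSys K (Fin (n ^ 2)) where
  p {W} hW := (lmR b (E.e hW)).map (algebraMap Γ(S.X, W) (S.GK K W))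
  absorb {W W' V} hW hW' h h' := by
    have h1 := congr_arg (lmR b) (E.res_e_mul_res_e hW hW' h h')
    rw [lmR_mul, lmR_bcHom, lmR_bcHom] at h1
    rw [algebraMap_map_resK, algebraMap_map_resK, ← Matrix.map_mul, h1]

variable [NeZero n] [FiniteDimensional F K] (ρ : A →ₐ[F] Matrix (Fin n) (Fin n) K)
  (b : Module.Basis (Fin (n ^ 2)) F A) (hρ : LinearIndependent K fun i => ρ (b i))
  (T : Type) [Fintype T] [DecidableEq T]

/-- The morphisms from powers of the split representation to powers of the tautological sheaf. -/
def colHom (j : T → Fin n) : ((E.rhoSys ρ).pow T).sub.sheaf ⟶ ((E.lmSys K b).pow T).sub.sheaf :=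
  LocSub.map _ _ (constMap (piMat fun t => colC ρ b hρ (j t))) <| constMap_mem _ _ _ fun W hW => by
    rw [cst_piMat]
    change piMat _ * piMat _ = piMat _ * piMat _
    rw [piMat_mul, piMat_mul]
    congr 1
    ext1 t
    exact (intertwines_base ρ b hρ (E.e hW)).comp_C (j t)

include hρ in
/-- The morphisms from powers of the tautological sheaf to powers of the split representation. -/
def rowHom (j : T → Fin n) : ((E.lmSys K b).pow T).sub.sheaf ⟶ ((E.rhoSys ρ).pow T).sub.sheaf :=
  LocSub.map _ _ (constMap (piMat fun t => colD ρ b (j t))) <| constMap_mem _ _ _ fun W hW => by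
    rw [cst_piMat]
    change piMat _ * piMat _ = piMat _ * piMat _
    rw [piMat_mul, piMat_mul]
    congr 1
    ext1 t
    exact ((intertwines_base ρ b hρ (E.e hW)).D_comp (j t)).symm

-- The tensor power of `∑ C j * D j = 1` writes the identity of `ℐ^T ⊗ K` as a sum, over
-- multi-indices `T → Fin n`, of morphisms through `L^T`.
include hρ in
lemma addOf_lm_rho :
    AddOf ((E.lmSys K b).pow T).sub.sheaf ((E.rhoSys ρ).pow T).sub.sheaf := by
  refine ⟨T → Fin n, inferInstance, E.rowHom ρ b hρ T, E.colHom ρ b hρ T, mod_hom_ext fun U x => ?_⟩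
  refine LocSub.vec_injective _ ?_
  rw [sum_app_apply, map_sum]
  have h1 (j : T → Fin n) : LocSub.vec _ ((E.rowHom ρ b hρ T j ≫ E.colHom ρ b hρ T j).app U x) =
      (cst (F := F) Γ(S.X, U) ((piMat fun t => colC ρ b hρ (j t)) *
        piMat fun t => colD ρ b (j t))).mulVec (LocSub.vec _ x) := by
    rw [cst_mul, ← Matrix.mulVec_mulVec]
    rfl
  simp only [h1]
  rw [← Matrix.sum_mulVec, ← cst_sum]
  simp only [piMat_mul]
  rw [piMat_sum fun _ j => colC ρ b hρ j * colD ρ b j,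
    (intertwines_const ρ b hρ (1 : A)).sum_C_D, piMat_one, cst_one, Matrix.one_mulVec]
  rfl

-- A single multi-index suffices here: `D 0 * C 0 = 1` makes `L^T` a retract.
include hρ in
lemma addOf_rho_lm :
    AddOf ((E.rhoSys ρ).pow T).sub.sheaf ((E.lmSys K b).pow T).sub.sheaf := by
  refine .of_retract (E.colHom ρ b hρ T 0) (E.rowHom ρ b hρ T 0) (mod_hom_ext fun U x => ?_)
  refine LocSub.vec_injective _ ?_
  have h1 : LocSub.vec _ ((E.colHom ρ b hρ T 0 ≫ E.rowHom ρ b hρ T 0).app U x) =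
      (cst (F := F) Γ(S.X, U) ((piMat fun t : T => colD ρ b ((0 : T → Fin n) t)) *
        piMat fun t => colC ρ b hρ ((0 : T → Fin n) t))).mulVec (LocSub.vec _ x) := by
    rw [cst_mul, ← Matrix.mulVec_mulVec]
    rfl
  rw [h1, piMat_mul]
  simp only [(intertwines_const ρ b hρ (1 : A)).D_C, if_true]
  rw [piMat_one, cst_one, Matrix.one_mulVec]
  rfl

end LeftId

end SeveriBrauer
end SB

end

noncomputable section
set_option linter.unusedVariables false
namespace SB

/-! ### Tensor products of sheaves of modules -/

section Tensor

variable {X : Scheme.{u}}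

/-- The tensor product of presheaves of modules underlying the tensor product. -/
abbrev preTensor (M N : X.Modules) : PresheafOfModules X.ringCatSheaf.obj :=
  PresheafOfModules.Monoidal.tensorObj (R := X.presheaf) M.val N.val

/-- The morphism of presheaves of modules out of a tensor product given on sections. -/
def preTensorDesc {M N L : X.Modules}
    (f : ∀ U : X.Opens, Γ(M, U) ⊗[Γ(X, U)] Γ(N, U) →ₗ[Γ(X, U)] Γ(L, U))
    (nat : ∀ {U V : X.Opens} (h : V ≤ U) (m : Γ(M, U)) (n : Γ(N, U)),
      f V (mres M h m ⊗ₜ mres N h n) = mres L h (f U (m ⊗ₜ n))) :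
    preTensor M N ⟶ (SheafOfModules.forget _ ⋙
      PresheafOfModules.restrictScalars (𝟙 X.ringCatSheaf.obj)).obj L :=
  PresheafOfModules.homMk
    { app := fun U => AddCommGrpCat.ofHom (f U.unop).toAddMonoidHom
      naturality := fun U V i => by
        ext x
        let r : Γ(M, U.unop) ⊗[Γ(X, U.unop)] Γ(N, U.unop) →+
          Γ(M, V.unop) ⊗[Γ(X, V.unop)] Γ(N, V.unop) := ((preTensor M N).presheaf.map i).hom
        have hr (m n) : r (m ⊗ₜ n) = mres M (leOfHom i.unop) m ⊗ₜ mres N (leOfHom i.unop) n := rfl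
        change f V.unop (r x) = mres L (leOfHom i.unop) (f U.unop x)
        clear_value r
        change Γ(M, U.unop) ⊗[Γ(X, U.unop)] Γ(N, U.unop) at x
        induction x with
        | zero => simp only [map_zero]
        | tmul m n => rw [hr]; exact nat (leOfHom i.unop) m n
        | add x y hx hy => simp only [map_add, hx, hy] }
    fun U r x => (f U.unop).map_smul r x

/-- A map of presheaves that is bijective over affine open subsets is locally bijective, so
sheafification inverts it; the target is already a sheaf. -/
theorem nonempty_tensorObj_iso {M N L : X.Modules}
    (f : ∀ U : X.Opens, Γ(M, U) ⊗[Γ(X, U)] Γ(N, U) →ₗ[Γ(X, U)] Γ(L, U))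
    (nat : ∀ {U V : X.Opens} (h : V ≤ U) (m : Γ(M, U)) (n : Γ(N, U)),
      f V (mres M h m ⊗ₜ mres N h n) = mres L h (f U (m ⊗ₜ n)))
    (bij : ∀ U, IsAffineOpen U → Function.Bijective (f U)) :
    Nonempty (tensorObj M N ≅ L) := by
  let φ := preTensorDesc f nat
  have hφ : IsIso ((PresheafOfModules.sheafification (𝟙 X.ringCatSheaf.obj)).map φ) := by
    have h1 := PresheafOfModules.inverseImage_W_toPresheaf_eq_inverseImage_isomorphisms
      (𝟙 X.ringCatSheaf.obj)
    have h2 : (MorphismProperty.isomorphisms _).inverseImage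
      (PresheafOfModules.sheafification (𝟙 X.ringCatSheaf.obj)) φ := by
      rw [← h1]
      change GrothendieckTopology.W _ _
      rw [GrothendieckTopology.W_iff_isLocallyBijective]
      refine ⟨⟨fun {U} x y hxy => ?_⟩, ⟨fun {U} s => ?_⟩⟩
      · intro p hp
        obtain ⟨V, hVU, hpV, hV⟩ := exists_affine_le U.unop p hp
        refine ⟨V, homOfLE hVU, ?_, hpV⟩
        refine (bij V hV).1 ?_
        have n1 := congr($(((PresheafOfModules.toPresheaf _).map φ).naturality (homOfLE hVU).op) x)
        have n2 := congr($(((PresheafOfModules.toPresheaf _).map φ).naturality (homOfLE hVU).op) y)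
        exact n1.trans ((congr_arg (mres L hVU) hxy).trans n2.symm)
      · intro p hp
        obtain ⟨V, hVU, hpV, hV⟩ := exists_affine_le U p hp
        refine ⟨V, homOfLE hVU, ?_, hpV⟩
        exact (bij V hV).2 (mres L hVU s)
    exact h2
  exact ⟨(asIso ((PresheafOfModules.sheafification (𝟙 X.ringCatSheaf.obj)).map φ) ≪≫
    (asIso (PresheafOfModules.sheafificationAdjunction (𝟙 X.ringCatSheaf.obj)).counit).app L :)⟩

/-- The morphism induced on tensor products of presheaves of modules. -/
def preTensorMap {M M' : X.Modules} (f : M ⟶ M') (N : X.Modules) :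
    preTensor M N ⟶ preTensor M' N :=
  PresheafOfModules.Monoidal.tensorHom (R := X.presheaf) f.val (𝟙 N.val)

open MonoidalCategory in
lemma preTensorMap_id (M N : X.Modules) : preTensorMap (𝟙 M) N = 𝟙 _ := by
  have h := id_tensorHom_id (C := PresheafOfModules (X.presheaf ⋙ forget₂ CommRingCat RingCat))
    M.val N.val
  exact h

open MonoidalCategory in
lemma preTensorMap_comp {M M' M'' : X.Modules} (f : M ⟶ M') (g : M' ⟶ M'') (N : X.Modules) :
    preTensorMap (f ≫ g) N = preTensorMap f N ≫ preTensorMap g N :=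
  comp_whiskerRight (C := PresheafOfModules (X.presheaf ⋙ forget₂ CommRingCat RingCat))
    f.val g.val N.val

open MonoidalCategory in
lemma preTensorMap_add {M M' : X.Modules} (f g : M ⟶ M') (N : X.Modules) :
    preTensorMap (f + g) N = preTensorMap f N + preTensorMap g N := by
  refine PresheafOfModules.hom_ext fun U => ?_
  exact MonoidalPreadditive.add_whiskerRight (C := ModuleCat (X.presheaf.obj U))
    (f := f.val.app U) (g := g.val.app U) (X := N.val.obj U)

instance : (PresheafOfModules.sheafification (𝟙 X.ringCatSheaf.obj)).Additive := 
  (PresheafOfModules.sheafificationAdjunction (𝟙 X.ringCatSheaf.obj)).left_adjoint_additive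

/-- Tensoring on the right, as a functor. -/
def tensorRight (N : X.Modules) : X.Modules ⥤ X.Modules where
  obj M := tensorObj M N
  map f := (PresheafOfModules.sheafification (𝟙 X.ringCatSheaf.obj)).map (preTensorMap f N)
  map_id M := by
    rw [preTensorMap_id]
    exact CategoryTheory.Functor.map_id _ _
  map_comp f g := by
    rw [preTensorMap_comp]
    exact CategoryTheory.Functor.map_comp _ _ _

instance (N : X.Modules) : (tensorRight N).Additive where
  map_add {M M' f g} := by
    change (PresheafOfModules.sheafification (𝟙 X.ringCatSheaf.obj)).map (preTensorMap _ N) = _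
    rw [preTensorMap_add]
    exact CategoryTheory.Functor.map_add _

end Tensor
end SB

end

/-! ### Tensoring with the tautological sheaf -/

noncomputable section
set_option linter.unusedVariables false
namespace SB

lemma kronecker_mulVec {R : Type*} [CommRing R] {ι κ ι' κ' : Type*} [Fintype ι] [Fintype κ]
    (M : Matrix ι' ι R) (N : Matrix κ' κ R) (v : ι → R) (w : κ → R) :
    (Matrix.kroneckerMap (· * ·) M N).mulVec (fun x => v x.1 * w x.2) =
      fun x => M.mulVec v x.1 * N.mulVec w x.2 := by
  ext x
  simp only [Matrix.mulVec, dotProduct, Matrix.kroneckerMap_apply, Fintype.sum_prod_type,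
    Finset.sum_mul_sum]
  exact Finset.sum_congr rfl fun _ _ => Finset.sum_congr rfl fun _ _ => by ring

namespace SeveriBrauer

variable {F A : Type u} [Field F] [Ring A] [Algebra F A] {n : ℕ} {S : SeveriBrauer F A n}
  {K : Type u} [Field K] [Algebra F K] {ι κ : Type}

lemma map_resK_refl {U : S.X.Opens} (h : U ≤ U) (M : Matrix κ ι (S.GK K U)) :
    M.map (S.resK K h) = M := by
  ext i j; exact resK_refl _ _

section
variable [Fintype ι] (P : S.ProjSys K ι)

lemma ProjSys.mem_iff_self {W : S.X.Opens} (hW : IsAffineOpen W) (v : ι → S.GK K W) :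
    v ∈ P.sub.carrier W ↔ (P.p hW).mulVec v = v := by
  rw [P.mem_iff hW le_rfl, map_resK_refl]

lemma ProjSys.mulVec_mem {W : S.X.Opens} (hW : IsAffineOpen W) (v : ι → S.GK K W) :
    (P.p hW).mulVec v ∈ P.sub.carrier W := by
  have := P.map_mulVec_mem hW le_rfl v
  rwa [map_resK_refl] at this

/-- The external product of two systems of idempotent matrices. -/
def ProjSys.prod [Fintype κ] (P : S.ProjSys K ι) (Q : S.ProjSys K κ) : S.ProjSys K (ι × κ) where
  p hW := Matrix.kroneckerMap (· * ·) (P.p hW) (Q.p hW)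
  absorb {W W' V} hW hW' h h' := by
    have h1 {W V : S.X.Opens} (hW : IsAffineOpen W) (h : V ≤ W) :
        (Matrix.kroneckerMap (· * ·) (P.p hW) (Q.p hW)).map (S.resK K h) =
        Matrix.kroneckerMap (· * ·) ((P.p hW).map (S.resK K h)) ((Q.p hW).map (S.resK K h)) := by
      ext i j
      exact map_mul (S.resK K h) _ _
    rw [h1, h1, ← Matrix.mul_kronecker_mul, P.absorb, Q.absorb]

end

section Taut

variable [FiniteDimensional F A] (b : Module.Basis (Fin (n ^ 2)) F A)

/-- The element of `𝒪 ⊗ A` underlying a section of the tautological sheaf. -/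
def tautVal {U : S.X.Opens} : Γ(S.taut, U) →ₗ[Γ(S.X, U)] Γ(S.X, U) ⊗[F] A :=
  (S.tautSections U).subtype

lemma tautVal_mem {U : S.X.Opens} (s : Γ(S.taut, U)) : tautVal s ∈ S.tautSections U :=
  Subtype.prop _

lemma tautVal_injective {U : S.X.Opens} : Function.Injective (tautVal (S := S) (U := U)) :=
  Subtype.val_injective

lemma tautVal_mres {U V : S.X.Opens} (h : V ≤ U) (s : Γ(S.taut, U)) :
    tautVal (mres S.taut h s) = bcHom (S.res h) A (tautVal s) := rfl

/-- The section of the tautological sheaf given by an element of `𝒪 ⊗ A`. -/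
def tautSec {U : S.X.Opens} (s : Γ(S.X, U) ⊗[F] A) (hs : s ∈ S.tautSections U) : Γ(S.taut, U) :=
  (⟨s, hs⟩ : S.tautSections U)

@[simp] lemma tautVal_tautSec {U : S.X.Opens} (s : Γ(S.X, U) ⊗[F] A) (hs) :
    tautVal (tautSec (S := S) s hs) = s := rfl

variable (K) in
/-- The coordinates of a section of the tautological sheaf. -/
def tautCoord {U : S.X.Opens} : Γ(S.taut, U) →ₗ[Γ(S.X, U)] (Fin (n ^ 2) → Γ(S.X, U)) :=
  (b.baseChange Γ(S.X, U)).equivFun.toLinearMap ∘ₗ tautVal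

lemma tautCoord_mres {U V : S.X.Opens} (h : V ≤ U) (s : Γ(S.taut, U)) (j : Fin (n ^ 2)) :
    tautCoord b (mres S.taut h s) j = fres h (tautCoord b s j) :=
  repr_bcHom b (S.res h) (tautVal s) j

lemma tautCoord_eq {U : S.X.Opens} (s : Γ(S.taut, U)) :
    tautCoord b s = (b.baseChange Γ(S.X, U)).repr (tautVal s) := rfl

lemma LeftId.lmR_mulVec_tautCoord (E : S.LeftId) {U : S.X.Opens} (hU : IsAffineOpen U)
    (s : Γ(S.taut, U)) : (lmR b (E.e hU)).mulVec (tautCoord b s) = tautCoord b s := by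
  rw [tautCoord_eq, lmR_mulVec_repr]
  have := (E.mem_tautSections hU le_rfl _).1 (tautVal_mem s)
  rw [S.res_refl] at this
  congr 2
  simpa [bcHom] using this

variable [Fintype ι] (P : S.ProjSys K ι) (E : S.LeftId) [FiniteDimensional F K]

/-- The product of two sections is fixed by the Kronecker product because each factor is fixed by
its own idempotent. -/
lemma mul_tautCoord_mem {U : S.X.Opens} (v : Γ(P.sub.sheaf, U)) (s : Γ(S.taut, U)) :
    (fun x : ι × Fin (n ^ 2) => tautCoord b s x.2 • P.sub.vec v x.1) ∈
      (P.prod (E.lmSys K b)).sub.carrier U := by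
  refine ProjSys.mem_of_small _ fun W hW h => ?_
  rw [ProjSys.mem_iff_self _ hW]
  have h1 : vres h (fun x : ι × Fin (n ^ 2) => tautCoord b s x.2 • P.sub.vec v x.1) =
      fun x => P.sub.vec (mres _ h v) x.1 *
        algebraMap _ (S.GK K W) (tautCoord b (mres S.taut h s) x.2) := by
    ext x
    rw [vres_apply, resK_smul, tautCoord_mres, LocSub.vec_mres, Algebra.smul_def, mul_comm]
    rfl
  rw [h1]
  refine (kronecker_mulVec _ _ _ (fun j => algebraMap _ (S.GK K W)
    (tautCoord b (mres S.taut h s) j))).trans ?_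
  have h2 := (P.mem_iff_self hW _).1 (P.sub.vec_mem (mres _ h v))
  have h3 := E.lmR_mulVec_tautCoord b hW (mres S.taut h s)
  have h4 : ((E.lmSys K b).p hW).mulVec (fun j => algebraMap _ (S.GK K W)
      (tautCoord b (mres S.taut h s) j)) = fun j => algebraMap _ (S.GK K W)
      (tautCoord b (mres S.taut h s) j) := by
    ext j
    conv_rhs => rw [← h3]
    exact (RingHom.map_mulVec (algebraMap _ (S.GK K W)) _ _ j).symm
  rw [h2, h4]

/-- Multiplication of sections, from a tensor product with the tautological sheaf. -/
def tensorMul (U : S.X.Opens) : Γ(P.sub.sheaf, U) ⊗[Γ(S.X, U)] Γ(S.taut, U) →ₗ[Γ(S.X, U)]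
    Γ((P.prod (E.lmSys K b)).sub.sheaf, U) :=
  TensorProduct.lift (LinearMap.mk₂ _
    (fun v s => LocSub.sec _ _ (mul_tautCoord_mem b P E v s))
    (fun v v' s => LocSub.vec_injective _ (by
      ext x
      simp only [LocSub.vec_sec, Pi.add_apply, map_add, smul_add]))
    (fun r v s => LocSub.vec_injective _ (by
      ext x
      simp only [LocSub.vec_sec, LocSub.vec_smul, Pi.smul_apply, smul_comm r]))
    (fun v s s' => LocSub.vec_injective _ (by
      ext x
      simp only [LocSub.vec_sec, Pi.add_apply, map_add, add_smul]))
    (fun r v s => LocSub.vec_injective _ (by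
      ext x
      simp only [LocSub.vec_sec, map_smul, Pi.smul_apply, smul_assoc]
      rfl)))

lemma vec_tensorMul_tmul {U : S.X.Opens} (v : Γ(P.sub.sheaf, U)) (s : Γ(S.taut, U)) :
    LocSub.vec _ (tensorMul b P E U (v ⊗ₜ s)) =
      fun x => tautCoord b s x.2 • P.sub.vec v x.1 := rfl

/-- The inverse of the multiplication of sections over an affine open subset. -/
def tensorMulInv {U : S.X.Opens} (hU : IsAffineOpen U) :
    Γ((P.prod (E.lmSys K b)).sub.sheaf, U) →+ Γ(P.sub.sheaf, U) ⊗[Γ(S.X, U)] Γ(S.taut, U) where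
  -- A section `w = ∑ w_j ⊗ b_j` of the image satisfies `w = ∑ (p w_j) ⊗ (e b_j)`, which displays it
  -- as a sum of products of sections of the two factors.
  toFun w := ∑ j, P.sub.sec ((P.p hU).mulVec fun i => LocSub.vec _ w (i, j)) (P.mulVec_mem hU _) ⊗ₜ
    tautSec (E.e hU * (1 ⊗ₜ b j)) (tautSections_mul_mem (E.e_mem hU) _)
  map_zero' := Finset.sum_eq_zero fun j _ => by
    have : P.sub.sec ((P.p hU).mulVec fun i => LocSub.vec (P.prod (E.lmSys K b)).sub
        (0 : Γ((P.prod (E.lmSys K b)).sub.sheaf, U)) (i, j)) (P.mulVec_mem hU _) = 0 := by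
      refine P.sub.vec_injective ?_
      rw [LocSub.vec_sec, map_zero, map_zero]
      exact Matrix.mulVec_zero _
    rw [this, zero_tmul]
  map_add' w w' := by
    rw [← Finset.sum_add_distrib]
    refine Finset.sum_congr rfl fun j _ => ?_
    rw [← add_tmul]
    congr 1
    refine P.sub.vec_injective ?_
    rw [LocSub.vec_sec, map_add, map_add, LocSub.vec_sec, LocSub.vec_sec, ← Matrix.mulVec_add]
    rfl

lemma tensorMulInv_apply {U : S.X.Opens} (hU : IsAffineOpen U)
    (w : Γ((P.prod (E.lmSys K b)).sub.sheaf, U)) : tensorMulInv b P E hU w =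
      ∑ j, P.sub.sec ((P.p hU).mulVec fun i => LocSub.vec _ w (i, j)) (P.mulVec_mem hU _) ⊗ₜ
        tautSec (E.e hU * (1 ⊗ₜ b j)) (tautSections_mul_mem (E.e_mem hU) _) := rfl

lemma tensorMul_tensorMulInv {U : S.X.Opens} (hU : IsAffineOpen U)
    (w : Γ((P.prod (E.lmSys K b)).sub.sheaf, U)) :
    tensorMul b P E U (tensorMulInv b P E hU w) = w := by
  refine LocSub.vec_injective _ ?_
  have h := (ProjSys.mem_iff_self _ hU _).1 (LocSub.vec_mem _ w)
  rw [← h]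
  rw [tensorMulInv_apply]
  rw [map_sum, map_sum]
  ext x
  simp only [vec_tensorMul_tmul, LocSub.vec_sec, Finset.sum_apply]
  have h2 (j) : tautCoord b (tautSec (S := S) (E.e hU * (1 ⊗ₜ b j))
      (tautSections_mul_mem (E.e_mem hU) _)) x.2 = lmR b (E.e hU) x.2 j := by
    rw [tautCoord_eq, tautVal_tautSec, lmR, Algebra.leftMulMatrix_eq_repr_mul,
      Module.Basis.baseChange_apply]
  simp only [h2]
  simp only [Matrix.mulVec, dotProduct, Fintype.sum_prod_type_right, Finset.smul_sum]
  refine Finset.sum_congr rfl fun j _ => Finset.sum_congr rfl fun i _ => ?_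
  rw [Algebra.smul_def, ← mul_assoc]
  congr 1
  exact mul_comm _ _

lemma tensorMulInv_tensorMul {U : S.X.Opens} (hU : IsAffineOpen U)
    (x : Γ(P.sub.sheaf, U) ⊗[Γ(S.X, U)] Γ(S.taut, U)) :
    tensorMulInv b P E hU (tensorMul b P E U x) = x := by
  induction x with
  | zero => rw [map_zero, map_zero]
  | add x y hx hy => rw [map_add, map_add, hx, hy]
  | tmul v s =>
    have h1 (j) : P.sub.sec ((P.p hU).mulVec fun i => LocSub.vec _ (tensorMul b P E U (v ⊗ₜ s)) (i, j))
        (P.mulVec_mem hU _) = tautCoord b s j • v := by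
      refine P.sub.vec_injective ?_
      rw [LocSub.vec_sec, LocSub.vec_smul, vec_tensorMul_tmul]
      refine (Matrix.mulVec_smul _ (tautCoord b s j) (P.sub.vec v)).trans ?_
      rw [(P.mem_iff_self hU _).1 (P.sub.vec_mem v)]
    rw [tensorMulInv_apply]
    simp only [h1, smul_tmul]
    rw [← tmul_sum]
    congr 1
    refine tautVal_injective ?_
    rw [map_sum]
    simp only [map_smul, tautVal_tautSec]
    simp only [← mul_smul_comm]
    rw [← Finset.mul_sum]
    have h3 : ∑ j, tautCoord b s j • ((1 : Γ(S.X, U)) ⊗ₜ[F] b j) = tautVal s := by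
      have := (b.baseChange Γ(S.X, U)).sum_repr (tautVal s)
      simp only [Module.Basis.baseChange_apply] at this
      exact this
    rw [h3]
    have := (E.mem_tautSections hU le_rfl _).1 (tautVal_mem s)
    rw [S.res_refl] at this
    simpa [bcHom] using this

/-- The sheaf of `P` is a module over `𝒪 ⊗ K`, so tensoring it with `ℐ` over `𝒪` amounts to
tensoring it with `ℐ ⊗ K` over `𝒪 ⊗ K`. -/
theorem nonempty_tensor_iso :
    Nonempty (tensorObj P.sub.sheaf S.taut ≅ (P.prod (E.lmSys K b)).sub.sheaf) := by
  refine nonempty_tensorObj_iso (tensorMul b P E) (fun {U V} h m s => ?_) fun U hU => ?_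
  · refine LocSub.vec_injective _ ?_
    rw [LocSub.vec_mres, vec_tensorMul_tmul, vec_tensorMul_tmul]
    ext x
    rw [vres_apply, resK_smul, tautCoord_mres]
    rfl
  · exact Function.bijective_iff_has_inverse.2 ⟨tensorMulInv b P E hU,
      tensorMulInv_tensorMul b P E hU, tensorMul_tensorMulInv b P E hU⟩

end Taut

end SeveriBrauer
end SB

end

/-! ### Tensor powers of `ℐ` and their scalar extensions -/

noncomputable section
set_option linter.unusedVariables false
namespace SB

namespace SeveriBrauer

variable {F A : Type u} [Field F] [Ring A] [Algebra F A] {n : ℕ} {S : SeveriBrauer F A n}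
  {K : Type u} [Field K] [Algebra F K] {ι κ : Type}

variable (S K) in
/-- Reindexing of vectors. -/
def reindexMap (W : S.X.Opens) (σ : κ → ι) : S.NatMap K W ι κ where
  f U _ := LinearMap.funLeft Γ(S.X, U) (S.GK K U) σ
  nat _ _ _ := rfl

/-- Reindexing of subsheaves. -/
def reindexIso [FiniteDimensional F K] (L : S.LocSub K ι) (L' : S.LocSub K κ) (σ : κ ≃ ι)
    (h : ∀ U v, v ∈ L.carrier U ↔ v ∘ σ ∈ L'.carrier U) : L.sheaf ≅ L'.sheaf where
  hom := L.map L' (S.reindexMap K ⊤ σ) fun U v hv => (h U v).1 hv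
  inv := L'.map L (S.reindexMap K ⊤ σ.symm) fun U v hv => (h U _).2 (by
    change (v ∘ σ.symm) ∘ σ ∈ _
    rwa [Function.comp_assoc, σ.symm_comp_self])
  hom_inv_id := mod_hom_ext fun U x => L.vec_injective (by
    change (L.vec x ∘ σ) ∘ σ.symm = L.vec x
    rw [Function.comp_assoc, σ.self_comp_symm, Function.comp_id])
  inv_hom_id := mod_hom_ext fun U x => L'.vec_injective (by
    change (L'.vec x ∘ σ.symm) ∘ σ = L'.vec x
    rw [Function.comp_assoc, σ.symm_comp_self, Function.comp_id])

/-- Reindexing of the images of systems of idempotent matrices. -/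
def ProjSys.reindexIso [Fintype ι] [Fintype κ] [FiniteDimensional F K]
    (P : S.ProjSys K ι) (Q : S.ProjSys K κ) (σ : κ ≃ ι)
    (h : ∀ (W : S.X.Opens) (hW : IsAffineOpen W) (a c : κ), Q.p hW a c = P.p hW (σ a) (σ c)) :
    P.sub.sheaf ≅ Q.sub.sheaf :=
  SeveriBrauer.reindexIso _ _ σ fun U v => by
    refine forall_congr' fun W => forall_congr' fun hW => forall_congr' fun hWU => ?_
    have h1 : (Q.p hW).mulVec (vres hWU (v ∘ σ)) = (P.p hW).mulVec (vres hWU v) ∘ σ := by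
      ext a
      simp only [Matrix.mulVec, dotProduct, Function.comp_apply, h]
      exact Equiv.sum_comp σ fun i => P.p hW (σ a) i * vres hWU v i
    rw [h1]
    exact (σ.surjective.injective_comp_right.eq_iff (b := vres hWU v)).symm

/-- A linear functional on the extension of the base field, with coefficients in functions. -/
def evalK (R : Type u) [CommRing R] [Algebra F R] (l : K →ₗ[F] F) : R ⊗[F] K →ₗ[R] R :=
  (TensorProduct.AlgebraTensorModule.rid F R R).toLinearMap ∘ₗ l.baseChange R

@[simp] lemma evalK_tmul (R : Type u) [CommRing R] [Algebra F R] (l : K →ₗ[F] F) (r : R) (k : K) :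
    evalK R l (r ⊗ₜ k) = l k • r := by
  simp [evalK]

lemma evalK_resK (l : K →ₗ[F] F) {U V : S.X.Opens} (h : V ≤ U) (x : Γ(S.X, U) ⊗[F] K) :
    evalK _ l (S.resK K h x) = fres h (evalK _ l x) := by
  induction x with
  | zero => simp
  | tmul r k =>
    rw [evalK_tmul]
    change evalK _ l (S.res h r ⊗ₜ k) = S.res h (l k • r)
    rw [evalK_tmul, map_smul]
  | add x y hx hy => simp only [map_add, hx, hy]

/-- The structure sheaf, as a sheaf of modules. -/
def unitMod (X : Scheme.{u}) : X.Modules := SheafOfModules.unit X.ringCatSheaf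

/-- Functions as sections of the structure sheaf. -/
def unitFun {X : Scheme.{u}} (U : X.Opens) : Γ(unitMod X, U) ≃ₗ[Γ(X, U)] Γ(X, U) where
  toFun x := x
  invFun x := x
  map_add' _ _ := rfl
  map_smul' _ _ := rfl

lemma unitFun_mres {X : Scheme.{u}} {U V : X.Opens} (h : V ≤ U) (x : Γ(unitMod X, U)) :
    unitFun V (mres _ h x) = fres h (unitFun U x) := rfl

section Unit

variable [Fintype ι] (P : S.ProjSys K ι) [FiniteDimensional F K]

lemma ProjSys.mem_pow_zero {U : S.X.Opens} (v : (Fin 0 → ι) → S.GK K U) :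
    v ∈ (P.pow (Fin 0)).sub.carrier U := by
  intro W hW h
  have h1 : (P.pow (Fin 0)).p hW = 1 := by
    ext a c
    rw [Subsingleton.elim a c, Matrix.one_apply_eq]
    change ∏ t : Fin 0, P.p hW (c t) (c t) = 1
    rw [Finset.univ_eq_empty, Finset.prod_empty]
  rw [h1, Matrix.one_mulVec]

/-- The constant sections of the zeroth power. -/
def unitTo (k : K) : unitMod S.X ⟶ (P.pow (Fin 0)).sub.sheaf :=
  LocSub.lift _
    (fun U => (LinearMap.pi fun _ => (LinearMap.lsmul Γ(S.X, U) (S.GK K U)).flip (1 ⊗ₜ k)) ∘ₗ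
      (unitFun U).toLinearMap)
    (fun U x => P.mem_pow_zero _)
    (fun {U V} h x => funext fun _ => by
      change unitFun V (mres _ h x) • ((1 : Γ(S.X, V)) ⊗ₜ[F] k) =
        S.resK K h (unitFun U x • ((1 : Γ(S.X, U)) ⊗ₜ[F] k))
      rw [resK_smul, resK, bcHom_tmul, map_one, unitFun_mres])

lemma vec_unitTo (k : K) (U : S.X.Opens) (x : Γ(unitMod S.X, U)) (a) :
    (P.pow (Fin 0)).sub.vec ((unitTo P k).app U x) a = unitFun U x • ((1 : Γ(S.X, U)) ⊗ₜ[F] k) := rfl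

/-- A functional on the zeroth power. -/
def toUnit (l : K →ₗ[F] F) : (P.pow (Fin 0)).sub.sheaf ⟶ unitMod S.X :=
  mkHom (fun U => (unitFun U).symm.toAddMonoidHom.comp ((evalK Γ(S.X, U) l).toAddMonoidHom.comp
      ((Pi.evalAddMonoidHom _ Fin.elim0).comp (P.pow (Fin 0)).sub.vec)))
    (fun U r x => (evalK Γ(S.X, U) l).map_smul r _)
    (fun h x => evalK_resK l h _)

lemma toUnit_app (l : K →ₗ[F] F) (U : S.X.Opens) (x : Γ((P.pow (Fin 0)).sub.sheaf, U)) :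
    unitFun U ((toUnit P l).app U x) =
      evalK Γ(S.X, U) l ((P.pow (Fin 0)).sub.vec x Fin.elim0) := rfl

/-- The zeroth power is `𝒪 ⊗ K`; an `F`-linear retraction `K → F` splits off `𝒪`. -/
lemma addOf_unit : AddOf (unitMod S.X)
    (P.pow (Fin 0)).sub.sheaf := by
  obtain ⟨l, hl⟩ : ∃ f : K →ₗ[F] F, f 1 = 1 := by
    obtain ⟨g, hg⟩ := (Algebra.linearMap F K).exists_leftInverse_of_injective
      (LinearMap.ker_eq_bot.2 (algebraMap F K).injective)
    exact ⟨g, by simpa using LinearMap.congr_fun hg 1⟩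
  refine .of_retract (unitTo P 1) (toUnit P l) (mod_hom_ext fun U x => ?_)
  refine (unitFun U).injective ?_
  rw [comp_app_apply, toUnit_app, vec_unitTo, map_smul, evalK_tmul, hl, one_smul, smul_eq_mul,
    mul_one]
  rfl

/-- A basis of `K` over `F` writes `𝒪 ⊗ K` as a finite sum of copies of `𝒪`. -/
lemma addOf_pow_zero : AddOf (P.pow (Fin 0)).sub.sheaf
    (unitMod S.X) := by
  let b := Module.finBasis F K
  refine ⟨Fin _, inferInstance, fun i => toUnit P (b.coord i), fun i => unitTo P (b i),
    mod_hom_ext fun U x => LocSub.vec_injective _ (funext fun a => ?_)⟩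
  rw [sum_app_apply, map_sum, Finset.sum_apply, Subsingleton.elim a Fin.elim0]
  simp only [comp_app_apply, vec_unitTo, toUnit_app]
  have h (y : Γ(S.X, U) ⊗[F] K) : ∑ i, evalK Γ(S.X, U) (b.coord i) y • ((1 : Γ(S.X, U)) ⊗ₜ[F] b i) = y := by
    induction y with
    | zero => simp
    | tmul r k =>
      simp only [evalK_tmul, TensorProduct.smul_tmul', smul_eq_mul, mul_one, smul_tmul]
      rw [← tmul_sum]
      congr 1
      exact b.sum_repr k
    | add y z hy hz => simp only [map_add, add_smul, Finset.sum_add_distrib, hy, hz]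
  exact h _

end Unit

section TensorPow

variable [FiniteDimensional F A] [FiniteDimensional F K] (E : S.LeftId)
  (b : Module.Basis (Fin (n ^ 2)) F A)

/-- Tensoring with `ℐ` is an additive functor, so it preserves both relations, and it takes `ℐ^m ⊗
K` to `ℐ^(m+1) ⊗ K` by `nonempty_tensor_iso`. The new factor comes last, as in the recursion of
`tensorPow`. -/
theorem addOf_tensorPow (m : ℕ) :
    AddOf (tensorPow S.taut m) ((E.lmSys K b).pow (Fin m)).sub.sheaf ∧
      AddOf ((E.lmSys K b).pow (Fin m)).sub.sheaf (tensorPow S.taut m) := by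
  induction m with
  | zero => exact ⟨addOf_unit _, addOf_pow_zero _⟩
  | succ m ih =>
    obtain ⟨e⟩ := nonempty_tensor_iso b ((E.lmSys K b).pow (Fin m)) E
    let e' : (((E.lmSys K b).pow (Fin m)).prod (E.lmSys K b)).sub.sheaf ≅
        ((E.lmSys K b).pow (Fin (m + 1))).sub.sheaf :=
      ProjSys.reindexIso _ _ ((Fin.snocEquiv fun _ => Fin (n ^ 2)).symm.trans (Equiv.prodComm _ _))
        fun W hW a c => Fin.prod_univ_castSucc _
    exact ⟨(ih.1.map (tensorRight S.taut)).trans (.of_iso (e ≪≫ e')),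
      AddOf.trans (.of_iso (e ≪≫ e').symm) (ih.2.map (tensorRight S.taut))⟩

variable (K) in
include K E b in
lemma isQcoh_tensorPow (m : ℕ) : isQcoh S.X (tensorPow S.taut m) :=
  ((addOf_tensorPow E b m).1 : AddOf _ ((E.lmSys K b).pow (Fin m)).sub.sheaf).isQcoh
    (ProjSys.isQcoh_sheaf _)

end TensorPow

end SeveriBrauer
end SB

end

noncomputable section
set_option linter.unusedVariables false
namespace SB

/-! ### The Koszul complex and its contracting homotopy -/

section Koszul

variable {n : ℕ}

/-- The sign of adjoining an element to a finite set. -/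
def adjSign (j : Fin n) (s : Finset (Fin n)) : ℤ := ∏ k ∈ s, if k < j then -1 else 1

lemma adjSign_mul_self (j : Fin n) (s : Finset (Fin n)) : adjSign j s * adjSign j s = 1 := by
  rw [adjSign, ← Finset.prod_mul_distrib]
  exact Finset.prod_eq_one fun k _ => by split_ifs <;> rfl

lemma adjSign_insert {j k : Fin n} {s : Finset (Fin n)} (h : j ∉ s) :
    adjSign k (insert j s) = (if j < k then -1 else 1) * adjSign k s :=
  Finset.prod_insert h

lemma adjSign_insert_self (k : Fin n) (s : Finset (Fin n)) :
    adjSign k (insert k s) = adjSign k s := by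
  by_cases h : k ∈ s
  · rw [Finset.insert_eq_of_mem h]
  · rw [adjSign_insert h, if_neg (lt_irrefl k), one_mul]

lemma adjSign_erase_self (k : Fin n) (s : Finset (Fin n)) :
    adjSign k (s.erase k) = adjSign k s := by
  by_cases h : k ∈ s
  · rw [← adjSign_insert_self, Finset.insert_erase h]
  · rw [Finset.erase_eq_of_notMem h]

lemma sign_add_sign {j k : Fin n} (h : j ≠ k) :
    (if j < k then -1 else 1 : ℤ) + (if k < j then -1 else 1) = 0 := by
  rcases lt_or_gt_of_ne h with h | h
  · rw [if_pos h, if_neg h.not_gt]; rfl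
  · rw [if_neg h.not_gt, if_pos h]; rfl

/-- Adjoining two elements in either order produces opposite signs, the source of `d² = 0`. -/
lemma adjSign_swap {j k : Fin n} {s : Finset (Fin n)} (hj : j ∉ s) (hk : k ∉ s) (h : j ≠ k) :
    adjSign j s * adjSign k (insert j s) + adjSign k s * adjSign j (insert k s) = 0 := by
  rw [adjSign_insert hj, adjSign_insert hk]
  linear_combination adjSign j s * adjSign k s * sign_add_sign h

/-- These are the signs with which the terms replacing `k` by `j` enter `d h` and `h d`; they
cancel. -/
lemma adjSign_cross {j k : Fin n} {s : Finset (Fin n)} (hj : j ∉ s) (hk : k ∈ s) :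
    adjSign j s * adjSign k (insert j s) + adjSign k s * adjSign j (s.erase k) = 0 := by
  have h : j ≠ k := fun h => hj (h ▸ hk)
  have h1 := adjSign_swap (j := j) (k := k) (s := s.erase k)
    (fun h' => hj (Finset.mem_of_mem_erase h')) (Finset.notMem_erase k s) h
  have h2 : adjSign j s = adjSign j (insert k (s.erase k)) := by rw [Finset.insert_erase hk]
  have h3 : adjSign k (insert j s) = (if j < k then -1 else 1) * adjSign k s := adjSign_insert hj
  have h4 : adjSign j (insert k (s.erase k)) =
    (if k < j then -1 else 1) * adjSign j (s.erase k) := adjSign_insert (Finset.notMem_erase k s)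
  have h5 : (if k < j then -1 else 1 : ℤ) * (if j < k then -1 else 1) = -1 := by
    rcases lt_or_gt_of_ne h with h | h
    · rw [if_pos h, if_neg h.not_gt]; rfl
    · rw [if_neg h.not_gt, if_pos h]; rfl
  rw [h2, h3, h4]
  linear_combination adjSign j (s.erase k) * adjSign k s * h5

variable {V V' V'' : Type*} [AddCommGroup V] [AddCommGroup V'] [AddCommGroup V'']

/-- The Koszul differential. -/
def kosD (x : Fin n → V →+ V') (ω : Finset (Fin n) → V) (s : Finset (Fin n)) : V' :=
  ∑ j, if j ∈ s then 0 else adjSign j s • x j (ω (insert j s))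

/-- The Koszul homotopy. -/
def kosH (y : Fin n → V →+ V') (ω : Finset (Fin n) → V) (s : Finset (Fin n)) : V' :=
  ∑ j, if j ∈ s then adjSign j s • y j (ω (s.erase j)) else 0

lemma kosD_kosD (x : Fin n → V →+ V') (x' : Fin n → V' →+ V'')
    (hx : ∀ i j v, x' i (x j v) = x' j (x i v)) (ω : Finset (Fin n) → V) (s : Finset (Fin n)) :
    kosD x' (kosD x ω) s = 0 := by
  have h1 : kosD x' (kosD x ω) s = ∑ p : Fin n × Fin n,
      if p.1 ∈ s then 0 else if p.2 ∈ insert p.1 s then 0 else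
        (adjSign p.1 s * adjSign p.2 (insert p.1 s)) •
          x' p.1 (x p.2 (ω (insert p.2 (insert p.1 s)))) := by
    rw [Fintype.sum_prod_type, kosD]
    refine Finset.sum_congr rfl fun j _ => ?_
    split_ifs with hj
    · simp
    · rw [kosD, map_sum, Finset.smul_sum]
      refine Finset.sum_congr rfl fun k _ => ?_
      split_ifs with hk
      · rw [map_zero, smul_zero]
      · rw [map_zsmul, mul_smul]
  rw [h1]
  -- The terms for `(j, k)` and `(k, j)` cancel, and the diagonal terms are zero, so the swap fixes
  -- no nonzero term.
  refine Finset.sum_involution (fun p _ => (p.2, p.1)) ?_ ?_ (fun _ _ => Finset.mem_univ _)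
    (fun _ _ => rfl)
  · rintro ⟨j, k⟩ -
    by_cases hj : j ∈ s
    · simp [hj]
    by_cases hk : k ∈ s
    · simp [hk]
    by_cases hjk : j = k
    · simp [hjk]
    have h2 : k ∉ insert j s := by simp [hk, Ne.symm hjk]
    have h3 : j ∉ insert k s := by simp [hj, hjk]
    simp only [if_neg hj, if_neg hk, if_neg h2, if_neg h3]
    rw [hx j k, Finset.insert_comm k j, ← add_smul, adjSign_swap hj hk hjk, zero_smul]
  · rintro ⟨j, k⟩ - h heq
    obtain rfl : k = j := congr_arg Prod.fst heq
    simp at h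

variable {V₀ V₁ V₂ : Type*} [AddCommGroup V₀] [AddCommGroup V₁] [AddCommGroup V₂]

/-- Adjoining `j` and removing it again contributes `c j j` for `j ∉ s`; all other terms replace
some `k ∈ s` by some `j ∉ s`. The formula for `kosH_kosD` has the complementary diagonal and the
same mixed terms with opposite signs. -/
lemma kosD_kosH (x : Fin n → V₂ →+ V₁) (y : Fin n → V₁ →+ V₂) (c : Fin n → Fin n → V₁ →+ V₁)
    (hxy : ∀ i j v, x i (y j v) = c i j v) (ω : Finset (Fin n) → V₁) (s : Finset (Fin n)) :
    kosD x (kosH y ω) s = (∑ j, if j ∈ s then 0 else c j j (ω s)) +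
      ∑ j, ∑ k, if j ∈ s then 0 else if k ∈ s then
        (adjSign j s * adjSign k (insert j s)) • c j k (ω (insert j (s.erase k))) else 0 := by
  rw [kosD, ← Finset.sum_add_distrib]
  refine Finset.sum_congr rfl fun j _ => ?_
  split_ifs with hj
  · simp
  · rw [kosH, ← Finset.add_sum_erase _ _ (Finset.mem_univ j), if_pos (Finset.mem_insert_self j s),
      map_add, map_zsmul, hxy, Finset.erase_insert hj, smul_add, smul_smul, adjSign_insert_self,
      adjSign_mul_self, one_smul, map_sum, Finset.smul_sum]
    congr 1
    rw [← Finset.add_sum_erase _ _ (Finset.mem_univ j), if_neg hj, zero_add]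
    refine Finset.sum_congr rfl fun k hk => ?_
    have hkj : k ≠ j := Finset.ne_of_mem_erase hk
    by_cases hks : k ∈ s
    · rw [if_pos hks, if_pos (Finset.mem_insert_of_mem hks), map_zsmul, hxy, smul_smul,
        Finset.erase_insert_of_ne hkj.symm]
    · rw [if_neg hks, if_neg (by simp [hkj, hks]), map_zero, smul_zero]

lemma kosH_kosD (x : Fin n → V₁ →+ V₀) (y : Fin n → V₀ →+ V₁) (c : Fin n → Fin n → V₁ →+ V₁)
    (hyx : ∀ i j v, y j (x i v) = c i j v) (ω : Finset (Fin n) → V₁) (s : Finset (Fin n)) :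
    kosH y (kosD x ω) s = (∑ j, if j ∈ s then c j j (ω s) else 0) +
      ∑ j, ∑ k, if j ∈ s then 0 else if k ∈ s then
        (adjSign k s * adjSign j (s.erase k)) • c j k (ω (insert j (s.erase k))) else 0 := by
  rw [Finset.sum_comm, kosH, ← Finset.sum_add_distrib]
  refine Finset.sum_congr rfl fun k _ => ?_
  split_ifs with hk
  · rw [kosD, ← Finset.add_sum_erase _ _ (Finset.mem_univ k), if_neg (Finset.notMem_erase k s),
      map_add, map_zsmul, hyx, Finset.insert_erase hk, smul_add, smul_smul, adjSign_erase_self,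
      adjSign_mul_self, one_smul, map_sum, Finset.smul_sum]
    congr 1
    rw [← Finset.add_sum_erase _ _ (Finset.mem_univ k), if_pos hk, zero_add]
    refine Finset.sum_congr rfl fun j hj => ?_
    have hjk : j ≠ k := Finset.ne_of_mem_erase hj
    by_cases hjs : j ∈ s
    · rw [if_pos hjs, if_pos (Finset.mem_erase.2 ⟨hjk, hjs⟩), map_zero, smul_zero]
    · rw [if_neg hjs, if_neg (fun h => hjs (Finset.mem_of_mem_erase h)), map_zsmul, hyx, smul_smul]
  · simp

/-- The Koszul homotopy formula. -/
theorem kosD_kosH_add (x : Fin n → V₂ →+ V₁) (y : Fin n → V₁ →+ V₂) (x' : Fin n → V₁ →+ V₀)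
    (y' : Fin n → V₀ →+ V₁) (c : Fin n → Fin n → V₁ →+ V₁)
    (hxy : ∀ i j v, x i (y j v) = c i j v) (hyx : ∀ i j v, y' j (x' i v) = c i j v)
    (hc : ∀ v, ∑ j, c j j v = v) (ω : Finset (Fin n) → V₁) (s : Finset (Fin n)) :
    kosD x (kosH y ω) s + kosH y' (kosD x' ω) s = ω s := by
  rw [kosD_kosH x y c hxy, kosH_kosD x' y' c hyx, add_add_add_comm, ← Finset.sum_add_distrib,
    ← Finset.sum_add_distrib]
  conv_rhs => rw [← hc (ω s), ← add_zero (∑ j, c j j (ω s))]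
  congr 1
  · refine Finset.sum_congr rfl fun j _ => ?_
    split_ifs <;> simp
  · refine Finset.sum_eq_zero fun j _ => ?_
    rw [← Finset.sum_add_distrib]
    refine Finset.sum_eq_zero fun k _ => ?_
    split_ifs with hj hk
    · simp
    · rw [← add_smul, adjSign_cross hj hk, zero_smul]
    · simp

/-- At the end of the complex the summand `h d` of the homotopy formula is not needed: no element of
`∅` can be replaced, so the mixed terms are absent. -/
lemma kosD_kosH_empty (x : Fin n → V₂ →+ V₁) (y : Fin n → V₁ →+ V₂) (c : Fin n → Fin n → V₁ →+ V₁)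
    (hxy : ∀ i j v, x i (y j v) = c i j v) (hc : ∀ v, ∑ j, c j j v = v)
    (ω : Finset (Fin n) → V₁) : kosD x (kosH y ω) ∅ = ω ∅ := by
  rw [kosD_kosH x y c hxy]
  simp [hc]

lemma kosD_supp (x : Fin n → V →+ V') {ω : Finset (Fin n) → V} {i : ℕ}
    (h : ∀ s, s.card ≠ i + 1 → ω s = 0) (s : Finset (Fin n)) (hs : s.card ≠ i) :
    kosD x ω s = 0 := by
  refine Finset.sum_eq_zero fun j _ => ?_
  split_ifs with hj
  · rfl
  · rw [h _ (by rw [Finset.card_insert_of_notMem hj]; omega), map_zero, smul_zero]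

lemma kosH_supp (y : Fin n → V →+ V') {ω : Finset (Fin n) → V} {i : ℕ}
    (h : ∀ s, s.card ≠ i → ω s = 0) (s : Finset (Fin n)) (hs : s.card ≠ i + 1) :
    kosH y ω s = 0 := by
  refine Finset.sum_eq_zero fun j _ => ?_
  split_ifs with hj
  · rw [h _ (by
      have := Finset.card_erase_add_one hj
      omega), map_zero, smul_zero]
  · rfl

end Koszul

section

variable {X : Scheme.{u}}

/-- A sequence of sheaves of modules which is left exact on sections, and right exact on sections
over affine open subsets. -/
structure IsAffExact {M' M M'' : X.Modules} (f : M' ⟶ M) (g : M ⟶ M'') : Prop where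
  inj : ∀ U, Function.Injective (f.app U)
  comp : ∀ U x, g.app U (f.app U x) = 0
  exact : ∀ U x, g.app U x = 0 → ∃ y, f.app U y = x
  surj : ∀ U, IsAffineOpen U → Function.Surjective (g.app U)

end

/-! ### Coordinates on the powers of a rank one idempotent -/

namespace SeveriBrauer

variable {F A : Type u} [Field F] [Ring A] [Algebra F A] {n : ℕ} {S : SeveriBrauer F A n}
  {K : Type u} [Field K] [Algebra F K] 

/-- A system of idempotent matrices of rank one. -/
structure ProjSys.RankOne {ι : Type} [Fintype ι] (Q : S.ProjSys K ι) : Prop where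
  minor {W : S.X.Opens} (hW : IsAffineOpen W) (i j a c : ι) :
    Q.p hW i a * Q.p hW j c = Q.p hW j a * Q.p hW i c
  trace {W : S.X.Opens} (hW : IsAffineOpen W) : ∑ i, Q.p hW i i = 1

variable {N : ℕ} (Q : S.ProjSys K (Fin N))

lemma pow_p_cons {k : ℕ} {W : S.X.Opens} (hW : IsAffineOpen W) (i j : Fin N) (a c : Fin k → Fin N) :
    (Q.pow (Fin (k + 1))).p hW (Fin.cons i a) (Fin.cons j c) =
      Q.p hW i j * (Q.pow (Fin k)).p hW a c := by
  exact Fin.prod_univ_succ fun t => Q.p hW ((Fin.cons i a : Fin (k + 1) → Fin N) t)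
    ((Fin.cons j c : Fin (k + 1) → Fin N) t)

lemma pow_mulVec_cons {k : ℕ} {W : S.X.Opens} (hW : IsAffineOpen W)
    (v : (Fin (k + 1) → Fin N) → S.GK K W) (i : Fin N) :
    (fun a => ((Q.pow (Fin (k + 1))).p hW).mulVec v (Fin.cons i a)) =
      ∑ j, Q.p hW i j • ((Q.pow (Fin k)).p hW).mulVec fun a => v (Fin.cons j a) := by
  ext a
  rw [Finset.sum_apply]
  simp only [Matrix.mulVec, dotProduct, Pi.smul_apply, smul_eq_mul, Finset.mul_sum]
  rw [← (Fin.consEquiv fun _ => Fin N).sum_comp, Fintype.sum_prod_type]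
  refine Finset.sum_congr rfl fun j _ => Finset.sum_congr rfl fun c _ => ?_
  rw [← mul_assoc, ← pow_p_cons]
  rfl

lemma ProjSys.idem {ι : Type} [Fintype ι] (Q : S.ProjSys K ι)
    {W : S.X.Opens} (hW : IsAffineOpen W) :
    Q.p hW * Q.p hW = Q.p hW := by
  have := Q.absorb hW hW le_rfl le_rfl
  rwa [map_resK_refl] at this

/-- The idempotent of the power `k + 1` is a product of two commuting idempotents, one acting on the
first slot and one on the others; a tensor is fixed by the product exactly when both fix it. -/
lemma mem_pow_succ_iff {k : ℕ} {W : S.X.Opens} (hW : IsAffineOpen W)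
    (v : (Fin (k + 1) → Fin N) → S.GK K W) :
    v ∈ (Q.pow (Fin (k + 1))).sub.carrier W ↔
      (∀ i, (fun a => v (Fin.cons i a)) ∈ (Q.pow (Fin k)).sub.carrier W) ∧
      ∀ i a, v (Fin.cons i a) = ∑ j, Q.p hW i j * v (Fin.cons j a) := by
  rw [ProjSys.mem_iff_self _ hW]
  simp only [ProjSys.mem_iff_self _ hW]
  constructor
  · intro hv
    have h1 (i) : (fun a => v (Fin.cons i a)) = ∑ j, Q.p hW i j •
        ((Q.pow (Fin k)).p hW).mulVec fun a => v (Fin.cons j a) := by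
      rw [← pow_mulVec_cons, hv]
    have h2 (i) : ((Q.pow (Fin k)).p hW).mulVec (fun a => v (Fin.cons i a)) =
        fun a => v (Fin.cons i a) := by
      conv_lhs => rw [h1]
      rw [Matrix.mulVec_sum]
      simp only [Matrix.mulVec_smul, Matrix.mulVec_mulVec, ProjSys.idem (Q.pow (Fin k)) hW]
      exact (h1 i).symm
    refine ⟨h2, fun i a => ?_⟩
    have h3 := congr_fun (h1 i) a
    simp only [h2] at h3
    rw [h3, Finset.sum_apply]
    rfl
  · rintro ⟨h1, h2⟩
    ext a
    obtain ⟨⟨i, c⟩, rfl⟩ := (Fin.consEquiv fun _ => Fin N).surjective a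
    have h3 := congr_fun (pow_mulVec_cons Q hW v i) c
    simp only [h1] at h3
    refine h3.trans ((Finset.sum_apply _ _ _).trans (h2 i c).symm)

section Local

variable {W : S.X.Opens} (hW : IsAffineOpen W)

/-- The sections over an affine open subset of the powers. -/
abbrev PowSec (W : S.X.Opens) (k : ℕ) := (Q.pow (Fin k)).sub.carrier W

/-- A coordinate of a tensor. -/
def coordX (k : ℕ) (j : Fin N) : PowSec Q W (k + 1) →+ PowSec Q W k where
  toFun v := ⟨fun a => v.1 (Fin.cons j a), ((mem_pow_succ_iff Q hW v.1).1 v.2).1 j⟩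
  map_zero' := rfl
  map_add' _ _ := rfl

/-- Multiplication by a function. -/
def scal (k : ℕ) (r : S.GK K W) : PowSec Q W k →+ PowSec Q W k where
  toFun v := ⟨r • v.1, by
    rw [ProjSys.mem_iff_self _ hW, Matrix.mulVec_smul, (ProjSys.mem_iff_self _ hW _).1 v.2]⟩
  map_zero' := Subtype.ext (smul_zero r)
  map_add' v w := Subtype.ext (smul_add r v.1 w.1)

/-- Multiplication of a tensor by a column of the idempotent matrix. -/
def colY (k : ℕ) (j : Fin N) : PowSec Q W k →+ PowSec Q W (k + 1) where
  toFun v := ⟨fun a => Q.p hW (a 0) j * v.1 (Fin.tail a), by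
    rw [mem_pow_succ_iff Q hW]
    refine ⟨fun i => (scal Q hW k (Q.p hW i j) v).2, fun i a => ?_⟩
    simp only [Fin.cons_zero, Fin.tail_cons, ← mul_assoc, ← Finset.sum_mul]
    rw [← Matrix.mul_apply, ProjSys.idem Q hW]⟩
  map_zero' := Subtype.ext (funext fun _ => mul_zero _)
  map_add' v w := Subtype.ext (funext fun _ => mul_add _ _ _)

lemma coordX_colY (k : ℕ) (i j : Fin N) (v : PowSec Q W k) :
    coordX Q hW k i (colY Q hW k j v) = scal Q hW k (Q.p hW i j) v := rfl

variable {Q} (hQ : Q.RankOne)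
include hQ

/-- The vanishing `2 × 2` minors turn `p c j * v_i` into `p i j * v_c`. This is where rank one
enters the homotopy: taking a coordinate and multiplying by a column is multiplication by a
function, in either order. -/
lemma colY_coordX (k : ℕ) (i j : Fin N) (v : PowSec Q W (k + 1)) :
    colY Q hW k j (coordX Q hW k i v) = scal Q hW (k + 1) (Q.p hW i j) v := by
  refine Subtype.ext (funext fun a => ?_)
  obtain ⟨⟨c, a⟩, rfl⟩ := (Fin.consEquiv fun _ => Fin N).surjective a
  have h := ((mem_pow_succ_iff Q hW v.1).1 v.2).2
  change Q.p hW c j * v.1 (Fin.cons i a) = Q.p hW i j * v.1 (Fin.cons c a)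
  rw [h i a, h c a, Finset.mul_sum, Finset.mul_sum]
  refine Finset.sum_congr rfl fun d _ => ?_
  rw [← mul_assoc, ← mul_assoc, hQ.minor hW c i j d]

/-- Tensors in a power of a line bundle are symmetric, again by the minors; so the coordinates
commute, as a Koszul complex requires. -/
lemma coordX_comm (k : ℕ) (i j : Fin N) (v : PowSec Q W (k + 2)) :
    coordX Q hW k i (coordX Q hW (k + 1) j v) = coordX Q hW k j (coordX Q hW (k + 1) i v) := by
  refine Subtype.ext (funext fun a => ?_)
  have h := ((mem_pow_succ_iff Q hW v.1).1 v.2).2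
  have h' (c) (i) (a) := ((mem_pow_succ_iff Q hW _).1 (coordX Q hW (k + 1) c v).2).2 i a
  have key (i j : Fin N) : v.1 (Fin.cons j (Fin.cons i a)) = ∑ c, ∑ d,
      Q.p hW j c * Q.p hW i d * v.1 (Fin.cons c (Fin.cons d a)) := by
    rw [h j]
    refine Finset.sum_congr rfl fun c _ => ?_
    refine (congr_arg (Q.p hW j c * ·) (h' c i a)).trans ?_
    rw [Finset.mul_sum]
    exact Finset.sum_congr rfl fun d _ => (mul_assoc _ _ _).symm
  change v.1 (Fin.cons j (Fin.cons i a)) = v.1 (Fin.cons i (Fin.cons j a))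
  rw [key i j, key j i]
  exact Finset.sum_congr rfl fun c _ => Finset.sum_congr rfl fun d _ => by rw [hQ.minor hW j i c d]

/-- Trace one is the normalisation of the Koszul homotopy. -/
lemma sum_scal (k : ℕ) (v : PowSec Q W k) : ∑ j, scal Q hW k (Q.p hW j j) v = v := by
  refine Subtype.ext ?_
  rw [AddSubmonoidClass.coe_finsetSum]
  change ∑ j, Q.p hW j j • v.1 = v.1
  rw [← Finset.sum_smul, hQ.trace hW, one_smul]

end Local

end SeveriBrauer
end SB

end

/-! ### The Koszul complex of sheaves -/

noncomputable section
set_option linter.unusedVariables false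
namespace SB

namespace SeveriBrauer

variable {F A : Type u} [Field F] [Ring A] [Algebra F A] {n : ℕ} {S : SeveriBrauer F A n}
  {K : Type u} [Field K] [Algebra F K] {N : ℕ} (Q : S.ProjSys K (Fin N))

/-- The index type of the terms of the Koszul complex. -/
abbrev KosIdx (N k : ℕ) := Finset (Fin N) × (Fin k → Fin N)

/-- The terms of the Koszul complex. -/
def kosC (k i : ℕ) : S.LocSub K (KosIdx N k) where
  carrier U :=
    { carrier := {ω | ∀ s, (fun a => ω (s, a)) ∈ (Q.pow (Fin k)).sub.carrier U ∧
        (s.card ≠ i → ∀ a, ω (s, a) = 0)}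
      add_mem' := fun hv hw s => ⟨add_mem (hv s).1 (hw s).1, fun hs a => by
        rw [Pi.add_apply, (hv s).2 hs, (hw s).2 hs, add_zero]⟩
      zero_mem' := fun s => ⟨zero_mem _, fun _ _ => rfl⟩
      smul_mem' := fun r v hv s => ⟨Submodule.smul_mem _ r (hv s).1, fun hs a => by
        rw [Pi.smul_apply, (hv s).2 hs, smul_zero]⟩ }
  res_mem h v hv s := ⟨(Q.pow (Fin k)).sub.res_mem h (hv s).1, fun hs a => by
    rw [vres_apply, (hv s).2 hs, map_zero]⟩
  loc {U v} H s := ⟨(Q.pow (Fin k)).sub.loc fun p hp => by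
      obtain ⟨V, hV, hpV, h⟩ := H p hp
      exact ⟨V, hV, hpV, (h s).1⟩,
    fun hs a => GK_ext fun p hp => by
      obtain ⟨V, hV, hpV, h⟩ := H p hp
      refine ⟨V, hV, hpV, ?_⟩
      rw [map_zero]
      exact (h s).2 hs a⟩

variable (S K N) in
/-- The differential of the Koszul complex. -/
def kosMap (k : ℕ) : S.NatMap K ⊤ (KosIdx N (k + 1)) (KosIdx N k) where
  f U _ := LinearMap.pi fun x => ∑ j, if j ∈ x.1 then 0 else
    adjSign j x.1 • LinearMap.proj (insert j x.1, (Fin.cons j x.2 : Fin (k + 1) → Fin N))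
  nat {U V} h hU v := by
    ext x
    simp only [vres_apply, LinearMap.pi_apply, LinearMap.sum_apply, map_sum]
    refine Finset.sum_congr rfl fun j _ => ?_
    split_ifs
    · simp
    · simp

lemma kosMap_apply (k : ℕ) (U : S.X.Opens) (ω : KosIdx N (k + 1) → S.GK K U) (s) (a) :
    (S.kosMap K N k).f U le_top ω (s, a) = ∑ j, if j ∈ s then 0 else
      adjSign j s • ω (insert j s, (Fin.cons j a : Fin (k + 1) → Fin N)) := by
  change (∑ j, if j ∈ s then 0 else
    adjSign j s • LinearMap.proj (insert j s, (Fin.cons j a : Fin (k + 1) → Fin N)) :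
      (KosIdx N (k + 1) → S.GK K U) →ₗ[Γ(S.X, U)] S.GK K U) ω = _
  rw [LinearMap.sum_apply]
  refine Finset.sum_congr rfl fun j _ => ?_
  split_ifs <;> rfl

/-- The components of a section over an affine open subset of a term of the Koszul complex. -/
def kosComp {k i : ℕ} {W : S.X.Opens} (ω : (kosC Q k i).carrier W) (s : Finset (Fin N)) :
    PowSec Q W k := ⟨fun a => ω.1 (s, a), (ω.2 s).1⟩

lemma kosMap_eq {k i : ℕ} {W : S.X.Opens} (hW : IsAffineOpen W) (ω : (kosC Q (k + 1) i).carrier W)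
    (s) (a) : (S.kosMap K N k).f W le_top ω.1 (s, a) =
      (kosD (coordX Q hW k) (kosComp Q ω) s).1 a := by
  rw [kosMap_apply, kosD, AddSubmonoidClass.coe_finsetSum, Finset.sum_apply]
  refine Finset.sum_congr rfl fun j _ => ?_
  split_ifs <;> rfl

lemma kosMap_mem {k i : ℕ} (U : S.X.Opens) :
    ∀ v ∈ (kosC Q (k + 1) (i + 1)).carrier U, (S.kosMap K N k).f U le_top v ∈
      (kosC Q k i).carrier U := by
  intro v hv
  refine (kosC Q k i).loc fun p hp => ?_
  obtain ⟨W, hWU, hpW, hW⟩ := exists_affine_le U p hp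
  refine ⟨W, hWU, hpW, fun s => ?_⟩
  rw [(S.kosMap K N k).nat]
  let ω : (kosC Q (k + 1) (i + 1)).carrier W := ⟨vres hWU v, (kosC Q _ _).res_mem hWU hv⟩
  refine ⟨?_, fun hs a => ?_⟩
  · have : (fun a => (S.kosMap K N k).f W le_top (vres hWU v) (s, a)) =
      (kosD (coordX Q hW k) (kosComp Q ω) s).1 := funext fun a => kosMap_eq Q hW ω s a
    rw [this]
    exact Subtype.prop _
  · refine (kosMap_eq Q hW ω s a).trans ?_
    rw [kosD_supp (i := i) _ _ s hs]
    · rfl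
    · exact fun t ht => Subtype.ext (funext fun a => (ω.2 t).2 ht a)

/-- The kernels of the differentials of the Koszul complex. -/
def kosKer (k i : ℕ) : S.LocSub K (KosIdx N (k + 1)) where
  carrier U := (kosC Q (k + 1) (i + 1)).carrier U ⊓ LinearMap.ker ((S.kosMap K N k).f U le_top)
  res_mem {U V} h v hv := ⟨(kosC Q _ _).res_mem h hv.1, by
    have := hv.2
    rw [SetLike.mem_coe, LinearMap.mem_ker] at this ⊢
    rw [← (S.kosMap K N k).nat h le_top, this, map_zero]⟩
  loc {U v} H := ⟨(kosC Q _ _).loc fun p hp => by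
      obtain ⟨V, hV, hpV, h⟩ := H p hp
      exact ⟨V, hV, hpV, h.1⟩, by
    rw [SetLike.mem_coe, LinearMap.mem_ker]
    refine vec_ext fun p hp => ?_
    obtain ⟨V, hV, hpV, h⟩ := H p hp
    refine ⟨V, hV, hpV, ?_⟩
    rw [(S.kosMap K N k).nat, map_zero]
    exact h.2⟩

/-- The cycles of the Koszul complex. -/
def kosZ : ∀ k _ : ℕ, S.LocSub K (KosIdx N k)
  | k, 0 => kosC Q k 0
  | 0, i + 1 => kosC Q 0 (i + 1)
  | k + 1, i + 1 => kosKer Q k i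

lemma kosZ_le (k i : ℕ) (U : S.X.Opens) : (kosZ Q k i).carrier U ≤ (kosC Q k i).carrier U := by
  rcases k with _ | k <;> rcases i with _ | i
  exacts [le_rfl, le_rfl, le_rfl, inf_le_left]

variable (hQ : Q.RankOne)
include hQ

lemma kosMap_mem_kosZ {k i : ℕ} (hki : i ≤ k) (U : S.X.Opens) :
    ∀ v ∈ (kosC Q (k + 1) (i + 1)).carrier U, (S.kosMap K N k).f U le_top v ∈
      (kosZ Q k i).carrier U := by
  intro v hv
  obtain _ | i := i
  · cases k <;> exact kosMap_mem Q U v hv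
  obtain _ | k := k
  · omega
  refine ⟨kosMap_mem Q U v hv, ?_⟩
  rw [SetLike.mem_coe, LinearMap.mem_ker]
  refine vec_ext fun p hp => ?_
  obtain ⟨W, hWU, hpW, hW⟩ := exists_affine_le U p hp
  refine ⟨W, hWU, hpW, ?_⟩
  rw [(S.kosMap K N k).nat, (S.kosMap K N _).nat, map_zero]
  let ω : (kosC Q (k + 1 + 1) (i + 1 + 1)).carrier W := ⟨vres hWU v, (kosC Q _ _).res_mem hWU hv⟩
  let dω : (kosC Q (k + 1) (i + 1)).carrier W :=
    ⟨(S.kosMap K N _).f W le_top ω.1, kosMap_mem Q W _ ω.2⟩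
  ext ⟨s, a⟩
  refine (kosMap_eq Q hW dω s a).trans ?_
  have h1 : kosComp Q dω = kosD (coordX Q hW (k + 1)) (kosComp Q ω) := by
    refine funext fun t => Subtype.ext (funext fun c => ?_)
    exact kosMap_eq Q hW ω t c
  rw [h1, kosD_kosD _ _ (coordX_comm hW hQ k)]
  rfl

/-- The homotopy supplies the preimage `h v` of a cycle `v`, since `d h + h d = 1` and `d v = 0`. In
degree `0` the term `h d` is absent. -/
lemma kosMap_surj {k i : ℕ} {W : S.X.Opens} (hW : IsAffineOpen W) (hki : i ≤ k) :
    ∀ v ∈ (kosZ Q k i).carrier W, ∃ w ∈ (kosC Q (k + 1) (i + 1)).carrier W,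
      (S.kosMap K N k).f W le_top w = v := by
  intro v hv
  let ω : (kosC Q k i).carrier W := ⟨v, kosZ_le Q k i W hv⟩
  have hsupp (s : Finset (Fin N)) (hs : s.card ≠ i) : kosComp Q ω s = 0 :=
    Subtype.ext (funext fun a => (ω.2 s).2 hs a)
  let η := kosH (colY Q hW k) (kosComp Q ω)
  let w : (kosC Q (k + 1) (i + 1)).carrier W := ⟨fun x => (η x.1).1 x.2, fun s =>
    ⟨(η s).2, fun hs a => by
      have : η s = 0 := kosH_supp _ hsupp s hs
      simp only [this]
      rfl⟩⟩
  have hw : kosComp Q w = η := rfl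
  refine ⟨w.1, w.2, ?_⟩
  ext ⟨s, a⟩
  rw [kosMap_eq Q hW w, hw]
  suffices h : kosD (coordX Q hW k) η s = kosComp Q ω s by
    rw [h]; rfl
  obtain _ | i := i
  · by_cases hs : s = ∅
    · rw [hs]
      exact kosD_kosH_empty _ _ _ (coordX_colY Q hW k) (sum_scal hW hQ k) _
    · rw [hsupp s (by rwa [Ne, Finset.card_eq_zero])]
      exact kosD_supp _ (fun t ht => kosH_supp _ hsupp t ht) s (by rwa [Ne, Finset.card_eq_zero])
  obtain _ | k := k
  · omega
  have h2 := kosD_kosH_add (coordX Q hW (k + 1)) (colY Q hW (k + 1)) (coordX Q hW k)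
    (colY Q hW k) (fun i j => scal Q hW (k + 1) (Q.p hW i j)) (coordX_colY Q hW (k + 1))
    (colY_coordX hW hQ k) (sum_scal hW hQ (k + 1)) (kosComp Q ω) s
  have h3 : kosD (coordX Q hW k) (kosComp Q ω) = 0 := by
    refine funext fun t => Subtype.ext (funext fun c => ?_)
    refine (kosMap_eq Q hW ω t c).symm.trans ?_
    have := hv.2
    rw [SetLike.mem_coe, LinearMap.mem_ker] at this
    exact congr_fun this (t, c)
  rw [h3] at h2
  have h4 : kosH (colY Q hW k) (0 : Finset (Fin N) → PowSec Q W k) s = 0 :=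
    Finset.sum_eq_zero fun j _ => by simp
  rw [h4, add_zero] at h2
  exact h2

end SeveriBrauer
end SB

end

/-! ### Thick classes contain all powers of `L` -/

noncomputable section
set_option linter.unusedVariables false
namespace SB

/-- A property of sheaves of modules which is inherited by direct summands of finite direct sums
and satisfies two of the cases of the two out of three property. -/
structure IsThickProp {X : Scheme.{u}} (P : X.Modules → Prop) : Prop where
  add {M N : X.Modules} : AddOf M N → P N → P M
  ker {M' M M'' : X.Modules} (f : M' ⟶ M) (g : M ⟶ M'') : IsAffExact f g → P M → P M'' → P M'
  mid {M' M M'' : X.Modules} (f : M' ⟶ M) (g : M ⟶ M'') : IsAffExact f g → isQcoh X M →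
    P M' → P M'' → P M

namespace SeveriBrauer

variable {F A : Type u} [Field F] [Ring A] [Algebra F A] {n : ℕ} {S : SeveriBrauer F A n}
  {K : Type u} [Field K] [Algebra F K] [FiniteDimensional F K] {N : ℕ} (Q : S.ProjSys K (Fin N))

variable (S K) in
/-- The identity of vectors. -/
def idMap (W : S.X.Opens) (ι : Type) : S.NatMap K W ι ι where
  f U _ := LinearMap.id
  nat _ _ _ := rfl

/-- The inclusion of the cycles of the Koszul complex. -/
def kosIncl (k i : ℕ) : (kosZ Q k i).sheaf ⟶ (kosC Q k i).sheaf :=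
  LocSub.map _ _ (S.idMap K ⊤ _) fun U v hv => kosZ_le Q k i U hv

section

variable (hQ : Q.RankOne)

/-- The differential of the Koszul complex, with values in cycles. -/
def kosHom {k i : ℕ} (hki : i ≤ k) : (kosC Q (k + 1) (i + 1)).sheaf ⟶ (kosZ Q k i).sheaf :=
  LocSub.map _ _ (S.kosMap K N k) fun U v hv => kosMap_mem_kosZ Q hQ hki U v hv

lemma kos_isAffExact {k i : ℕ} (hki : i ≤ k) :
    IsAffExact (kosIncl Q (k + 1) (i + 1)) (kosHom Q hQ hki) where
  inj U x y h := by
    have h' := congr_arg (LocSub.vec (kosC Q (k + 1) (i + 1))) h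
    exact LocSub.vec_injective _ h'
  comp U x := LocSub.vec_injective _ (LocSub.vec_mem _ x).2
  exact U x hx := ⟨(kosZ Q (k + 1) (i + 1)).sec (LocSub.vec _ x) ⟨LocSub.vec_mem _ x,
    congr_arg (LocSub.vec (kosZ Q k i)) hx⟩, rfl⟩
  surj U hU x := by
    obtain ⟨w, hw, h⟩ := kosMap_surj Q hQ hU hki _ (LocSub.vec_mem _ x)
    exact ⟨LocSub.sec _ w hw, LocSub.vec_injective _ h⟩

end

/-- A component of the terms of the Koszul complex. -/
def kosProj (k i : ℕ) (s : Finset (Fin N)) :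
    (kosC Q k i).sheaf ⟶ (Q.pow (Fin k)).sub.sheaf :=
  LocSub.map _ _ (S.reindexMap K ⊤ fun a => (s, a)) fun U v hv => (hv s).1

variable (S K) in
/-- The vectors concentrated in one component. -/
def kosSingle (k : ℕ) (s : Finset (Fin N)) : S.NatMap K ⊤ (Fin k → Fin N) (KosIdx N k) where
  f U _ := LinearMap.pi fun x => if x.1 = s then LinearMap.proj x.2 else 0
  nat {U V} h hU v := by
    ext x
    simp only [vres_apply, LinearMap.pi_apply]
    split_ifs
    · rfl
    · exact map_zero _

lemma kosSingle_apply (k : ℕ) (s t : Finset (Fin N)) (U : S.X.Opens)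
    (v : (Fin k → Fin N) → S.GK K U) (a) :
    (S.kosSingle K k s).f U le_top v (t, a) = if t = s then v a else 0 := by
  change (if t = s then LinearMap.proj a else 0 :
    ((Fin k → Fin N) → S.GK K U) →ₗ[Γ(S.X, U)] S.GK K U) v = _
  split_ifs <;> rfl

/-- The inclusion of a component in a term of the Koszul complex. -/
def kosInj (k : ℕ) {i : ℕ} (s : Finset (Fin N)) (hs : s.card = i) :
    (Q.pow (Fin k)).sub.sheaf ⟶ (kosC Q k i).sheaf :=
  LocSub.map _ _ (S.kosSingle K k s) fun U v hv t => by
    simp only [kosSingle_apply]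
    refine ⟨?_, fun ht a => if_neg fun h => ht (by rw [h, hs])⟩
    split_ifs
    · exact hv
    · exact zero_mem _

lemma addOf_pow_kosC (k : ℕ) {i : ℕ} (s : Finset (Fin N)) (hs : s.card = i) :
    AddOf (Q.pow (Fin k)).sub.sheaf (kosC Q k i).sheaf := by
  refine .of_retract (kosInj Q k s hs) (kosProj Q k _ s) (mod_hom_ext fun U x => ?_)
  refine LocSub.vec_injective _ (funext fun a => ?_)
  exact (kosSingle_apply k s s U _ a).trans (if_pos rfl)

lemma addOf_kosC_pow (k i : ℕ) : AddOf (kosC Q k i).sheaf (Q.pow (Fin k)).sub.sheaf := by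
  refine ⟨{s : Finset (Fin N) // s.card = i}, inferInstance, fun s => kosProj Q k i s.1,
    fun s => kosInj Q k s.1 s.2,
    mod_hom_ext fun U x => LocSub.vec_injective _ (funext fun ⟨t, a⟩ => ?_)⟩
  rw [sum_app_apply, map_sum, Finset.sum_apply]
  refine (Finset.sum_congr rfl fun s _ => kosSingle_apply k s.1 t U
    (fun a => LocSub.vec (kosC Q k i) x (s.1, a)) a).trans ?_
  change _ = LocSub.vec _ x (t, a)
  by_cases ht : t.card = i
  · rw [Finset.sum_eq_single ⟨t, ht⟩]
    · rw [if_pos rfl]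
    · intro s _ hs
      rw [if_neg fun h => hs (Subtype.ext h.symm)]
    · exact fun h => absurd (Finset.mem_univ _) h
  · rw [(LocSub.vec_mem _ x t).2 ht]
    exact Finset.sum_eq_zero fun s _ => if_neg fun h : t = s.1 => ht (h ▸ s.2)

lemma isQcoh_kosC (k i : ℕ) : isQcoh S.X (kosC Q k i).sheaf :=
  (addOf_kosC_pow Q k i).isQcoh (ProjSys.isQcoh_sheaf _)

/-- The top cycles of the Koszul complex vanish. -/
lemma addOf_kosZ_top (hQ : Q.RankOne) (k : ℕ) (hk : N ≤ k) (M : S.X.Modules) :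
    AddOf (kosZ Q k N).sheaf M := by
  refine ⟨Fin 0, inferInstance, Fin.elim0, fun i => i.elim0, ?_⟩
  rw [Finset.univ_eq_empty, Finset.sum_empty]
  refine hom_ext_of_small IsAffineOpen exists_affine_le fun U hU x => ?_
  refine LocSub.vec_injective _ ?_
  obtain ⟨w, hw, h⟩ := kosMap_surj Q hQ hU hk _ (LocSub.vec_mem _ x)
  -- `w` sits in exterior degree `N + 1`, and `Fin N` has no subset of that size.
  have h0 : w = 0 := by
    ext ⟨s, a⟩
    refine (hw s).2 ?_ a
    have := s.card_le_univ
    rw [Fintype.card_fin] at this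
    omega
  rw [h0, map_zero] at h
  exact h

/-- The powers of a system of rank one idempotent matrices satisfy every thick property
which is satisfied by the first ones. -/
theorem pow_of_isThickProp (hQ : Q.RankOne) {P : S.X.Modules → Prop} (hP : IsThickProp P)
    (h0 : ∀ k < N, P (Q.pow (Fin k)).sub.sheaf) (hN : 0 < N) (k : ℕ) :
    P (Q.pow (Fin k)).sub.sheaf := by
  induction k using Nat.strong_induction_on with
  | _ k ih =>
    by_cases hk : k < N
    · exact h0 k hk
    obtain ⟨m, rfl⟩ := Nat.exists_eq_add_of_le' (not_lt.1 hk)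
    have hC (i : ℕ) (hi : i < N) : P (kosC Q (m + i) i).sheaf :=
      hP.add (addOf_kosC_pow Q _ _) (ih _ (by omega))
    -- The cycles are reached from `Z_0 = C_0` along the sequences `0 → Z_(i+1) → C_(i+1) → Z_i →
    -- 0`; for `i < N` the term `C_i` involves only the power `m + i < m + N`.
    have hZ (i : ℕ) (hi : i < N) : P (kosZ Q (m + i) i).sheaf := by
      induction i with
      | zero =>
        have h : kosZ Q m 0 = kosC Q m 0 := by cases m <;> rfl
        rw [Nat.add_zero, h]
        exact hC 0 hi
      | succ i ihi =>
        exact hP.ker _ _ (kos_isAffExact Q hQ (Nat.le_add_left i m)) (hC (i + 1) hi)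
          (ihi (by omega))
    obtain _ | i := N
    · exact absurd hN (lt_irrefl _)
    -- The top cycles vanish, and zero belongs to the class as an empty sum of copies of `L^0`. The
    -- last sequence thus puts the top term in the class; its component at the full set is the new
    -- power.
    have hT : P (kosC Q (m + (i + 1)) (i + 1)).sheaf :=
      hP.mid _ _ (kos_isAffExact Q hQ (Nat.le_add_left i m)) (isQcoh_kosC Q _ _)
        (hP.add (addOf_kosZ_top Q hQ _ (Nat.le_add_left _ _) _) (h0 0 hN)) (hZ i (by omega))
    exact hP.add (addOf_pow_kosC Q _ Finset.univ (by simp)) hT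

end SeveriBrauer
end SB

end

noncomputable section
set_option linter.unusedVariables false
namespace SB

/-! ### Orthogonality in the derived category -/

section Derived

open Pretriangulated ZeroObject

universe v u'

variable {C : Type u'} [Category.{v} C] [Abelian C] [HasDerivedCategory.{w} C]

lemma eq_zero_of_iso_hom_comp {D : Type*} [Category* D] [HasZeroMorphisms D] {X Y M : D} (e : X ≅ Y)
    (f : Y ⟶ M) (h : e.hom ≫ f = 0) : f = 0 := by
  rw [← cancel_epi e.hom, h, comp_zero]

/-- All morphisms from the shifts of the object `N` to `M` in the derived category vanish. -/
def LeftOrth (M : DerivedCategory C) (N : C) : Prop :=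
  ∀ (i : ℤ) (f : ((DerivedCategory.singleFunctor C 0).obj N)⟦i⟧ ⟶ M), f = 0

lemma LeftOrth.addOf {M : DerivedCategory C} {N N' : C} (h : AddOf N' N) (hN : LeftOrth M N) :
    LeftOrth M N' := by
  intro i f
  obtain ⟨I, _, α, β, h⟩ := h.map (DerivedCategory.singleFunctor C 0 ⋙ shiftFunctor _ i)
  refine (Category.id_comp f).symm.trans ?_
  change 𝟙 ((DerivedCategory.singleFunctor C 0 ⋙ shiftFunctor _ i).obj N') ≫ f = 0
  rw [← h, Preadditive.sum_comp]
  refine Finset.sum_eq_zero fun j _ => ?_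
  rw [Category.assoc]
  have : β j ≫ f = 0 := hN i _
  rw [this, comp_zero]

lemma LeftOrth.mid {M : DerivedCategory C} {T : ShortComplex C} (hT : T.ShortExact)
    (h₁ : LeftOrth M T.X₁) (h₃ : LeftOrth M T.X₃) : LeftOrth M T.X₂ := by
  intro i f
  have hd := Triangle.shift_distinguished _ hT.singleTriangle_distinguished i
  obtain ⟨g, hg⟩ := Triangle.yoneda_exact₂ _ hd f (h₁ i _)
  rw [hg, h₃ i g]
  exact comp_zero

/-- The triangle is rotated backwards so that `X₁` stands between `X₃⟦-1⟧` and `X₂`. -/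
lemma LeftOrth.left {M : DerivedCategory C} {T : ShortComplex C} (hT : T.ShortExact)
    (h₂ : LeftOrth M T.X₂) (h₃ : LeftOrth M T.X₃) : LeftOrth M T.X₁ := by
  intro i f
  have hd := Triangle.shift_distinguished _ (inv_rot_of_distTriang _
    hT.singleTriangle_distinguished) i
  obtain ⟨g, hg⟩ := Triangle.yoneda_exact₂ _ hd f (eq_zero_of_iso_hom_comp
    ((shiftFunctorAdd' (DerivedCategory C) (-1) i (-1 + i) rfl).app _) _ (h₃ _ _))
  rw [hg]
  refine (congr_arg _ (h₂ i g)).trans comp_zero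

/-- A map from `N` to the cycles is a chain map from `N` placed in degree `j`. In the derived
category it is a morphism from a shift of `N`, so it vanishes, and with it the induced map on
homology. -/
lemma comp_homologyπ_eq_zero (K : CochainComplex C ℤ) {N : C}
    (hN : LeftOrth (DerivedCategory.Q.obj K) N) (j : ℤ) (φ : N ⟶ K.cycles j) :
    φ ≫ K.homologyπ j = 0 := by
  let m : (HomologicalComplex.single C (ComplexShape.up ℤ) j).obj N ⟶ K :=
    HomologicalComplex.mkHomFromSingle (φ ≫ K.iCycles j) fun i _ => by simp
  have h0 : DerivedCategory.Q.map m = 0 := eq_zero_of_iso_hom_comp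
    (((DerivedCategory.singleFunctors C).shiftIso (-j) j 0 (by lia)).app N) _ (hN _ _)
  have h1 : HomologicalComplex.homologyMap m j = 0 := by
    have := DerivedCategory.homologyFunctorFactors_hom_naturality m j
    rw [h0, Functor.map_zero, zero_comp] at this
    exact eq_zero_of_iso_hom_comp ((DerivedCategory.homologyFunctorFactors C j).app _) _ this.symm
  have h2 : φ = (HomologicalComplex.singleObjCyclesSelfIso (ComplexShape.up ℤ) j N).inv ≫
      HomologicalComplex.cyclesMap m j := by
    rw [← cancel_mono (K.iCycles j), Category.assoc, HomologicalComplex.cyclesMap_i,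
      HomologicalComplex.singleObjCyclesSelfIso_inv_iCycles_assoc,
      HomologicalComplex.mkHomFromSingle_f]
    simp
  rw [h2, Category.assoc, ← HomologicalComplex.homologyπ_naturality, h1, comp_zero, comp_zero]

/-- An object of the derived category vanishes as soon as the objects which are left orthogonal
to it form a separating family. -/
theorem isZero_of_leftOrth_separating (M : DerivedCategory C)
    (h : ∀ {Z H : C} (g : Z ⟶ H), (∀ N, LeftOrth M N → ∀ φ : N ⟶ Z, φ ≫ g = 0) → g = 0) :
    IsZero M := by
  let K := DerivedCategory.Q.objPreimage M
  let e : DerivedCategory.Q.obj K ≅ M := DerivedCategory.Q.objObjPreimageIso M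
  have hK {N : C} (hN : LeftOrth M N) : LeftOrth (DerivedCategory.Q.obj K) N := fun i f => by
    rw [← cancel_mono e.hom, zero_comp]
    exact hN i _
  have hz (j : ℤ) : IsZero ((DerivedCategory.homologyFunctor C j).obj M) := by
    -- Separation is applied only to the epimorphism from cycles to homology; once it is zero, so is
    -- its target.
    have h0 : K.homologyπ j = 0 := h _ fun N hN φ => comp_homologyπ_eq_zero K (hK hN) j φ
    exact (IsZero.of_epi_eq_zero _ h0).of_iso
      (((DerivedCategory.homologyFunctor C j).mapIso e).symm ≪≫
        (DerivedCategory.homologyFunctorFactors C j).app K)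
  have : IsIso (0 : M ⟶ 0) := by
    rw [DerivedCategory.isIso_iff]
    intro j
    rw [Functor.map_zero]
    exact ⟨0, (hz j).eq_of_src _ _, ((Functor.map_isZero _ (isZero_zero _)).eq_of_src _ _)⟩
  exact (isZero_zero _).of_iso (asIso (0 : M ⟶ 0))

end Derived

/-! ### Thick classes of quasi-coherent sheaves -/

section Qcoh

variable {X : Scheme.{u}}

/-- The kernel property of the first map of an exact sequence. -/
lemma IsAffExact.isLimit {M' M M'' : X.Modules} {f : M' ⟶ M} {g : M ⟶ M''} (h : IsAffExact f g) :
    ∃ w : f ≫ g = 0, Nonempty (IsLimit (KernelFork.ofι f w)) := by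
  have w : f ≫ g = 0 := mod_hom_ext fun U x => h.comp U x
  have hι := exact_app g _ (kernelIsKernel g)
  let k := kernel.lift g f w
  have hk : IsIso k := by
    rw [Scheme.Modules.Hom.isIso_iff_isIso_app]
    intro U
    rw [ConcreteCategory.isIso_iff_bijective]
    have hkι (x) : (kernel.ι g).app U (k.app U x) = f.app U x := by
      rw [← comp_app_apply, kernel.lift_ι]
    refine ⟨fun x y hxy => h.inj U ?_, fun y => ?_⟩
    · rw [← hkι, ← hkι, hxy]
    · obtain ⟨x, hx⟩ := h.exact U ((kernel.ι g).app U y) (by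
        rw [← comp_app_apply, kernel.condition]; rfl)
      exact ⟨x, (hι U).1 ((hkι x).trans hx)⟩
  exact ⟨w, ⟨IsLimit.ofIsoLimit (kernelIsKernel g)
    (Fork.ext (asIso k) (kernel.lift_ι g f w)).symm⟩⟩

/-- The kernel and epimorphism properties hold among all sheaves of modules and descend to the full
subcategory, where they are tested on fewer objects. -/
lemma IsAffExact.shortExact {M' M M'' : Qcoh X} {f : M' ⟶ M} {g : M ⟶ M''}
    (h : IsAffExact f.hom g.hom) : ∃ w : f ≫ g = 0, (ShortComplex.mk f g w).ShortExact := by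
  obtain ⟨w, ⟨hk⟩⟩ := h.isLimit
  have w' : f ≫ g = 0 := by ext1; exact w
  have hl : IsLimit (KernelFork.ofι f w') := KernelFork.IsLimit.ofι _ _
    (fun a ha => ⟨hk.lift (KernelFork.ofι a.hom congr(($ha).hom))⟩)
    (fun a ha => by
      ext1
      exact hk.fac (KernelFork.ofι a.hom congr(($ha).hom)) WalkingParallelPair.zero)
    (fun a ha m hm => by
      ext1
      exact Fork.IsLimit.hom_ext hk (congr(($hm).hom).trans
        (hk.fac (KernelFork.ofι a.hom congr(($ha).hom)) WalkingParallelPair.zero).symm))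
  have hepi : Epi g := by
    have : Epi g.hom := epi_of_locally_surjective _ h.surj
    exact (isQcoh X).ι.epi_of_epi_map this
  exact ⟨w', { exact := ShortComplex.exact_of_f_is_kernel _ hl
               mono_f := Fork.IsLimit.mono hl
               epi_g := hepi }⟩

variable [HasDerivedCategory.{w} (Qcoh X)]

/-- Sheaves of modules which are quasi-coherent and left orthogonal to an object of the derived
category of quasi-coherent sheaves. -/
def QcohOrth (M : DerivedCategory (Qcoh X)) (N : X.Modules) : Prop :=
  ∃ h : isQcoh X N, LeftOrth M (⟨N, h⟩ : Qcoh X)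

/-- Orthogonality passes through triangles. Quasi-coherence is inherited by summands and kernels;
for the middle term it is part of the hypothesis, so closure under extensions is not needed. -/
lemma isThickProp_qcohOrth (M : DerivedCategory (Qcoh X)) : IsThickProp (QcohOrth M) where
  add {N' N} h hN := by
    have hq := h.isQcoh hN.1
    refine ⟨hq, LeftOrth.addOf ?_ hN.2⟩
    obtain ⟨I, _, α, β, h⟩ := h
    refine ⟨I, inferInstance, fun i => ⟨α i⟩, fun i => ⟨β i⟩, ?_⟩
    apply (isQcoh X).ι.map_injective
    rw [Functor.map_sum]
    exact h
  ker {M' N M''} f g h hN h' := by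
    obtain ⟨w, ⟨hk⟩⟩ := h.isLimit
    have hq : isQcoh X M' :=
      ObjectProperty.IsClosedUnderKernels.kernels_le _ ⟨_, _, hk, hN.1, h'.1⟩
    obtain ⟨w', hs⟩ := IsAffExact.shortExact (M' := ⟨M', hq⟩) (M := ⟨N, hN.1⟩) (M'' := ⟨M'', h'.1⟩)
      (f := ⟨f⟩) (g := ⟨g⟩) h
    exact ⟨hq, LeftOrth.left hs hN.2 h'.2⟩
  mid {M' N M''} f g h hq hM' h' := by
    obtain ⟨w', hs⟩ := IsAffExact.shortExact (M' := ⟨M', hM'.1⟩) (M := ⟨N, hq⟩) (M'' := ⟨M'', h'.1⟩)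
      (f := ⟨f⟩) (g := ⟨g⟩) h
    exact ⟨hq, LeftOrth.mid hs hM'.2 h'.2⟩

end Qcoh

/-! ### Twists by a line bundle and extension of sections -/

section Charts

variable {X : Scheme.{u}}

lemma isQcoh.exists_pow_smul {Z : X.Modules} (hZ : isQcoh X Z) {W D : X.Opens} (hW : IsAffineOpen W)
    (f : Γ(X, W)) (hD : X.basicOpen f = D) (h : D ≤ W) (x : Γ(Z, D)) :
    ∃ (k : ℕ) (t : Γ(Z, W)), fres h f ^ k • x = mres Z h t := by
  subst hD
  obtain ⟨k, t, ht⟩ := ((isQcoh_iff Z).1 hZ W hW f).1 x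
  exact ⟨k, t, by rw [← ht, map_pow]⟩

lemma isQcoh.exists_pow_smul_eq_zero {Z : X.Modules} (hZ : isQcoh X Z) {W D : X.Opens}
    (hW : IsAffineOpen W) (f : Γ(X, W)) (hD : X.basicOpen f = D) (h : D ≤ W) (t : Γ(Z, W))
    (ht : mres Z h t = 0) : ∃ k : ℕ, f ^ k • t = 0 := by
  subst hD
  exact ((isQcoh_iff Z).1 hZ W hW f).2 t ht

/-- An affine cover which looks like the one given by the nonvanishing loci of sections of a
line bundle. The function `d i j` is the quotient of the `j`-th section by the `i`-th one. -/
structure Charts (X : Scheme.{u}) where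
  /-- the index type -/
  ι : Type
  /-- finiteness of the index type -/
  fin : Finite ι
  /-- the open subsets of the cover -/
  V : ι → X.Opens
  affine (i : ι) : IsAffineOpen (V i)
  cover : ⨆ i, V i = ⊤
  /-- the transition functions -/
  d (i j : ι) : Γ(X, V i)
  basicOpen_d (i j : ι) : X.basicOpen (d i j) = V i ⊓ V j
  d_self (i : ι) : d i i = 1
  cocycle (i j l : ι) : fres (inf_le_left : V i ⊓ V j ≤ V i) (d i j) *
    fres (inf_le_right : V i ⊓ V j ≤ V j) (d j l) = fres inf_le_left (d i l)

namespace Charts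

variable (C : Charts X)

instance : Finite C.ι := C.fin

lemma cocycle_res (i j l : C.ι) {U : X.Opens} (hi : U ≤ C.V i) (hj : U ≤ C.V j) :
    fres hi (C.d i j) * fres hj (C.d j l) = fres hi (C.d i l) := by
  have := congr_arg (fres (le_inf hi hj)) (C.cocycle i j l)
  rwa [map_mul, fres_fres, fres_fres, fres_fres] at this

/-- A section of a quasi-coherent sheaf over a chart extends to a section of a twist. -/
theorem exists_extension {Z : X.Modules} (hZ : isQcoh X Z) (j : C.ι) (z : Γ(Z, C.V j)) :
    ∃ (k : ℕ) (y : ∀ i, Γ(Z, C.V i)), (∀ i i', mres Z (inf_le_left : C.V i ⊓ C.V i' ≤ C.V i) (y i) =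
      fres (inf_le_left : C.V i ⊓ C.V i' ≤ C.V i) (C.d i i') ^ k •
        mres Z (inf_le_right : C.V i ⊓ C.V i' ≤ C.V i') (y i')) ∧ y j = z := by
  -- On each chart `d i j ^ k • z` extends from `V i ⊓ V j`, the locus where `d i j` is invertible;
  -- finiteness gives a common `k`.
  obtain ⟨k, hk⟩ := exists_nat_forall (J := C.ι) (P := fun i k => ∃ t : Γ(Z, C.V i),
      fres (inf_le_left : C.V i ⊓ C.V j ≤ C.V i) (C.d i j) ^ k •
        mres Z (inf_le_right : C.V i ⊓ C.V j ≤ C.V j) z = mres Z inf_le_left t)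
    (fun i k l hkl ⟨t, ht⟩ => ⟨C.d i j ^ (l - k) • t, by
      rw [mres_smul, ← ht, smul_smul, map_pow, ← pow_add, Nat.sub_add_cancel hkl]⟩)
    fun i => hZ.exists_pow_smul (C.affine i) (C.d i j) (C.basicOpen_d i j) inf_le_left _
  choose t ht using hk
  -- The extensions `t i` are compatible only over `V j`. Their defects are killed by a power `d i j
  -- ^ l`, which is absorbed by passing from `k` to `k + l`.
  let D (i i') : Γ(Z, C.V i ⊓ C.V i') :=
    fres (inf_le_left : C.V i ⊓ C.V i' ≤ C.V i) (C.d i i') ^ k •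
      mres Z (inf_le_right : C.V i ⊓ C.V i' ≤ C.V i') (t i') - mres Z inf_le_left (t i)
  obtain ⟨l, hl⟩ := exists_nat_forall (J := C.ι × C.ι) (P := fun p l =>
      fres (inf_le_left : C.V p.1 ⊓ C.V p.2 ≤ C.V p.1) (C.d p.1 j) ^ l • D p.1 p.2 = 0)
    (fun p k l hkl h => by rw [← Nat.sub_add_cancel hkl, pow_add, mul_smul, h, smul_zero])
    fun ⟨i, i'⟩ => by
      have haff : IsAffineOpen (C.V i ⊓ C.V i') := by
        rw [← C.basicOpen_d]
        exact (C.affine i).basicOpen _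
      have hb : X.basicOpen (fres (inf_le_left : C.V i ⊓ C.V i' ≤ C.V i) (C.d i j)) =
          C.V i ⊓ C.V i' ⊓ C.V j := by
        refine (X.basicOpen_res (C.d i j) (homOfLE inf_le_left).op).trans ?_
        rw [C.basicOpen_d]
        rw [inf_inf_distrib_left (C.V i ⊓ C.V i') (C.V i), inf_eq_right.2]
        exact inf_le_left.trans (le_inf le_rfl inf_le_left)
      refine hZ.exists_pow_smul_eq_zero haff _ hb inf_le_left _ ?_
      have h1 := congr_arg (mres Z (show C.V i ⊓ C.V i' ⊓ C.V j ≤ C.V i ⊓ C.V j from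
        inf_le_inf_right _ inf_le_left)) (ht i)
      have h2 := congr_arg (mres Z (show C.V i ⊓ C.V i' ⊓ C.V j ≤ C.V i' ⊓ C.V j from
        inf_le_inf_right _ inf_le_right)) (ht i')
      rw [mres_smul, map_pow, fres_fres, mres_mres, mres_mres] at h1 h2
      rw [map_sub, mres_smul, mres_mres, mres_mres, ← h1, ← h2, smul_smul, map_pow, fres_fres,
        ← mul_pow, C.cocycle_res, sub_self]
  refine ⟨k + l, fun i => C.d i j ^ l • t i, fun i i' => ?_, ?_⟩
  · have h := hl (i, i')
    simp only [D, smul_sub, sub_eq_zero, smul_smul] at h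
    rw [mres_smul, mres_smul, smul_smul, map_pow, map_pow, ← h, pow_add, mul_assoc, ← mul_pow,
      C.cocycle_res, mul_comm]
  · have h := ht j
    rw [C.d_self, map_one, one_pow, one_smul] at h
    change C.d j j ^ l • t j = z
    rw [C.d_self, one_pow, one_smul]
    exact eq_of_mres_eq Z fun p hp => ⟨C.V j ⊓ C.V j, inf_le_left, ⟨hp, hp⟩, h.symm⟩

/-- Basic open subsets of charts form a basis, and a section over one of them is, up to an
invertible factor, the restriction of a section over the chart. -/
lemma eq_zero_of_charts {Z H : X.Modules} (hZ : isQcoh X Z) (g : Z ⟶ H)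
    (h : ∀ i (z : Γ(Z, C.V i)), g.app _ z = 0) : g = 0 := by
  refine hom_ext_of_small (fun D => ∃ (i : C.ι) (f : Γ(X, C.V i)), X.basicOpen f = D)
    (fun U p hp => ?_) ?_
  · obtain ⟨i, hi⟩ : ∃ i, p ∈ C.V i := by
      rw [← Opens.mem_iSup, C.cover]; trivial
    obtain ⟨f, hf, hpf⟩ := (C.affine i).exists_basicOpen_le ⟨p, hp⟩ hi
    exact ⟨_, hf, hpf, i, f, rfl⟩
  · rintro _ ⟨i, f, rfl⟩ x
    obtain ⟨k, t, ht⟩ := hZ.exists_pow_smul (C.affine i) f rfl (X.basicOpen_le f) x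
    have h1 : fres (X.basicOpen_le f) f ^ k • g.app _ x = 0 := by
      rw [← Scheme.Modules.Hom.app_smul, ht, app_mres, h, map_zero]
    have hu : IsUnit (fres (X.basicOpen_le f) f) := RingedSpace.isUnit_res_basicOpen _ f
    have h2 := (hu.pow k).smul_eq_zero.1 h1
    rw [h2]
    rfl

/-- Sheaves with functionals which transform like powers of the sections of the line bundle. -/
structure Twists where
  /-- the sheaves -/
  P : ℕ → X.Modules
  /-- the functionals -/
  δ (k : ℕ) (i : C.ι) (U : X.Opens) : Γ(P k, U) →+ Γ(X, U)
  δ_smul (k : ℕ) (i : C.ι) (U : X.Opens) (r : Γ(X, U)) (t : Γ(P k, U)) :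
    δ k i U (r • t) = r * δ k i U t
  δ_res (k : ℕ) (i : C.ι) {U V : X.Opens} (h : V ≤ U) (t : Γ(P k, U)) :
    δ k i V (mres _ h t) = fres h (δ k i U t)
  δ_eq (k : ℕ) (i j : C.ι) {U : X.Opens} (h : U ≤ C.V i) (t : Γ(P k, U)) :
    δ k j U t = fres h (C.d i j) ^ k * δ k i U t
  exists_one (k : ℕ) (i : C.ι) : ∃ t : Γ(P k, C.V i), δ k i _ t = 1

variable {C}

/-- A compatible family of sections of a twist gives a morphism. -/
theorem Twists.exists_hom (T : C.Twists) (Z : X.Modules) (k : ℕ) (y : ∀ i, Γ(Z, C.V i))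
    (hy : ∀ i i', mres Z (inf_le_left : C.V i ⊓ C.V i' ≤ C.V i) (y i) =
      fres (inf_le_left : C.V i ⊓ C.V i' ≤ C.V i) (C.d i i') ^ k •
        mres Z (inf_le_right : C.V i ⊓ C.V i' ≤ C.V i') (y i')) :
    ∃ φ : T.P k ⟶ Z, ∀ i (t : Γ(T.P k, C.V i)), φ.app _ t = T.δ k i _ t • y i := by
  -- The value at `t` is glued from the sections `δ i t • y i`. They agree on overlaps because the
  -- factor `d i i' ^ k` relating `δ i'` to `δ i` is also the one relating `y i` to `y i'`.
  have key (U : X.Opens) (t : Γ(T.P k, U)) : ∃ x : Γ(Z, U), ∀ i,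
      mres Z (inf_le_left : U ⊓ C.V i ≤ U) x =
        fres (inf_le_left : U ⊓ C.V i ≤ U) (T.δ k i U t) •
          mres Z (inf_le_right : U ⊓ C.V i ≤ C.V i) (y i) := by
    have hs := TopCat.Sheaf.existsUnique_gluing' ⟨Z.presheaf, Z.isSheaf⟩ (fun i => U ⊓ C.V i) U
      (fun i => homOfLE inf_le_left) (by rw [← inf_iSup_eq, C.cover, inf_top_eq])
      (fun i => fres (inf_le_left : U ⊓ C.V i ≤ U) (T.δ k i U t) •
          mres Z (inf_le_right : U ⊓ C.V i ≤ C.V i) (y i)) (fun i i' => by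
        change mres Z inf_le_left _ = mres Z inf_le_right _
        have h1 := congr_arg (mres Z (show U ⊓ C.V i ⊓ (U ⊓ C.V i') ≤ C.V i ⊓ C.V i' from
          inf_le_inf inf_le_right inf_le_right)) (hy i i')
        rw [mres_smul, mres_mres, mres_mres, map_pow, fres_fres] at h1
        rw [mres_smul, mres_smul, mres_mres, mres_mres, h1, smul_smul, fres_fres, fres_fres,
          ← T.δ_res, ← T.δ_res, mul_comm, T.δ_eq k i i' (inf_le_left.trans inf_le_right)])
    obtain ⟨x, hx, -⟩ := hs
    exact ⟨x, hx⟩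
  have huniq {U : X.Opens} {x x' : Γ(Z, U)} (h : ∀ i, mres Z (inf_le_left : U ⊓ C.V i ≤ U) x =
      mres Z inf_le_left x') : x = x' := eq_of_mres_eq Z fun p hp => by
    obtain ⟨i, hi⟩ : ∃ i, p ∈ C.V i := by
      rw [← Opens.mem_iSup, C.cover]; trivial
    exact ⟨_, inf_le_left, ⟨hp, hi⟩, h i⟩
  choose f hf using key
  refine ⟨mkHom (fun U => ⟨⟨f U, huniq fun i => ?_⟩, fun s t => huniq fun i => ?_⟩)
    (fun U r t => huniq fun i => ?_) (fun {U V} h t => huniq fun i => ?_), fun i t => ?_⟩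
  · rw [hf, map_zero, map_zero, map_zero, zero_smul]
  · change mres Z _ (f U (s + t)) = mres Z _ (f U s + f U t)
    rw [hf, map_add, map_add, map_add, add_smul, hf, hf]
  · change mres Z _ (f U (r • t)) = mres Z _ (r • f U t)
    rw [hf, mres_smul, hf, T.δ_smul, map_mul, mul_smul]
  · change mres Z _ (f V (mres _ h t)) = mres Z _ (mres Z h (f U t))
    rw [hf, mres_mres, T.δ_res]
    have h1 := congr_arg (mres Z (show V ⊓ C.V i ≤ U ⊓ C.V i from inf_le_inf_right _ h)) (hf U t i)
    rw [mres_smul, mres_mres, mres_mres, fres_fres] at h1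
    rw [h1, fres_fres]
  · change f _ t = _
    have h1 := hf _ t i
    exact eq_of_mres_eq Z fun p hp => ⟨_, inf_le_left, ⟨hp, hp⟩, h1.trans (mres_smul Z _ _ _).symm⟩

/-- The twists form a separating family for quasi-coherent sheaves. -/
theorem Twists.separating (T : C.Twists) {Z H : X.Modules} (hZ : isQcoh X Z) (g : Z ⟶ H)
    (h : ∀ k (φ : T.P k ⟶ Z), φ ≫ g = 0) : g = 0 := by
  refine C.eq_zero_of_charts hZ g fun i z => ?_
  obtain ⟨k, y, hy, rfl⟩ := C.exists_extension hZ i z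
  obtain ⟨φ, hφ⟩ := T.exists_hom Z k y hy
  -- A section on which `δ i` takes the value `1` is sent to the given section over the chart, so
  -- `g` kills the latter.
  obtain ⟨t, ht⟩ := T.exists_one k i
  have h1 := hφ i t
  rw [ht, one_smul] at h1
  rw [← h1, ← comp_app_apply, h]
  rfl

end Charts

end Charts

/-! ### Expansion of determinants into minors -/

section Minor

variable {R ι : Type*} [CommRing R] [Fintype ι] {n : ℕ}

/-- Multilinearity of the determinant in the rows: the Cauchy–Binet formula before terms with equal
index sets are collected. -/
lemma det_mul_eq_sum (M : Matrix (Fin n) ι R) (N : Matrix ι (Fin n) R) :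
    (M * N).det = ∑ I : Fin n → ι, (∏ r, M r (I r)) * (N.submatrix I id).det := by
  classical
  have h : M * N = Matrix.of fun r => ∑ i, M r i • N i := by
    ext r q
    simp [Matrix.mul_apply]
  rw [h]
  refine (MultilinearMap.map_sum (Matrix.detRowAlternating (R := R) (n := Fin n)).toMultilinearMap
    (fun r i => M r i • N i)).trans ?_
  refine Finset.sum_congr rfl fun I _ => ?_
  exact (MultilinearMap.map_smul_univ _ (fun r => M r (I r)) fun r => N (I r))

lemma exists_submatrix_det_ne_zero [Nontrivial R] {M : Matrix (Fin n) ι R} {N : Matrix ι (Fin n) R}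
    (h : M * N = 1) : ∃ I : Fin n → ι, (N.submatrix I id).det ≠ 0 := by
  by_contra! H
  have h1 := det_mul_eq_sum M N
  rw [h, Matrix.det_one, Finset.sum_eq_zero fun I _ => by rw [H I, mul_zero]] at h1
  exact one_ne_zero h1

lemma exists_submatrix_det_ne_zero' [Nontrivial R] {M : Matrix (Fin n) ι R}
    {N : Matrix ι (Fin n) R} (h : M * N = 1) : ∃ I : Fin n → ι, (M.submatrix id I).det ≠ 0 := by
  obtain ⟨I, hI⟩ := exists_submatrix_det_ne_zero (M := N.transpose) (N := M.transpose)
    (by rw [← Matrix.transpose_mul, h, Matrix.transpose_one])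
  refine ⟨I, ?_⟩
  rwa [← Matrix.det_transpose]

end Minor

/-! ### Frames of right ideals -/

section Frame

variable {F A : Type u} [Field F] [Ring A] [Algebra F A] {n : ℕ}
  (b : Module.Basis (Fin (n ^ 2)) F A) {R : Type u} [CommRing R] [Algebra F R]

/-- The matrix of the coordinates with given indices of a family of elements. -/
def coordMat (J : Fin n → Fin (n ^ 2)) (s : Fin n → R ⊗[F] A) : Matrix (Fin n) (Fin n) R :=
  .of fun q r => (b.baseChange R).repr (s r) (J q)

lemma coordMat_apply (J : Fin n → Fin (n ^ 2)) (s : Fin n → R ⊗[F] A) (q r) :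
    coordMat b J s q r = (b.baseChange R).repr (s r) (J q) := rfl

lemma coordMat_bcHom {R' : Type u} [CommRing R'] [Algebra F R'] (φ : R →ₐ[F] R')
    (J : Fin n → Fin (n ^ 2)) (s : Fin n → R ⊗[F] A) :
    coordMat b J (fun r => bcHom φ A (s r)) = (coordMat b J s).map φ := by
  ext q r
  exact repr_bcHom b φ (s r) (J q)

/-- A submodule contains a family whose coordinates with given indices are those of
the standard basis. -/
def Framed (J : Fin n → Fin (n ^ 2)) (N : Submodule R (R ⊗[F] A)) : Prop :=
  ∃ e : Fin n → R ⊗[F] A, (∀ r, e r ∈ N) ∧ coordMat b J e = 1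

lemma Framed.of_isUnit_det {J : Fin n → Fin (n ^ 2)} {N : Submodule R (R ⊗[F] A)}
    {s : Fin n → R ⊗[F] A} (hs : ∀ r, s r ∈ N) (hd : IsUnit (coordMat b J s).det) :
    Framed b J N := by
  refine ⟨fun r => ∑ i, (coordMat b J s)⁻¹ i r • s i,
    fun r => sum_mem fun i _ => N.smul_mem _ (hs i), ?_⟩
  rw [← Matrix.mul_nonsing_inv _ hd]
  ext q r
  rw [coordMat_apply, map_sum, Finsupp.finsetSum_apply, Matrix.mul_apply]
  refine Finset.sum_congr rfl fun i _ => ?_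
  rw [map_smul, Finsupp.smul_apply, smul_eq_mul, mul_comm, coordMat_apply]

/-- The projection to the span of a frame. -/
def frameProj (J : Fin n → Fin (n ^ 2)) (e : Fin n → R ⊗[F] A) : R ⊗[F] A →ₗ[R] R ⊗[F] A :=
  ∑ q, (LinearMap.toSpanSingleton R _ (e q)).comp ((b.baseChange R).coord (J q))

lemma frameProj_apply (J : Fin n → Fin (n ^ 2)) (e : Fin n → R ⊗[F] A) (s : R ⊗[F] A) :
    frameProj b J e s = ∑ q, (b.baseChange R).repr s (J q) • e q := by
  simp [frameProj]

lemma repr_frameProj {J : Fin n → Fin (n ^ 2)} {e : Fin n → R ⊗[F] A} (he : coordMat b J e = 1)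
    (s : R ⊗[F] A) (q : Fin n) :
    (b.baseChange R).repr (frameProj b J e s) (J q) = (b.baseChange R).repr s (J q) := by
  rw [frameProj_apply, map_sum, Finsupp.finsetSum_apply, Finset.sum_eq_single q]
  · rw [map_smul, Finsupp.smul_apply, ← coordMat_apply b J e, he, Matrix.one_apply_eq, smul_eq_mul,
      mul_one]
  · intro r _ hr
    rw [map_smul, Finsupp.smul_apply, ← coordMat_apply b J e, he, Matrix.one_apply_ne' hr,
      smul_zero]
  · exact fun h => absurd (Finset.mem_univ _) h

include b in
lemma finrank_rightIdealPoint [IsLocalRing R] (N : RightIdealPoint F A n R) :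
    Module.Free R N.toSubmodule ∧ Module.Finite R N.toSubmodule ∧
      Module.finrank R N.toSubmodule = n := by
  have : FiniteDimensional F A := Module.Finite.of_basis b
  have h1 := rankAtStalk_grassmannian N.toGrassmannian (IsLocalRing.closedPoint R)
  have hfree : Module.Free R N.toSubmodule := by
    have hp : Module.Projective R N.toSubmodule := inferInstance
    have hf : Module.Flat R N.toSubmodule := @Module.Flat.of_projective _ _ _ _ _ hp
    exact @Module.free_of_flat_of_isLocalRing _ _ _ _ _ _ _ hf
  refine ⟨hfree, inferInstance, ?_⟩
  rw [Module.rankAtStalk_eq_finrank_of_free, Module.finrank_baseChange,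
    Module.finrank_eq_card_basis b, Fintype.card_fin] at h1
  have h2 : n ≤ n ^ 2 := by
    rcases n with _ | n
    · exact le_rfl
    · exact Nat.le_self_pow two_ne_zero _
  simp only [Pi.natCast_apply, Nat.cast_id] at h1
  omega

/-- The frame makes the `n` coordinates map the free module `N` of rank `n` onto `R^n`, and a
surjection between free modules of equal finite rank is injective. -/
lemma eq_zero_of_framed [IsLocalRing R] (N : RightIdealPoint F A n R) {J : Fin n → Fin (n ^ 2)}
    (hJ : Framed b J N.toSubmodule) {s : R ⊗[F] A} (hs : s ∈ N.toSubmodule)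
    (h0 : ∀ q, (b.baseChange R).repr s (J q) = 0) : s = 0 := by
  obtain ⟨hfree, hfin, hrank⟩ := finrank_rightIdealPoint b N
  obtain ⟨e, he, hJ⟩ := hJ
  let B : Module.Basis (Fin n) R N.toSubmodule := Module.finBasisOfFinrankEq R _ hrank
  let π : N.toSubmodule →ₗ[R] (Fin n → R) :=
    LinearMap.pi fun q => ((b.baseChange R).coord (J q)).comp N.toSubmodule.subtype
  have hπ : Function.Surjective π := fun v => ⟨∑ r, v r • ⟨e r, he r⟩, by
    ext q
    have h (r) : π ⟨e r, he r⟩ q = (1 : Matrix (Fin n) (Fin n) R) q r := by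
      rw [← hJ]; rfl
    rw [map_sum, Finset.sum_apply]
    simp only [map_smul, Pi.smul_apply, h, Matrix.one_apply]
    simp⟩
  have hinj : Function.Injective (π ∘ₗ B.equivFun.symm.toLinearMap) :=
    OrzechProperty.injective_of_surjective_endomorphism _ (hπ.comp B.equivFun.symm.surjective)
  have h1 : B.equivFun ⟨s, hs⟩ = 0 := hinj (by
    rw [map_zero]
    ext q
    simpa [π] using h0 q)
  have h2 := B.equivFun.map_eq_zero_iff.1 h1
  exact congr_arg Subtype.val h2

/-- A right ideal with a frame is a right ideal of reduced dimension one. -/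
def framedPoint (N : Submodule R (R ⊗[F] A)) (hN : ∀ x ∈ N, ∀ y : R ⊗[F] A, x * y ∈ N)
    {J : Fin n → Fin (n ^ 2)} (e : Fin n → R ⊗[F] A) (he : ∀ r, e r ∈ N) (hJ : coordMat b J e = 1)
    (h : ∀ s ∈ N, frameProj b J e s = s) : RightIdealPoint F A n R := by
  have hfin : FiniteDimensional F A := Module.Finite.of_basis b
  have hmem (s) : frameProj b J e s ∈ N := by
    rw [frameProj_apply]
    exact sum_mem fun q _ => N.smul_mem _ (he q)
  let σ : (R ⊗[F] A ⧸ N) →ₗ[R] R ⊗[F] A := N.liftQ (LinearMap.id - frameProj b J e) fun s hs => by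
    rw [LinearMap.mem_ker, LinearMap.sub_apply, h s hs, LinearMap.id_apply, sub_self]
  have hσ : N.mkQ ∘ₗ σ = LinearMap.id := by
    refine LinearMap.ext fun x => ?_
    obtain ⟨s, rfl⟩ := N.mkQ_surjective x
    change N.mkQ (s - frameProj b J e s) = N.mkQ s
    rw [map_sub, sub_eq_self, Submodule.mkQ_apply, Submodule.Quotient.mk_eq_zero]
    exact hmem s
  have hproj : Module.Projective R (R ⊗[F] A ⧸ N) := .of_split σ N.mkQ hσ
  -- The frame splits `R ⊗ A` as `R^n × (R ⊗ A) / N`, whence the rank of the quotient.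
  let E : R ⊗[F] A ≃ₗ[R] (Fin n → R) × (R ⊗[F] A ⧸ N) :=
    LinearEquiv.ofBijective ((LinearMap.pi fun q => (b.baseChange R).coord (J q)).prod N.mkQ) <| by
      constructor
      · rw [injective_iff_map_eq_zero]
        intro s hs
        simp only [LinearMap.prod_apply, Function.prod_apply, Prod.mk_eq_zero, Submodule.mkQ_apply,
          Submodule.Quotient.mk_eq_zero] at hs
        rw [← h s hs.2, frameProj_apply]
        refine Finset.sum_eq_zero fun q _ => ?_
        have := congr_fun hs.1 q
        rw [LinearMap.pi_apply, Module.Basis.coord_apply] at this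
        rw [this, Pi.zero_apply, zero_smul]
      · rintro ⟨v, q⟩
        obtain ⟨z, rfl⟩ := N.mkQ_surjective q
        refine ⟨∑ r, v r • e r + (z - frameProj b J e z), Prod.ext (funext fun q => ?_) ?_⟩
        · change (b.baseChange R).repr _ (J q) = v q
          rw [map_add, map_sub, Finsupp.add_apply, Finsupp.sub_apply, repr_frameProj b hJ, sub_self,
            add_zero, map_sum, Finsupp.finsetSum_apply]
          have hr (r : Fin n) : (b.baseChange R).repr (v r • e r) (J q) =
              v r * (1 : Matrix (Fin n) (Fin n) R) q r := by
            rw [map_smul, Finsupp.smul_apply, ← hJ]; rfl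
          rw [Finset.sum_congr rfl fun r _ => hr r]
          simp [Matrix.one_apply]
        · change N.mkQ _ = N.mkQ z
          rw [map_add, map_sub, (Submodule.Quotient.mk_eq_zero N).2 (hmem z) |> fun h =>
            (show N.mkQ _ = 0 from h), sub_zero, add_eq_right]
          exact (Submodule.Quotient.mk_eq_zero N).2 (sum_mem fun r _ => N.smul_mem _ (he r))
  exact
    { toSubmodule := N
      finite_quotient := inferInstance
      projective_quotient := hproj
      rankAtStalk_eq := fun p => by
        have : Nontrivial R := p.nontrivial
        have h1 := congr_fun (Module.rankAtStalk_eq_of_equiv E) p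
        rw [Module.rankAtStalk_prod, Module.rankAtStalk_eq_finrank_of_free, Pi.add_apply,
          Module.rankAtStalk_eq_finrank_of_free, Module.finrank_baseChange,
          Module.finrank_eq_card_basis b, Fintype.card_fin, Module.finrank_fin_fun] at h1
        simp only [Pi.natCast_apply, Nat.cast_id] at h1
        omega
      mul_mem := hN }

/-- Every right ideal of reduced dimension one over a field has a frame. -/
lemma exists_framed {k : Type u} [Field k] [Algebra F k] (N : RightIdealPoint F A n k) :
    ∃ J, Framed b J N.toSubmodule := by
  obtain ⟨-, hfin, hrank⟩ := finrank_rightIdealPoint b N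
  let B : Module.Basis (Fin n) k N.toSubmodule := Module.finBasisOfFinrankEq k _ hrank
  let l : (Fin n → k) →ₗ[k] (Fin (n ^ 2) → k) :=
    (b.baseChange k).equivFun.toLinearMap ∘ₗ N.toSubmodule.subtype ∘ₗ B.equivFun.symm.toLinearMap
  have hl : Function.Injective l := (b.baseChange k).equivFun.injective.comp
    (N.toSubmodule.injective_subtype.comp B.equivFun.symm.injective)
  -- The coordinate matrix of a basis of `N` has a left inverse, so one of its `n × n` minors is
  -- nonzero.
  obtain ⟨g, hg⟩ := l.exists_leftInverse_of_injective (LinearMap.ker_eq_bot.2 hl)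
  have h1 : LinearMap.toMatrix' g * LinearMap.toMatrix' l = 1 := by
    rw [← LinearMap.toMatrix'_comp, hg, LinearMap.toMatrix'_id]
  obtain ⟨J, hJ⟩ := exists_submatrix_det_ne_zero h1
  refine ⟨J, Framed.of_isUnit_det b (s := fun r => (B r).1) (fun r => (B r).2)
    (isUnit_iff_ne_zero.2 ?_)⟩
  convert hJ using 2
  ext q r
  rw [coordMat_apply, Matrix.submatrix_apply, LinearMap.toMatrix'_apply]
  simp [l]

end Frame

/-! ### The Plücker charts -/

namespace SeveriBrauer

variable {F A : Type u} [Field F] [Ring A] [Algebra F A] {n : ℕ} {S : SeveriBrauer F A n}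
  (b : Module.Basis (Fin (n ^ 2)) F A) {J : Fin n → Fin (n ^ 2)}

lemma framed_res {U V : S.X.Opens} (h : V ≤ U) (hU : Framed b J (S.tautSections U)) :
    Framed b J (S.tautSections V) := by
  obtain ⟨e, he, hJ⟩ := hU
  refine ⟨fun r => bcHom (S.res h) A (e r), fun r => tautSections_res h (he r), ?_⟩
  rw [coordMat_bcHom, hJ, Matrix.map_one _ (map_zero _) (map_one _)]

/-- Stalkwise this is `eq_zero_of_framed`. As a consequence frames are unique, which allows them to
be glued. -/
lemma eq_zero_of_coord_eq_zero {U : S.X.Opens} (hU : Framed b J (S.tautSections U))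
    {s : Γ(S.X, U) ⊗[F] A} (hs : s ∈ S.tautSections U)
    (h0 : ∀ q, (b.baseChange Γ(S.X, U)).repr s (J q) = 0) : s = 0 := by
  refine S.tensor_section_ext fun x hx => ?_
  rw [map_zero]
  obtain ⟨e, he, hJ⟩ := hU
  refine eq_zero_of_framed b (S.points (S.X.presheaf.stalk x)
    ⟨S.X.fromSpecStalk x, S.fromSpecStalk_structMap x⟩)
    (J := J) ⟨fun r => bcHom (S.germ x hx) A (e r), fun r => he r x hx, ?_⟩ (hs x hx) fun q => ?_
  · rw [coordMat_bcHom, hJ, Matrix.map_one _ (map_zero _) (map_one _)]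
  · rw [repr_bcHom, h0, map_zero]

lemma frameProj_mem {U : S.X.Opens} {e : Fin n → Γ(S.X, U) ⊗[F] A}
    (he : ∀ r, e r ∈ S.tautSections U) (s : Γ(S.X, U) ⊗[F] A) :
    frameProj b J e s ∈ S.tautSections U := by
  rw [frameProj_apply]
  exact sum_mem fun q _ => Submodule.smul_mem _ _ (he q)

lemma frameProj_eq {U : S.X.Opens} {e : Fin n → Γ(S.X, U) ⊗[F] A}
    (he : ∀ r, e r ∈ S.tautSections U) (hJ : coordMat b J e = 1)
    {s : Γ(S.X, U) ⊗[F] A} (hs : s ∈ S.tautSections U) : frameProj b J e s = s := by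
  rw [← sub_eq_zero]
  refine eq_zero_of_coord_eq_zero b ⟨e, he, hJ⟩ (sub_mem (frameProj_mem b he s) hs) fun q => ?_
  rw [map_sub, Finsupp.sub_apply, repr_frameProj b hJ, sub_self]

variable (S J) in
/-- The largest open subset over which the tautological sheaf has a frame. -/
def chart : S.X.Opens := sSup {V | Framed b J (S.tautSections V)}

lemma le_chart {V : S.X.Opens} (h : Framed b J (S.tautSections V)) : V ≤ S.chart b J := le_sSup h

lemma coordMat_eq_one_of_local {U : S.X.Opens} {e : Fin n → Γ(S.X, U) ⊗[F] A}
    (h : ∀ p ∈ U, ∃ (V : S.X.Opens) (h : V ≤ U), p ∈ V ∧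
      coordMat b J (fun r => bcHom (S.res h) A (e r)) = 1) : coordMat b J e = 1 := by
  ext q r
  refine S.section_ext fun p hp => ?_
  obtain ⟨V, hV, hpV, h⟩ := h p hp
  rw [← S.germ_comp_res hV p hpV, AlgHom.comp_apply, AlgHom.comp_apply]
  change S.germ p hpV (((coordMat b J e).map (S.res hV)) q r) = _
  rw [coordMat_bcHom] at h
  rw [h, Matrix.one_apply, Matrix.one_apply]
  split_ifs
  · rw [map_one, map_one, map_one]
  · rw [map_zero, map_zero, map_zero]

variable (S J) in
lemma framed_chart [FiniteDimensional F A] : Framed b J (S.tautSections (S.chart b J)) := by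
  let I := {V : S.X.Opens // Framed b J (S.tautSections V)}
  choose e he hJ using fun V : I => V.2
  have hle (V : I) : V.1 ≤ S.chart b J := le_chart b V.2
  have hcov {p : S.X} (hp : p ∈ S.chart b J) : ∃ V : I, p ∈ V.1 := by
    rw [chart, Opens.mem_sSup] at hp
    obtain ⟨V, hV, hp⟩ := hp
    exact ⟨⟨V, hV⟩, hp⟩
  have hg (r : Fin n) := TopCat.Sheaf.existsUnique_gluing' ⟨S.taut.presheaf, S.taut.isSheaf⟩
    (fun V : I => V.1) (S.chart b J) (fun V => homOfLE (hle V))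
    (fun p hp => by
      obtain ⟨V, hV⟩ := hcov hp
      exact Opens.mem_iSup.2 ⟨V, hV⟩)
    (fun V => tautSec (e V r) (he V r)) (fun V V' => by
      change mres S.taut inf_le_left _ = mres S.taut inf_le_right _
      refine tautVal_injective ?_
      rw [tautVal_mres, tautVal_mres, ← sub_eq_zero]
      refine eq_zero_of_coord_eq_zero b (framed_res b (inf_le_left : V.1 ⊓ V'.1 ≤ V.1) V.2)
        (sub_mem (tautSections_res _ (he V r)) (tautSections_res _ (he V' r))) fun q => ?_
      rw [map_sub, Finsupp.sub_apply, tautVal_tautSec, tautVal_tautSec, repr_bcHom, repr_bcHom,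
        ← coordMat_apply b J (e V), ← coordMat_apply b J (e V'), hJ, hJ, Matrix.one_apply,
        Matrix.one_apply]
      split_ifs
      · rw [map_one, map_one, sub_self]
      · rw [map_zero, map_zero, sub_self])
  choose g hg _ using hg
  refine ⟨fun r => tautVal (g r), fun r => tautVal_mem (g r), coordMat_eq_one_of_local b
    fun p hp => ?_⟩
  obtain ⟨V, hV⟩ := hcov hp
  refine ⟨V.1, hle V, hV, ?_⟩
  rw [← hJ V]
  congr 1
  funext r
  exact congr_arg tautVal (hg r V)

variable (S J) in
/-- The frame over a chart. -/
def frame [FiniteDimensional F A] : Fin n → Γ(S.X, S.chart b J) ⊗[F] A := (S.framed_chart b J).choose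

lemma frame_mem [FiniteDimensional F A] (r : Fin n) :
    S.frame b J r ∈ S.tautSections (S.chart b J) := (S.framed_chart b J).choose_spec.1 r

lemma coordMat_frame [FiniteDimensional F A] : coordMat b J (S.frame b J) = 1 :=
  (S.framed_chart b J).choose_spec.2

/-- Points at which the right ideal has a frame after an extension of the residue field lie
in the chart. -/
lemma mem_chart_of_field (E : S.LeftId) {W : S.X.Opens} (hW : IsAffineOpen W) {k : Type u} [Field k]
    [Algebra F k] (φ : Γ(S.X, W) →ₐ[F] k) {x : S.X}
    (hx : ∀ f, φ f ≠ 0 → x ∈ S.X.basicOpen f)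
    (h : Framed b J (Module.Grassmannian.map φ (S.idealOn hW).toGrassmannian).toSubmodule) :
    x ∈ S.chart b J := by
  obtain ⟨s, hs, hJ⟩ := h
  let M := (lmR b (E.e hW)).map φ
  have h1 (r) : M.mulVec ((b.baseChange k).repr (s r)) = (b.baseChange k).repr (s r) := by
    have := (mem_map_iff φ _ (E.mem hW) (E.mul_eq hW) (S.idealOn hW).mul_mem (s r)).1 (hs r)
    simp only [M]
    rw [← lmR_bcHom, lmR_mulVec_repr, this]
  -- `M` fixes the frame over `k`, so its rows `J` times the frame give the identity, and a minor of
  -- these rows, with columns `I`, is nonzero in `k`. It is the value of a minor `f` over `W`; where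
  -- `f` is invertible, the elements `e * b (I i)` yield a frame.
  have h2 : M.submatrix J id * Matrix.of (fun i r => (b.baseChange k).repr (s r) i) = 1 := by
    rw [← hJ]
    ext q r
    exact congr_fun (h1 r) (J q)
  obtain ⟨I, hI⟩ := exists_submatrix_det_ne_zero' h2
  let f : Γ(S.X, W) := ((lmR b (E.e hW)).submatrix J I).det
  have hf : φ f ≠ 0 := by
    rw [AlgHom.map_det]
    exact hI
  have hV : S.X.basicOpen f ≤ W := S.X.basicOpen_le f
  refine le_chart b ?_ (hx f hf)
  refine Framed.of_isUnit_det b (s := fun i => bcHom (S.res hV) A (E.e hW) *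
    b.baseChange _ (I i)) (fun i => tautSections_mul_mem (E.res_e_mem hW hV) _) ?_
  have h3 : coordMat b J (fun i => bcHom (S.res hV) A (E.e hW) * b.baseChange _ (I i)) =
      ((lmR b (E.e hW)).submatrix J I).map (S.res hV) := by
    ext q i
    rw [coordMat_apply, ← Algebra.leftMulMatrix_eq_repr_mul]
    exact congr_fun (congr_fun (lmR_bcHom b (S.res hV) (E.e hW)) (J q)) (I i)
  rw [h3]
  have hu : IsUnit (S.res hV f) := RingedSpace.isUnit_res_basicOpen _ f
  rw [AlgHom.map_det] at hu
  exact hu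

/-- The charts cover the Severi-Brauer variety. -/
lemma exists_mem_chart (E : S.LeftId) (x : S.X) : ∃ J, x ∈ S.chart b J := by
  obtain ⟨W, -, hxW, hW⟩ := exists_affine_le ⊤ x trivial
  -- Over the residue field the ideal is a vector space of dimension `n`, on which some `n`
  -- coordinates are independent.
  let k := IsLocalRing.ResidueField (S.X.presheaf.stalk x)
  let _ : Algebra F k := ((algebraMap (S.X.presheaf.stalk x) k).comp
    (algebraMap F (S.X.presheaf.stalk x))).toAlgebra
  let π : S.X.presheaf.stalk x →ₐ[F] k :=
    { __ := algebraMap (S.X.presheaf.stalk x) k, commutes' := fun _ => rfl }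
  let φ : Γ(S.X, W) →ₐ[F] k := π.comp (S.germ x hxW)
  let N : RightIdealPoint F A n k :=
    { __ := Module.Grassmannian.map φ (S.idealOn hW).toGrassmannian
      mul_mem := fun y hy z => by
        have key (s) := mem_map_iff φ _ (E.mem hW) (E.mul_eq hW) (S.idealOn hW).mul_mem s
        rw [key] at hy ⊢
        rw [← mul_assoc, hy] }
  obtain ⟨J, hJ⟩ := exists_framed b N
  refine ⟨J, mem_chart_of_field b E hW φ (fun f hf => ?_) hJ⟩
  rw [Scheme.mem_basicOpen _ _ _ hxW]
  by_contra hu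
  exact hf ((IsLocalRing.residue_eq_zero_iff _).2 ((IsLocalRing.mem_maximalIdeal _).2 hu))

end SeveriBrauer
end SB

end

/-! ### Affineness of the charts -/

noncomputable section
set_option linter.unusedVariables false
namespace SB

/-- An open subset `V` is affine as soon as its canonical morphism to `Spec Γ(X, V)` has
an inverse over the affine open subsets of `V`. -/
lemma isAffineOpen_of_section {X : Scheme.{u}} {V : X.Opens} (g : Spec Γ(X, V) ⟶ X)
    (hg : ∀ (W : X.Opens) (hW : IsAffineOpen W) (h : W ≤ V),
      Spec.map (X.presheaf.map (homOfLE h).op) ≫ g = hW.fromSpec)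
    (hV : ∀ y, g y ∈ V) : IsAffineOpen V := by
  let 𝒰 : V.toScheme.OpenCover := .mkOfCovers {W : X.Opens // IsAffineOpen W ∧ W ≤ V}
    (fun W => W.1.toScheme) (fun W => X.homOfLE W.2.2) (fun x => by
      obtain ⟨W, hWV, hxW, hW⟩ := exists_affine_le V x.1 x.2
      exact ⟨⟨W, hW, hWV⟩, ⟨x.1, hxW⟩, X.homOfLE_apply' hWV x.1 hxW⟩)
    fun W => inferInstance
  have h1 : V.toSpecΓ ≫ g = V.ι := by
    refine 𝒰.hom_ext _ _ fun W => ?_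
    change X.homOfLE W.2.2 ≫ _ = X.homOfLE W.2.2 ≫ _
    rw [← Category.assoc, ← Scheme.Opens.toSpecΓ_SpecMap_presheaf_map, Category.assoc,
      hg W.1 W.2.1 W.2.2, IsAffineOpen.toSpecΓ_fromSpec, Scheme.homOfLE_ι]
  have hr : Set.range g ⊆ Set.range V.ι := by
    rw [Scheme.Opens.range_ι]
    rintro _ ⟨y, rfl⟩
    exact hV y
  let g' := IsOpenImmersion.lift V.ι g hr
  have hg' : g' ≫ V.ι = g := IsOpenImmersion.lift_fac _ _ _
  have h2 : V.toSpecΓ ≫ g' = 𝟙 _ := by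
    rw [← cancel_mono V.ι, Category.assoc, hg', h1, Category.id_comp]
  -- `V.toSpecΓ` is an isomorphism on global sections, so a one-sided inverse is two-sided there;
  -- morphisms into an affine scheme are determined by their effect on global sections.
  have h3 : g' ≫ V.toSpecΓ = 𝟙 _ := by
    refine ext_of_isAffine ?_
    have h4 := congr_arg Scheme.Hom.appTop h2
    rw [Scheme.Hom.comp_appTop, Scheme.Hom.id_appTop] at h4
    have : IsIso V.toSpecΓ.appTop := by
      rw [Scheme.Opens.toSpecΓ_appTop]
      infer_instance
    rw [Scheme.Hom.comp_appTop, Scheme.Hom.id_appTop, ← cancel_mono V.toSpecΓ.appTop,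
      Category.assoc, h4, Category.comp_id, Category.id_comp]
  have : IsIso V.toSpecΓ := ⟨g', h2, h3⟩
  exact IsAffine.of_isIso V.toSpecΓ

/-- The right ideals of reduced dimension one have left identities. -/
def HasLeftIds (F A : Type u) [Field F] [Ring A] [Algebra F A] (n : ℕ) : Prop :=
  ∀ (R : Type u) [CommRing R] [Algebra F R] (N : RightIdealPoint F A n R),
    ∃ e ∈ N.toSubmodule, ∀ x ∈ N.toSubmodule, e * x = x

lemma hasLeftIds {F A : Type u} [Field F] [Ring A] [Algebra F A] {n : ℕ} {K : Type u} [Field K]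
    [Algebra F K] [NeZero n] (ρ : A →ₐ[F] Matrix (Fin n) (Fin n) K)
    (b : Module.Basis (Fin (n ^ 2)) F A) (hρ : LinearIndependent K fun i => ρ (b i)) :
    HasLeftIds F A n := by
  obtain ⟨θ, h1, h2⟩ := exists_separability ρ b hρ
  exact fun R _ _ N => exists_left_identity h1 h2 N.toSubmodule N.mul_mem

namespace SeveriBrauer

variable {F A : Type u} [Field F] [Ring A] [Algebra F A] {n : ℕ} {S : SeveriBrauer F A n}
  (b : Module.Basis (Fin (n ^ 2)) F A) {J : Fin n → Fin (n ^ 2)}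

lemma framed_map (hid : HasLeftIds F A n) {R R' : Type u} [CommRing R] [Algebra F R] [CommRing R']
    [Algebra F R'] (φ : R →ₐ[F] R') (N : RightIdealPoint F A n R) (hN : Framed b J N.toSubmodule) :
    Framed b J (Module.Grassmannian.map φ N.toGrassmannian).toSubmodule := by
  obtain ⟨ε, hε, hε'⟩ := hid R N
  obtain ⟨e, he, hJ⟩ := hN
  refine ⟨fun r => bcHom φ A (e r), fun r => ?_, ?_⟩
  · rw [mem_map_iff φ _ hε hε' N.mul_mem, ← map_mul, hε' _ (he r)]
  · rw [coordMat_bcHom, hJ, Matrix.map_one _ (map_zero _) (map_one _)]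

/-- Points with a framed right ideal factor through the chart. -/
lemma mem_chart_of_point (hid : HasLeftIds F A n) (E : S.LeftId) {R : Type u} [CommRing R]
    [Algebra F R] (g : {f : Spec (CommRingCat.of R) ⟶ S.X //
      f ≫ S.structMap = Spec.map (CommRingCat.ofHom (algebraMap F R))})
    (hg : Framed b J (S.points R g).toSubmodule) (y : Spec (CommRingCat.of R)) :
    g.1 y ∈ S.chart b J := by
  -- The question is reduced to the residue field `k` of `y`, where the point factors through an
  -- affine open subset `W`. Naturality along `R → k` and along `Γ(X, W) → k` identifies the two
  -- base changes, so the frame over `R` gives one over `k` for the ideal of `W`.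
  let p : PrimeSpectrum R := y
  let k := p.asIdeal.ResidueField
  let _ : Algebra F k := ((algebraMap R k).comp (algebraMap F R)).toAlgebra
  let ψ : R →ₐ[F] k := { __ := algebraMap R k, commutes' := fun _ => rfl }
  let pt : PrimeSpectrum k := ⊥
  have hpt : Spec.map (CommRingCat.ofHom ψ.toRingHom) pt = y := by
    refine PrimeSpectrum.ext (?_ : Ideal.comap (algebraMap R k) ⊥ = p.asIdeal)
    exact Ideal.ker_algebraMap_residueField p.asIdeal
  let f : Spec (CommRingCat.of k) ⟶ S.X := Spec.map (CommRingCat.ofHom ψ.toRingHom) ≫ g.1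
  have hf : f ≫ S.structMap = Spec.map (CommRingCat.ofHom (algebraMap F k)) := by
    rw [Category.assoc, g.2, ← Spec.map_comp]
    rfl
  have hfpt : f pt = g.1 y := by rw [← hpt]; rfl
  obtain ⟨W, -, hxW, hW⟩ := exists_affine_le ⊤ (g.1 y) trivial
  have hr : Set.range f ⊆ Set.range hW.fromSpec := by
    rw [hW.range_fromSpec]
    rintro _ ⟨q, rfl⟩
    have : q = pt := Subsingleton.elim (α := PrimeSpectrum k) q pt
    rw [this, hfpt]
    exact hxW
  let l := IsOpenImmersion.lift hW.fromSpec f hr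
  have hl : l ≫ hW.fromSpec = f := IsOpenImmersion.lift_fac _ _ _
  let φ₀ := Spec.preimage l
  have hφ₀ : Spec.map φ₀ = l := Spec.map_preimage l
  have hφ : CommRingCat.ofHom (algebraMap F Γ(S.X, W)) ≫ φ₀ =
      CommRingCat.ofHom (algebraMap F k) := by
    apply Spec.map_injective
    rw [Spec.map_comp, hφ₀, ← hf, ← hl, Category.assoc, S.fromSpec_structMap hW]
  let φ : Γ(S.X, W) →ₐ[F] k := { __ := φ₀.hom, commutes' := fun a => congr($hφ a) }
  have hφl : Spec.map (CommRingCat.ofHom φ.toRingHom) = l := hφ₀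
  have hφf : Spec.map (CommRingCat.ofHom φ.toRingHom) ≫ hW.fromSpec = f := by rw [hφl, hl]
  refine mem_chart_of_field b E hW φ (fun a ha => ?_) ?_
  · rw [← hfpt, ← hφf]
    change Spec.map (CommRingCat.ofHom φ.toRingHom) pt ∈ hW.fromSpec ⁻¹ᵁ S.X.basicOpen a
    rw [hW.fromSpec_preimage_basicOpen]
    exact ha
  · have h1 := S.points_map φ hW.fromSpec (S.fromSpec_structMap hW) (by rw [hφf, hf])
    have h2 := S.points_map ψ g.1 g.2 hf
    have h3 : S.points k ⟨Spec.map (CommRingCat.ofHom φ.toRingHom) ≫ hW.fromSpec,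
        by rw [hφf, hf]⟩ = S.points k ⟨f, hf⟩ := congr_arg _ (Subtype.ext hφf)
    rw [h3] at h1
    have h4 := framed_map b hid ψ _ hg
    rw [idealOn, ← h1]
    change Framed b J (S.points k ⟨f, hf⟩).toGrassmannian.toSubmodule
    exact h2 ▸ h4

variable (S J) in
/-- The charts are affine. -/
theorem isAffineOpen_chart [FiniteDimensional F A] (hid : HasLeftIds F A n) (E : S.LeftId) :
    IsAffineOpen (S.chart b J) := by
  -- The tautological sections over the chart form a right ideal of reduced dimension one, hence
  -- define a morphism to `X` from the spectrum of the functions on the chart. It is the candidate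
  -- inverse: over affine open subsets the ideals are compared, and the frame makes it land in the
  -- chart.
  let N := framedPoint b (S.tautSections (S.chart b J)) (fun x hx y => tautSections_mul_mem hx y)
    (S.frame b J) (frame_mem b) (coordMat_frame b) fun s hs =>
      frameProj_eq b (frame_mem b) (coordMat_frame b) hs
  let g := (S.points Γ(S.X, S.chart b J)).symm N
  have hg : S.points Γ(S.X, S.chart b J) g = N := Equiv.apply_symm_apply _ _
  have hN : N.toSubmodule = S.tautSections (S.chart b J) := rfl
  obtain ⟨ε, hε, hε'⟩ := hid _ N
  refine isAffineOpen_of_section g.1 (fun W hW h => ?_) fun y => ?_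
  · have hs : (Spec.map (CommRingCat.ofHom (S.res h).toRingHom) ≫ g.1) ≫ S.structMap =
        Spec.map (CommRingCat.ofHom (algebraMap F Γ(S.X, W))) := by
      rw [Category.assoc, g.2, ← Spec.map_comp, ← CommRingCat.ofHom_comp]
      congr 2
      exact (S.res h).comp_algebraMap
    have h1 := S.points_map (S.res h) g.1 g.2 hs
    have h2 : S.points Γ(S.X, W) ⟨_, hs⟩ = S.idealOn hW := by
      have h3 : ((S.points Γ(S.X, W) ⟨_, hs⟩).toGrassmannian) = (S.idealOn hW).toGrassmannian := by
        refine Module.Grassmannian.ext (Submodule.ext fun s => ?_)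
        rw [h1]
        change s ∈ (Module.Grassmannian.map (S.res h) (S.points _ g).toGrassmannian).toSubmodule ↔ _
        rw [hg, mem_map_iff _ _ hε hε' N.mul_mem]
        -- Two right ideals with left identities coincide once each identity absorbs the other; `h5`
        -- and `h6` are the two absorptions.
        have h4 : bcHom (S.res h) A ε ∈ S.tautSections W := tautSections_res h hε
        have h5 : E.e hW * bcHom (S.res h) A ε = bcHom (S.res h) A ε := by
          have := (E.mem_tautSections hW le_rfl _).1 h4
          rw [S.res_refl] at this
          simpa [bcHom] using this
        have h6 : bcHom (S.res h) A ε * E.e hW = E.e hW := by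
          have h7 := frameProj_eq b (e := fun r => bcHom (S.res h) A (S.frame b J r))
            (fun r => tautSections_res h (frame_mem b r)) (by
              rw [coordMat_bcHom, coordMat_frame, Matrix.map_one _ (map_zero _) (map_one _)])
            (E.e_mem hW)
          rw [← h7, frameProj_apply, Finset.mul_sum]
          refine Finset.sum_congr rfl fun q _ => ?_
          rw [mul_smul_comm, ← map_mul, hε' _ (frame_mem b q)]
        constructor
        · intro hs
          rw [← hs, ← h5, mul_assoc]
          exact (S.idealOn hW).mul_mem _ (E.mem hW) _
        · intro hs
          rw [← E.mul_eq hW s hs, ← mul_assoc, h6]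
      revert h3
      generalize S.points Γ(S.X, W) ⟨_, hs⟩ = a
      generalize S.idealOn hW = c
      intro h3
      cases a; cases c
      congr
    exact congr_arg Subtype.val ((S.points Γ(S.X, W)).injective h2)
  · refine mem_chart_of_point b hid E g ?_ y
    rw [hg]
    exact S.framed_chart b J

end SeveriBrauer
end SB

end

noncomputable section
set_option linter.unusedVariables false
namespace SB

/-! ### Powers of minors as functionals on tensors -/

section MinorPow

variable {R : Type*} [CommRing R] {ι : Type*} [Fintype ι] [DecidableEq ι] {n k : ℕ}

variable (R) in
/-- The coefficients of a power of a minor of a matrix of `n` vectors, as a functional on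
tensors. -/
def minorCoef (J : Fin n → ι) (a : Fin k × Fin n → ι) : R :=
  ∏ c, (Matrix.of fun r s => if a (c, r) = J s then (1 : R) else 0).det

omit [Fintype ι] in
lemma map_minorCoef {R' : Type*} [CommRing R'] (φ : R →+* R') (J : Fin n → ι)
    (a : Fin k × Fin n → ι) : φ (minorCoef R J a) = minorCoef R' J a := by
  rw [minorCoef, map_prod, minorCoef]
  refine Finset.prod_congr rfl fun c _ => ?_
  rw [RingHom.map_det]
  congr 1
  ext r s
  simp only [RingHom.mapMatrix_apply, Matrix.map_apply, Matrix.of_apply]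
  split_ifs
  · exact map_one φ
  · exact map_zero φ

/-- A power of a minor, as a functional on tensors. -/
def minorFun (J : Fin n → ι) (t : (Fin k × Fin n → ι) → R) : R := ∑ a, minorCoef R J a * t a

lemma minorFun_add (J : Fin n → ι) (s t : (Fin k × Fin n → ι) → R) :
    minorFun J (s + t) = minorFun J s + minorFun J t := by
  simp only [minorFun, Pi.add_apply, mul_add, Finset.sum_add_distrib]

lemma minorFun_smul {R₀ : Type*} [CommRing R₀] [Algebra R₀ R] (J : Fin n → ι) (r : R₀)
    (t : (Fin k × Fin n → ι) → R) : minorFun J (r • t) = r • minorFun J t := by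
  simp only [minorFun, Pi.smul_apply, mul_smul_comm, Finset.smul_sum]

/-- On a pure tensor of `k * n` vectors, grouped in `k` blocks of `n`, the functional is the product
of the `J`-minors of the blocks. When all vectors are combinations of the `n` columns of `M`, each
block contributes one factor `det` of the rows `J` of `M`. -/
lemma minorFun_piMat_mulVec (J : Fin n → ι) (M : Matrix ι (Fin n) R)
    (τ : (Fin k × Fin n → Fin n) → R) :
    minorFun J ((piMat fun _ => M).mulVec τ) = (M.submatrix J id).det ^ k * minorFun id τ := by
  have key (q : Fin k × Fin n → Fin n) : ∑ a, minorCoef R J a * ∏ x, M (a x) (q x) =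
      (M.submatrix J id).det ^ k * minorCoef R id q := by
    rw [← (Equiv.curry (Fin k) (Fin n) ι).symm.sum_comp]
    simp only [minorCoef, Equiv.curry_symm_apply, Function.uncurry_apply_pair,
      Fintype.prod_prod_type, ← Finset.prod_mul_distrib]
    -- The sum over all multi-indices factors over the `k` blocks, and each factor is an instance of
    -- `det_mul_eq_sum`.
    rw [← Fintype.prod_sum (fun (c : Fin k) (a : Fin n → ι) =>
      (Matrix.of fun r s => if a r = J s then (1 : R) else 0).det * ∏ r, M (a r) (q (c, r)))]
    rw [← Fin.prod_const, ← Finset.prod_mul_distrib]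
    refine Finset.prod_congr rfl fun c _ => ?_
    have h1 := det_mul_eq_sum (Matrix.of fun (r : Fin n) (a : ι) => M a (q (c, r)))
      (Matrix.of fun (a : ι) (s : Fin n) => if a = J s then (1 : R) else 0)
    have h2 : (Matrix.of fun (r : Fin n) (a : ι) => M a (q (c, r))) *
        (Matrix.of fun (a : ι) (s : Fin n) => if a = J s then (1 : R) else 0) =
        (Matrix.of fun r s => if q (c, r) = id s then (1 : R) else 0) *
          (M.submatrix J id).transpose := by
      ext r s
      simp [Matrix.mul_apply]
    rw [h2, Matrix.det_mul, Matrix.det_transpose, mul_comm] at h1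
    rw [h1]
    exact Finset.sum_congr rfl fun a _ => mul_comm _ _
  simp only [minorFun, Matrix.mulVec, dotProduct, piMat_apply, Finset.mul_sum]
  rw [Finset.sum_comm]
  refine Finset.sum_congr rfl fun q _ => ?_
  simp only [← mul_assoc]
  rw [← Finset.sum_mul, key]

end MinorPow

/-! ### Plücker coordinates on the variety -/

namespace SeveriBrauer

variable {F A : Type u} [Field F] [Ring A] [Algebra F A] {n : ℕ} {S : SeveriBrauer F A n}
  (b : Module.Basis (Fin (n ^ 2)) F A) {J : Fin n → Fin (n ^ 2)}

/-- Change of frames. -/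
lemma coordMat_mul {U : S.X.Opens} {e : Fin n → Γ(S.X, U) ⊗[F] A}
    (he : ∀ r, e r ∈ S.tautSections U) (hJ : coordMat b J e = 1) {s : Fin n → Γ(S.X, U) ⊗[F] A}
    (hs : ∀ r, s r ∈ S.tautSections U) (L : Fin n → Fin (n ^ 2)) :
    coordMat b L s = coordMat b L e * coordMat b J s := by
  ext q r
  rw [coordMat_apply, ← frameProj_eq b he hJ (hs r), frameProj_apply, map_sum,
    Finsupp.finsetSum_apply, Matrix.mul_apply]
  refine Finset.sum_congr rfl fun p _ => ?_
  rw [map_smul, Finsupp.smul_apply, smul_eq_mul, mul_comm]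
  rfl

variable [FiniteDimensional F A]

lemma coordMat_res_frame {U : S.X.Opens} (h : U ≤ S.chart b J) :
    coordMat b J (fun r => bcHom (S.res h) A (S.frame b J r)) = 1 := by
  rw [coordMat_bcHom, coordMat_frame, Matrix.map_one _ (map_zero _) (map_one _)]

omit [FiniteDimensional F A] in
lemma fres_det_coordMat {U V : S.X.Opens} (h : V ≤ U) (L : Fin n → Fin (n ^ 2))
    (s : Fin n → Γ(S.X, U) ⊗[F] A) : fres h (coordMat b L s).det =
      (coordMat b L fun r => bcHom (S.res h) A (s r)).det := by
  rw [coordMat_bcHom]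
  exact AlgHom.map_det (S.res h) _

/-- Determinants are multiplicative, applied to the change of frames in `coordMat_mul`. -/
lemma det_coordMat_cocycle {U : S.X.Opens} {I J : Fin n → Fin (n ^ 2)} (hI : U ≤ S.chart b I)
    (hJ : U ≤ S.chart b J) (L : Fin n → Fin (n ^ 2)) :
    fres hI (coordMat b J (S.frame b I)).det * fres hJ (coordMat b L (S.frame b J)).det =
      fres hI (coordMat b L (S.frame b I)).det := by
  rw [fres_det_coordMat, fres_det_coordMat, fres_det_coordMat, mul_comm, ← Matrix.det_mul,
    ← coordMat_mul b (fun r => tautSections_res hJ (frame_mem b r)) (coordMat_res_frame b hJ)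
      (fun r => tautSections_res hI (frame_mem b r))]

/-- Where the `J`-minor of the `I`-frame is invertible, that frame can be normalised to a `J`-frame.
Conversely, on the overlap the two minors are inverse to each other by the cocycle relation. -/
lemma basicOpen_det_coordMat (I J : Fin n → Fin (n ^ 2)) :
    S.X.basicOpen (coordMat b J (S.frame b I)).det = S.chart b I ⊓ S.chart b J := by
  refine le_antisymm (le_inf (S.X.basicOpen_le _) (le_chart b ?_)) ?_
  · have hle := S.X.basicOpen_le (coordMat b J (S.frame b I)).det
    refine Framed.of_isUnit_det b (s := fun r => bcHom (S.res hle) A (S.frame b I r))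
      (fun r => tautSections_res hle (frame_mem b r)) ?_
    rw [← fres_det_coordMat]
    exact RingedSpace.isUnit_res_basicOpen _ _
  · have h1 := det_coordMat_cocycle b (inf_le_left : S.chart b I ⊓ S.chart b J ≤ _) inf_le_right I
    rw [coordMat_frame, Matrix.det_one, map_one] at h1
    have h2 := S.X.basicOpen_of_isUnit (IsUnit.of_mul_eq_one _ h1)
    have h3 := S.X.basicOpen_res (coordMat b J (S.frame b I)).det
      (homOfLE (inf_le_left : S.chart b I ⊓ S.chart b J ≤ _)).op
    refine le_trans (le_of_eq ?_) (inf_le_right : S.chart b I ⊓ S.chart b J ⊓ _ ≤ _)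
    rw [← h3]
    exact h2.symm

variable (S) in
/-- The charts of a Severi-Brauer variety. -/
def charts (hid : HasLeftIds F A n) (E : S.LeftId) : Charts S.X where
  ι := Fin n → Fin (n ^ 2)
  fin := inferInstance
  V J := S.chart b J
  affine J := S.isAffineOpen_chart b J hid E
  cover := top_le_iff.1 fun x _ => Opens.mem_iSup.2 (exists_mem_chart b E x)
  d I J := (coordMat b J (S.frame b I)).det
  basicOpen_d := basicOpen_det_coordMat b
  d_self I := by rw [coordMat_frame, Matrix.det_one]
  cocycle I J L := det_coordMat_cocycle b _ _ L

section Twists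

variable (K : Type u) [Field K] [Algebra F K] {k : ℕ}

/-- The coordinates of a frame, as a matrix of functions. -/
def frameMat {U : S.X.Opens} (e : Fin n → Γ(S.X, U) ⊗[F] A) :
    Matrix (Fin (n ^ 2)) (Fin n) (S.GK K U) :=
  .of fun i r => algebraMap _ _ ((b.baseChange _).repr (e r) i)

omit [FiniteDimensional F A] in
lemma det_frameMat_submatrix {U : S.X.Opens} (e : Fin n → Γ(S.X, U) ⊗[F] A) (L : Fin n → Fin (n ^ 2)) :
    ((frameMat b K e).submatrix L id).det = algebraMap _ (S.GK K U) (coordMat b L e).det := by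
  rw [RingHom.map_det]
  rfl

-- The columns of the idempotent matrix are the coordinates of the sections `e * b c` of `ℐ`, which
-- the frame recovers from their `J`-coordinates.
omit [FiniteDimensional F A] in
lemma lmSys_eq_frameMat_mul (E : S.LeftId) {W : S.X.Opens} (hW : IsAffineOpen W)
    {e : Fin n → Γ(S.X, W) ⊗[F] A} (he : ∀ r, e r ∈ S.tautSections W) (hJ : coordMat b J e = 1) :
    (E.lmSys K b).p hW = frameMat b K e * ((E.lmSys K b).p hW).submatrix J id := by
  have h (i c) : lmR b (E.e hW) i c = ∑ q, (b.baseChange _).repr (e q) i * lmR b (E.e hW) (J q) c := by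
    have h1 (i) : lmR b (E.e hW) i c = (b.baseChange _).repr (E.e hW * b.baseChange _ c) i :=
      Algebra.leftMulMatrix_eq_repr_mul _ _ _ _
    have h2 := frameProj_eq b he hJ (tautSections_mul_mem (E.e_mem hW) (b.baseChange _ c))
    simp only [h1]
    rw [frameProj_apply] at h2
    conv_lhs => rw [← h2, map_sum, Finsupp.finsetSum_apply]
    refine Finset.sum_congr rfl fun q _ => ?_
    rw [map_smul, Finsupp.smul_apply, smul_eq_mul, mul_comm]
  ext i c
  rw [Matrix.mul_apply]
  change algebraMap _ (S.GK K W) (lmR b (E.e hW) i c) = _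
  rw [h, map_sum]
  exact Finset.sum_congr rfl fun q _ => map_mul _ _ _

omit [FiniteDimensional F A] in
lemma lmSys_mul_frameMat (E : S.LeftId) {W : S.X.Opens} (hW : IsAffineOpen W)
    {e : Fin n → Γ(S.X, W) ⊗[F] A} (he : ∀ r, e r ∈ S.tautSections W) :
    (E.lmSys K b).p hW * frameMat b K e = frameMat b K e := by
  ext i r
  have h1 : E.e hW * e r = e r := by
    have := (E.mem_tautSections hW le_rfl _).1 (he r)
    rw [S.res_refl] at this
    simpa [bcHom] using this
  have h2 := congr_fun (lmR_mulVec_repr b (E.e hW) (e r)) i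
  rw [h1] at h2
  rw [Matrix.mul_apply]
  change _ = algebraMap _ (S.GK K W) ((b.baseChange _).repr (e r) i)
  rw [← h2, Matrix.mulVec, dotProduct, map_sum]
  exact Finset.sum_congr rfl fun q _ => (map_mul
    (algebraMap Γ(S.X, W) (S.GK K W)) (lmR b (E.e hW) i q) ((b.baseChange _).repr (e r) q)).symm

omit [FiniteDimensional F A] in
/-- Tensors in terms of a frame. -/
lemma eq_piMat_frameMat_mulVec (E : S.LeftId) {W : S.X.Opens} (hW : IsAffineOpen W)
    {e : Fin n → Γ(S.X, W) ⊗[F] A} (he : ∀ r, e r ∈ S.tautSections W) (hJ : coordMat b J e = 1)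
    {T : Type} [Fintype T] [DecidableEq T]
    (t : (T → Fin (n ^ 2)) → S.GK K W) (ht : t ∈ ((E.lmSys K b).pow T).sub.carrier W) :
    ∃ τ, t = (piMat fun _ : T => frameMat b K e).mulVec τ := by
  refine ⟨(piMat fun _ : T => ((E.lmSys K b).p hW).submatrix J id).mulVec t, ?_⟩
  rw [Matrix.mulVec_mulVec, piMat_mul, ← lmSys_eq_frameMat_mul b K E hW he hJ]
  exact ((ProjSys.mem_iff_self _ hW t).1 ht).symm

omit [FiniteDimensional F A] in
lemma resK_minorFun {U V : S.X.Opens} (h : V ≤ U) (J : Fin n → Fin (n ^ 2))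
    (t : (Fin k × Fin n → Fin (n ^ 2)) → S.GK K U) :
    S.resK K h (minorFun J t) = minorFun J (vres h t) := by
  rw [minorFun, map_sum, minorFun]
  refine Finset.sum_congr rfl fun a _ => ?_
  rw [map_mul, vres_apply]
  congr 1
  exact map_minorCoef (S.resK K h).toRingHom J a

/-- Locally `t` is the image of a tensor `τ` under the `I`-frame, so each functional is a power of a
minor of that frame times the same function of `τ`; the `I`-minor is `1`. -/
lemma minorFun_eq (E : S.LeftId) (I J : Fin n → Fin (n ^ 2)) {U : S.X.Opens} (h : U ≤ S.chart b I)
    (t : (Fin k × Fin n → Fin (n ^ 2)) → S.GK K U)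
    (ht : t ∈ ((E.lmSys K b).pow (Fin k × Fin n)).sub.carrier U) :
    minorFun J t = fres h (coordMat b J (S.frame b I)).det ^ k • minorFun I t := by
  refine GK_ext fun p hp => ?_
  obtain ⟨W, hWU, hpW, hW⟩ := exists_affine_le U p hp
  refine ⟨W, hWU, hpW, ?_⟩
  have he (r) := tautSections_res (hWU.trans h) (frame_mem (S := S) (J := I) b r)
  obtain ⟨τ, hτ⟩ := eq_piMat_frameMat_mulVec b K E hW he (coordMat_res_frame b (hWU.trans h))
    (vres hWU t) (LocSub.res_mem _ hWU ht)
  rw [resK_smul, map_pow, fres_fres, resK_minorFun, resK_minorFun, hτ, minorFun_piMat_mulVec,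
    minorFun_piMat_mulVec, det_frameMat_submatrix, det_frameMat_submatrix,
    coordMat_res_frame b (hWU.trans h), Matrix.det_one, map_one, one_pow, one_mul,
    ← fres_det_coordMat, ← map_pow, Algebra.smul_def]

lemma exists_minorFun_eq_one (E : S.LeftId) {W : S.X.Opens} (hW : IsAffineOpen W)
    (h : W ≤ S.chart b J) :
    ∃ t ∈ ((E.lmSys K b).pow (Fin k × Fin n)).sub.carrier W, minorFun J t = 1 := by
  have he (r) := tautSections_res h (frame_mem (S := S) (J := J) b r)
  let M := frameMat b K fun r => bcHom (S.res h) A (S.frame b J r)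
  -- This is the `k`-fold tensor power of `e_0 ⊗ ⋯ ⊗ e_(n-1)` for the frame vectors `e_r`; each
  -- block has `J`-minor `1`.
  refine ⟨(piMat fun _ : Fin k × Fin n => M).mulVec (Pi.single Prod.snd 1), ?_, ?_⟩
  · rw [ProjSys.mem_iff_self _ hW, Matrix.mulVec_mulVec]
    change Matrix.mulVec (piMat (fun _ => (E.lmSys K b).p hW) * piMat fun _ => M) _ = _
    rw [piMat_mul, lmSys_mul_frameMat b K E hW he]
  · rw [minorFun_piMat_mulVec, det_frameMat_submatrix, coordMat_res_frame b h, Matrix.det_one,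
      map_one, one_pow, one_mul, minorFun, Finset.sum_eq_single Prod.snd]
    · rw [Pi.single_eq_same, mul_one, minorCoef]
      refine Finset.prod_eq_one fun c _ => ?_
      rw [← Matrix.det_one (n := Fin n)]
      congr 1
      ext r s
      simp [Matrix.one_apply]
    · intro q _ hq
      rw [Pi.single_eq_of_ne hq, mul_zero]
    · exact fun h => absurd (Finset.mem_univ _) h

variable [FiniteDimensional F K]

/-- The power of a minor as a functional on a power of the tautological sheaf. -/
def minorHom (E : S.LeftId) (l : K →ₗ[F] F) (k : ℕ) (J : Fin n → Fin (n ^ 2)) (U : S.X.Opens) :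
    Γ(((E.lmSys K b).pow (Fin k × Fin n)).sub.sheaf, U) →+ Γ(S.X, U) :=
  AddMonoidHom.mk' (fun t => evalK _ l (minorFun J (LocSub.vec _ t))) fun s t =>
    (congr_arg (fun v => evalK _ l (minorFun J v)) (map_add (LocSub.vec _) s t)).trans
      ((congr_arg (evalK _ l) (minorFun_add J _ _)).trans (map_add (evalK _ l) _ _))

omit [FiniteDimensional F A] in
lemma minorHom_apply (E : S.LeftId) (l : K →ₗ[F] F) (k : ℕ) (J : Fin n → Fin (n ^ 2))
    (U : S.X.Opens) (t : Γ(((E.lmSys K b).pow (Fin k × Fin n)).sub.sheaf, U)) :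
    minorHom b K E l k J U t = evalK _ l (minorFun J (LocSub.vec _ t)) := rfl

/-- Powers of the tautological sheaf have functionals which transform like the powers of the
sections of a line bundle. -/
def twists (hid : HasLeftIds F A n) (E : S.LeftId) (l : K →ₗ[F] F) (hl : l 1 = 1) :
    (S.charts b hid E).Twists where
  P k := ((E.lmSys K b).pow (Fin k × Fin n)).sub.sheaf
  δ := minorHom b K E l
  δ_smul k J U r t := by
    refine (minorHom_apply b K E l k J U (r • t)).trans ?_
    rw [minorHom_apply b K E l k J U t, LocSub.vec_smul]
    exact (congr_arg (evalK _ l) (minorFun_smul J r _)).trans (map_smul (evalK _ l) _ _)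
  δ_res k J U V h t := by
    refine (minorHom_apply b K E l k J V (mres _ h t)).trans ?_
    rw [minorHom_apply b K E l k J U t, LocSub.vec_mres, ← evalK_resK]
    exact congr_arg _ (resK_minorFun K h J _).symm
  δ_eq k I J U h t := by
    refine (minorHom_apply b K E l k J U t).trans ?_
    rw [minorHom_apply b K E l k I U t]
    refine (congr_arg _ (minorFun_eq b K E I J h _ (LocSub.vec_mem _ t))).trans ?_
    exact map_smul (evalK _ l) _ _
  exists_one k J := by
    obtain ⟨t, ht, h1⟩ := exists_minorFun_eq_one (k := k) b K E (S.isAffineOpen_chart b J hid E)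
      le_rfl
    refine ⟨LocSub.sec _ t ht, (minorHom_apply b K E l k J _ _).trans
      ((congr_arg (evalK _ l) h1).trans ?_)⟩
    rw [Algebra.TensorProduct.one_def, evalK_tmul, hl, one_smul]
    rfl

end Twists

end SeveriBrauer
end SB

end

/-! ### Generation -/

noncomputable section
set_option linter.unusedVariables false
namespace SB

namespace SeveriBrauer

variable {F A : Type u} [Field F] [Ring A] [Algebra F A] {n : ℕ} {S : SeveriBrauer F A n}
  {K : Type u} [Field K] [Algebra F K]

lemma LeftId.rankOne_rhoSys [NeZero n] (E : S.LeftId) (ρ : A →ₐ[F] Matrix (Fin n) (Fin n) K)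
    (b : Module.Basis (Fin (n ^ 2)) F A) (hρ : LinearIndependent K fun i => ρ (b i)) :
    (E.rhoSys ρ).RankOne where
  minor hW := (rankOne_leftIdentity ρ b hρ (S.idealOn hW) (E.mem hW) (E.mul_eq hW)).1
  trace hW := (rankOne_leftIdentity ρ b hρ (S.idealOn hW) (E.mem hW) (E.mul_eq hW)).2

/-- Tensor powers indexed by equivalent types are isomorphic. -/
def ProjSys.powCongr [FiniteDimensional F K] {ι : Type} [Fintype ι] [DecidableEq ι]
    (Q : S.ProjSys K ι) {T T' : Type} [Fintype T] [DecidableEq T] [Fintype T'] [DecidableEq T']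
    (σ : T ≃ T') : (Q.pow T).sub.sheaf ≅ (Q.pow T').sub.sheaf :=
  ProjSys.reindexIso _ _ (σ.arrowCongr (Equiv.refl ι)).symm fun W hW a c =>
    (σ.prod_comp fun t => Q.p hW (a t) (c t)).symm

variable [FiniteDimensional F A] [FiniteDimensional F K]

variable (S) in
lemma addOf_tensorPow_T (i : Fin n) : AddOf (tensorPow S.taut i) S.T := by
  have : HasFiniteBiproducts S.X.Modules := Abelian.hasFiniteBiproducts
  exact .of_retract (biproduct.ι (fun i : Fin n => tensorPow S.taut i) i)
    (biproduct.π (fun i : Fin n => tensorPow S.taut i) i) (biproduct.ι_π_self _ i)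

variable (K) in
include K in
lemma isQcoh_T (E : S.LeftId) (b : Module.Basis (Fin (n ^ 2)) F A) : isQcoh S.X S.T := by
  have : HasFiniteBiproducts S.X.Modules := Abelian.hasFiniteBiproducts
  exact (isQcoh S.X).prop_of_isLimit (biproduct.isLimit fun i : Fin n => tensorPow S.taut i)
    fun i => isQcoh_tensorPow K E b _

/-- The thick subcategory generated by `𝒯` contains all tensor powers of the tautological
sheaf. -/
theorem pow_of_T [NeZero n] (E : S.LeftId) (ρ : A →ₐ[F] Matrix (Fin n) (Fin n) K)
    (b : Module.Basis (Fin (n ^ 2)) F A) (hρ : LinearIndependent K fun i => ρ (b i))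
    {P : S.X.Modules → Prop} (hP : IsThickProp P) (hT : P S.T) (m : ℕ) :
    P ((E.lmSys K b).pow (Fin m)).sub.sheaf :=
  hP.add (E.addOf_lm_rho ρ b hρ (Fin m)) <|
    pow_of_isThickProp _ (E.rankOne_rhoSys ρ b hρ) hP
      (fun k hk => hP.add (((E.addOf_rho_lm ρ b hρ (Fin k)).trans (addOf_tensorPow E b k).2).trans
        (S.addOf_tensorPow_T ⟨k, hk⟩)) hT) (NeZero.pos n) m

theorem generates_T [NeZero n] (ρ : A →ₐ[F] Matrix (Fin n) (Fin n) K)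
    (b : Module.Basis (Fin (n ^ 2)) F A) (hρ : LinearIndependent K fun i => ρ (b i))
    [HasDerivedCategory.{w} (Qcoh S.X)] :
    ∃ hT : isQcoh S.X S.T,
      Generates ((DerivedCategory.singleFunctor (Qcoh S.X) 0).obj ⟨S.T, hT⟩) := by
  obtain ⟨E⟩ := S.nonempty_leftId ρ b hρ
  have hid : HasLeftIds F A n := hasLeftIds ρ b hρ
  obtain ⟨l, hl⟩ : ∃ f : K →ₗ[F] F, f 1 = 1 := by
    obtain ⟨g, hg⟩ := (Algebra.linearMap F K).exists_leftInverse_of_injective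
      (LinearMap.ker_eq_bot.2 (algebraMap F K).injective)
    exact ⟨g, by simpa using LinearMap.congr_fun hg 1⟩
  have hT : isQcoh S.X S.T := isQcoh_T K E b
  refine ⟨hT, fun M hM => isZero_of_leftOrth_separating M fun {Z H} g hg => ?_⟩
  have hP := isThickProp_qcohOrth M
  let Tw := twists b K hid E l hl
  -- The twist `P k` is the power indexed by `Fin k × Fin n`, that is, the power of exponent `k *
  -- n`.
  have hTw (k : ℕ) : QcohOrth M (Tw.P k) :=
    hP.add (.of_iso ((E.lmSys K b).powCongr finProdFinEquiv))
      (pow_of_T E ρ b hρ hP ⟨hT, hM⟩ (k * n))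
  ext1
  refine Tw.separating Z.property g.hom fun k φ => ?_
  obtain ⟨hq, ho⟩ := hTw k
  exact congr(($(hg ⟨_, hq⟩ ho ⟨φ⟩)).hom)

end SeveriBrauer
end SB
end

theorem mainTheorem6 (F A : Type u) [Field F] [Ring A] [Algebra F A] [FiniteDimensional F A]
    [Algebra.IsCentral F A] [IsSimpleRing A] (n : ℕ) (hn : Module.finrank F A = n ^ 2)
    (S : SB.SeveriBrauer F A n) [HasDerivedCategory.{w} (SB.Qcoh S.X)] :
    ∃ hT : SB.isQcoh S.X S.T,
      SB.Generates ((DerivedCategory.singleFunctor (SB.Qcoh S.X) 0).obj ⟨S.T, hT⟩) := by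
  -- For `n = 0` the nonzero algebra `A` would have dimension `0`.
  have : NeZero n := ⟨by
    rintro rfl
    exact Module.finrank_pos.ne' hn⟩
  obtain ⟨K, _, _, _, ρ, hρ⟩ := SB.exists_splitting (F := F) (A := A) n hn
  let b : Module.Basis (Fin (n ^ 2)) F A := Module.finBasisOfFinrankEq F A hn
  exact SB.SeveriBrauer.generates_T ρ b (hρ b)
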